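/- Let $d\ge 1$ and $\mathbb{T}^d=(\mathbb{R}/2\pi\mathbb{Z})^d$. Let $s_0,b_0,b_1$ be real numbers with $$s_0>\max\left(0,\tfrac d2-1\right),\qquad \tfrac12<b_0<\min\left(\tfrac12+\tfrac14\left(s_0-\tfrac d2+1\right),\tfrac34\right),\qquad b_1=1-b_0.$$ Write $\langle x\rangle=(1+|x|^2)^{1/2}$ and, for $f$ on $\mathbb{T}^d$ and $k\in\mathbb{Z}^d$, $\widehat f(k)=(2\pi)^{-d}\int_{\mathbb{T}^d}f(x)e^{-i\langle k,x\rangle}\,dx$. For $\tau\in(0,1]$ let $\Pi_\tau f=\sum_{k\in\mathbb{Z}^d,\ \max_j|k_j|\le\tau^{-1/2}}\widehat f(k)e^{i\langle k,x\rangle}$. For a sequence $(u_n)_{n\in\mathbb{Z}}$ of functions on $\mathbb{T}^d$ let $$\|u_n\|_{l^4_\tau L^4}=\Big(\tau\sum_{n\in\mathbb{Z}}\|u_n\|_{L^4(\mathbb{T}^d)}^4\Big)^{1/4},\qquad \widetilde{u_n}(\sigma,k)=\tau\sum_{m\in\mathbb{Z}}\widehat{u_m}(k)e^{im\tau\sigma},$$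 where for each $k$ the series is taken in $L^2$ of the period $\sigma\in(-\pi/\tau,\pi/\tau]$, and $$\|u_n\|_{X^{s,b}_\tau}=\Big(\sum_{k\in\mathbb{Z}^d}\int_{-\pi/\tau}^{\pi/\tau}\langle k\rangle^{2s}\,\langle d_\tau(\sigma-|k|^2)\rangle^{2b}\,|\widetilde{u_n}(\sigma,k)|^2\,d\sigma\Big)^{1/2},\qquad d_\tau(\sigma)=\frac{e^{i\tau\sigma}-1}{\tau};$$ for $s,b\ge0$, the space $X^{s,b}_\tau$ consists of the sequences of integrable functions for which this norm is finite. Then there is a constant $C$, depending only on $d,s_0,b_0$ (and in particular not on $\tau$), such that for every $\tau\in(0,1]$: 1. for all $(u_n)_n\in X^{s_0/2,b_1}_\tau$, $$\|\Pi_\tau u_n\|_{l^4_\tau L^4}\le C\,\|u_n\|_{X^{s_0/2,b_1}_\tau};$$ 2. for all $(u_{n,1})_n,(u_{n,2})_n,(u_{n,3})_n\in X^{s_0,b_1}_\tau$, $$\|\Pi_\tau(\Pi_\tau u_{n,1}\,\Pi_\tau\overline{u}_{n,2}\,\Pi_\tau u_{n,3})\|_{X^{s_0,-b_1}_\tau}\le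 C\,\|u_{n,1}\|_{X^{s_0,b_1}_\tau}\|u_{n,2}\|_{X^{s_0,b_1}_\tau}\|u_{n,3}\|_{X^{s_0,b_1}_\tau};$$ 3. for every permutation $\pi$ of $\{1,2,3\}$ and all $(u_{n,i})_n$, $i=1,2,3$, with $(u_{n,\pi(1)})_n,(u_{n,\pi(2)})_n\in X^{s_0,b_1}_\tau$ and $(u_{n,\pi(3)})_n\in X^{0,b_1}_\tau$, $$\|\Pi_\tau(\Pi_\tau u_{n,1}\,\Pi_\tau\overline{u}_{n,2}\,\Pi_\tau u_{n,3})\|_{X^{0,-b_1}_\tau}\le C\,\|u_{n,\pi(1)}\|_{X^{s_0,b_1}_\tau}\|u_{n,\pi(2)}\|_{X^{s_0,b_1}_\tau}\|u_{n,\pi(3)}\|_{X^{0,b_1}_\tau}.$$ -/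

import Mathlib

open MeasureTheory
open scoped ENNReal NNReal

noncomputable section

namespace DiscBourgain

instance fact_two_pi_pos : Fact ((0 : ℝ) < 2 * Real.pi) := ⟨Real.two_pi_pos⟩

/-- The torus `𝕋^d = (ℝ / 2πℤ)^d`; its `volume` is Lebesgue measure, of total mass `(2π)^d`. -/
abbrev Torus (d : ℕ) : Type := Fin d → AddCircle (2 * Real.pi)

/-- The Japanese bracket `⟨x⟩ = (1 + |x|²)^{1/2}`. -/
def bracket {E : Type*} [Norm E] (x : E) : ℝ := (1 + ‖x‖ ^ 2) ^ (1 / 2 : ℝ)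

/-- A frequency `k ∈ ℤ^d` as a vector of Euclidean space, so that `‖freqVec k‖ = |k|`. -/
def freqVec {d : ℕ} (k : Fin d → ℤ) : EuclideanSpace ℝ (Fin d) :=
  WithLp.toLp 2 fun j => (k j : ℝ)

/-- The character `e^{i⟨k,x⟩}` of the torus. -/
def character {d : ℕ} (k : Fin d → ℤ) (x : Torus d) : ℂ := ∏ j, fourier (k j) (x j)

/-- On representatives, `character k` is `x ↦ e^{i⟨k,x⟩}`. -/
theorem character_coe {d : ℕ} (k : Fin d → ℤ) (x : Fin d → ℝ) :
    character k (fun j => (x j : AddCircle (2 * Real.pi))) =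
      Complex.exp (Complex.I * ∑ j, (k j : ℂ) * (x j : ℂ)) := by
  simp only [character, fourier_coe_apply, Finset.mul_sum, Complex.exp_sum]
  refine Finset.prod_congr rfl fun j _ => ?_
  congr 1
  have : (Real.pi : ℂ) ≠ 0 := by exact_mod_cast Real.pi_ne_zero
  push_cast
  field_simp

/-- The Fourier coefficient `f̂(k) = (2π)^{-d} ∫_{𝕋^d} f(x) e^{-i⟨k,x⟩} dx`. -/
def spaceCoeff {d : ℕ} (f : Torus d → ℂ) (k : Fin d → ℤ) : ℂ :=
  (1 / (2 * Real.pi) ^ d : ℂ) * ∫ x, f x * character (-k) x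

/-- The frequencies kept by the filter: `k ∈ ℤ^d` with `τ^{1/2} k ∈ [-1,1]^d`. -/
def filterSet (d : ℕ) (τ : ℝ) : Finset (Fin d → ℤ) :=
  Fintype.piFinset fun _ => Finset.Icc (-⌊τ ^ (-(1 / 2) : ℝ)⌋) ⌊τ ^ (-(1 / 2) : ℝ)⌋

theorem mem_filterSet {d : ℕ} {τ : ℝ} {k : Fin d → ℤ} :
    k ∈ filterSet d τ ↔ ∀ j, |(k j : ℝ)| ≤ τ ^ (-(1 / 2) : ℝ) := by
  simp only [filterSet, Fintype.mem_piFinset, Finset.mem_Icc, abs_le]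
  refine forall_congr' fun j => ?_
  rw [neg_le, Int.le_floor, Int.le_floor]
  push_cast
  rw [neg_le]

/-- The frequency filter `Π_τ = χ(-i∇ / τ^{-1/2})`, with `χ` the characteristic function of the
cube `[-1,1]^d`. -/
def filterOp {d : ℕ} (τ : ℝ) (f : Torus d → ℂ) (x : Torus d) : ℂ :=
  ∑ k ∈ filterSet d τ, spaceCoeff f k * character k x

/-- Lebesgue measure `dσ` on the period `(-π/τ, π/τ]` of the time frequency. -/
def timeFreqMeasure (τ : ℝ) : Measure ℝ :=
  volume.restrict (Set.Ioc (-(Real.pi / τ)) (Real.pi / τ))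

instance (τ : ℝ) : IsFiniteMeasure (timeFreqMeasure τ) := by
  unfold timeFreqMeasure
  infer_instance

/-- The function `σ ↦ e^{imτσ}`. -/
def timeMode (τ : ℝ) (m : ℤ) (σ : ℝ) : ℂ := Complex.exp (Complex.I * m * τ * σ)

theorem memLp_timeMode (τ : ℝ) (m : ℤ) : MemLp (timeMode τ m) 2 (timeFreqMeasure τ) := by
  refine MemLp.of_bound (C := 1) ?_ (Filter.Eventually.of_forall fun σ => ?_)
  · refine Continuous.aestronglyMeasurable ?_
    unfold timeMode
    fun_prop
  · have h : Complex.I * m * τ * σ = ((m * τ * σ : ℝ) : ℂ) * Complex.I := by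
      push_cast
      ring
    rw [timeMode, h, Complex.norm_exp_ofReal_mul_I]

/-- The `m`-th term `τ û_m(k) e^{imτσ}` of the time-space Fourier series, as an element of
`L²(dσ)` over one period. -/
def transformTerm {d : ℕ} (τ : ℝ) (u : ℤ → Torus d → ℂ) (k : Fin d → ℤ) (m : ℤ) :
    Lp ℂ 2 (timeFreqMeasure τ) :=
  (τ * spaceCoeff (u m) k : ℂ) • (memLp_timeMode τ m).toLp (timeMode τ m)

/-- The time-space Fourier transform `ũ(σ,k) = τ ∑_m û_m(k) e^{imτσ}`, the series being summed
in `L²(dσ)` over one period, for each `k`. -/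
def transform {d : ℕ} (τ : ℝ) (u : ℤ → Torus d → ℂ) (k : Fin d → ℤ) :
    Lp ℂ 2 (timeFreqMeasure τ) :=
  ∑' m, transformTerm τ u k m

/-- `d_τ(σ) = (e^{iτσ} - 1) / τ`. -/
def dTau (τ σ : ℝ) : ℂ := (Complex.exp (Complex.I * τ * σ) - 1) / τ

open Classical in
/-- The norm `‖⟨k⟩^s ⟨d_τ(σ - |k|²)⟩^b ũ(σ,k)‖_{L²l²}` of `X^{s,b}_τ`, with values in `[0,∞]`.
It is `∞` if one of the series defining `ũ(·,k)` does not converge in `L²`. -/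
def bourgainNorm {d : ℕ} (τ s b : ℝ) (u : ℤ → Torus d → ℂ) : ℝ≥0∞ :=
  if ∀ k, Summable (transformTerm τ u k) then
    (∑' k : Fin d → ℤ, ∫⁻ σ,
      ENNReal.ofReal (bracket (freqVec k) ^ s * bracket (dTau τ (σ - ‖freqVec k‖ ^ 2)) ^ b *
        ‖transform τ u k σ‖) ^ 2 ∂(timeFreqMeasure τ)) ^ (1 / 2 : ℝ)
  else ∞

/-- Membership in `X^{s,b}_τ` (used for `s, b ≥ 0`): a sequence of functions on the torus, each
integrable so that it has Fourier coefficients, of finite norm. -/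
def MemBourgain {d : ℕ} (τ s b : ℝ) (u : ℤ → Torus d → ℂ) : Prop :=
  (∀ n, Integrable (u n)) ∧ bourgainNorm τ s b u < ∞

/-- The norm `‖u_n‖_{l^p_τ L^p} = (τ ∑_n ‖u_n‖_{L^p}^p)^{1/p}` for `0 < p < ∞`. -/
def seqLpNorm {d : ℕ} (p : ℝ≥0) (τ : ℝ) (u : ℤ → Torus d → ℂ) : ℝ≥0∞ :=
  (ENNReal.ofReal τ * ∑' n, eLpNorm (u n) p volume ^ (p : ℝ)) ^ (1 / (p : ℝ))

/-- The filtered cubic term `Π_τ(Π_τ u_{n,1} Π_τ ū_{n,2} Π_τ u_{n,3})`. -/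
def cubic {d : ℕ} (τ : ℝ) (u : Fin 3 → ℤ → Torus d → ℂ) (n : ℤ) : Torus d → ℂ :=
  filterOp τ fun x =>
    filterOp τ (u 0 n) x * filterOp τ (fun y => starRingEnd ℂ (u 1 n y)) x * filterOp τ (u 2 n) x

end DiscBourgain

end

open DiscBourgain

/-
Under the time-space Fourier transform, sequences of functions on the torus become functions on
the group `ℝ / (2π/τ)ℤ × ℤ^d`, and pointwise products become convolutions on it. All three
estimates follow from one bilinear estimate `‖f * g‖_{L²} ≲ ‖f‖_{X^{s,b}} ‖g‖_{X^{0,b}}` for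
functions in the frequency band of `Π_τ`: by Parseval the `L⁴` norm of `Π_τ u` is the `L²` norm of
a convolution square, and by duality and Cauchy–Schwarz two applications of the bilinear estimate
bound the trilinear form, the weight `⟨k⟩^s` of the output being moved onto one of the three
factors.

By Cauchy–Schwarz the bilinear estimate holds as soon as the convolution of the squared inverse
weights `⟨k⟩^{-2s} ⟨d_τ(σ - |k|²)⟩^{-2b}` and `⟨d_τ(σ - |k|²)⟩^{-2b}` is bounded. In time, two
weights of exponent `2b` convolve to one of exponent `4b - 1`. As
`|p|² + |k - p|² = (|k|² + |2p - k|²) / 2`, and as this quantity stays within boundedly many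
periods `2π/τ` in the frequency band, there remain the lattice sums
`∑_p ⟨p⟩^{-2s} ⟨c - |2p - k|² / 2⟩^{-(4b-1)}`, to be bounded uniformly in `c` and `k`. One
coordinate at a time these reduce to the dimensions one and two. In dimension two, a circle
carries `O(B^ε)` lattice points at mutual distances at most `√B`, whatever its radius: if the
radius is large compared with `B`, three such points would span a triangle of area less than
`1 / 2`, and otherwise the divisor bound for sums of two squares applies.
-/

noncomputable section

namespace DiscBourgain

/-! ### Representations as a sum of two squares -/

/-- The representations `m = x² + y²`, as Gaussian integers `x + iy` of norm `m`. -/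
def normFiber (m : ℕ) : Set GaussianInt := {z | z.norm.natAbs = m}

theorem mem_normFiber_iff {m : ℕ} {z : GaussianInt} : z ∈ normFiber m ↔ z * star z = m := by
  rw [← Zsqrtd.norm_eq_mul_conj, ← Int.cast_natCast, Int.cast_inj, normFiber, Set.mem_ofPred_eq,
    ← Int.natCast_inj, Int.natAbs_of_nonneg (GaussianInt.norm_nonneg z)]

theorem finite_normFiber (m : ℕ) : (normFiber m).Finite := by
  refine ((Set.finite_Icc (-m : ℤ) m).prod (Set.finite_Icc (-m : ℤ) m)).preimage
    (f := fun z : GaussianInt => (z.re, z.im)) (fun z _ w _ h => ?_) |>.subset fun z hz => ?_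
  · exact Zsqrtd.ext (congrArg Prod.fst h) (congrArg Prod.snd h)
  · have hz : z.re.natAbs * z.re.natAbs + z.im.natAbs * z.im.natAbs = m :=
      (GaussianInt.natAbs_norm_eq z).symm.trans hz
    have hre := Nat.le_mul_self z.re.natAbs
    have him := Nat.le_mul_self z.im.natAbs
    simp only [Set.mem_preimage, Set.mem_prod, Set.mem_Icc]
    omega

theorem mem_normFiber_one_iff {z : GaussianInt} : z ∈ normFiber 1 ↔ IsUnit z :=
  Zsqrtd.norm_eq_one_iff

theorem ncard_normFiber_one_le : (normFiber 1).ncard ≤ 4 := by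
  have hsub : normFiber 1 ⊆ ({⟨1, 0⟩, ⟨-1, 0⟩, ⟨0, 1⟩, ⟨0, -1⟩} : Finset GaussianInt) := by
    rintro ⟨x, y⟩ hz
    have hz : x.natAbs * x.natAbs + y.natAbs * y.natAbs = 1 :=
      (GaussianInt.natAbs_norm_eq ⟨x, y⟩).symm.trans hz
    have hx : x.natAbs ≤ 1 := (Nat.le_mul_self _).trans (by omega)
    have hy : y.natAbs ≤ 1 := (Nat.le_mul_self _).trans (by omega)
    have hx' : -1 ≤ x ∧ x ≤ 1 := by omega
    have hy' : -1 ≤ y ∧ y ≤ 1 := by omega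
    obtain ⟨hx₁, hx₂⟩ := hx'
    obtain ⟨hy₁, hy₂⟩ := hy'
    interval_cases x <;> interval_cases y <;> simp_all
  exact (Set.ncard_le_ncard hsub (Finset.finite_toSet _)).trans
    ((Set.ncard_coe_finset _).le.trans Finset.card_le_four)

theorem exists_lt_mem_normFiber_of_mul_mem {p e : ℕ} (hp : p.Prime) {r w : GaussianInt}
    (hr : ¬ IsUnit r) (h : r * w ∈ normFiber (p ^ e)) : ∃ e' < e, w ∈ normFiber (p ^ e') := by
  have hmul : r.norm.natAbs * w.norm.natAbs = p ^ e := by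
    rw [← Int.natAbs_mul, ← Zsqrtd.norm_mul]
    exact h
  obtain ⟨e', he', hw⟩ := (Nat.dvd_prime_pow hp).1 (Dvd.intro_left _ hmul)
  refine ⟨e', he'.lt_of_ne ?_, hw⟩
  rintro rfl
  rw [hw] at hmul
  exact hr (Zsqrtd.norm_eq_one_iff.1 ((Nat.mul_eq_right (pow_pos hp.pos _).ne').1 hmul))

theorem exists_eq_unit_mul_pow_mul_star_pow {p : ℕ} (hp : p.Prime) {q : GaussianInt} (hq : Prime q)
    (hqp : q ∣ (p : GaussianInt)) {e : ℕ} {z : GaussianInt} (hz : z ∈ normFiber (p ^ e)) :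
    ∃ w, IsUnit w ∧ ∃ a ≤ e, ∃ b ≤ e, z = w * q ^ a * star q ^ b := by
  induction e using Nat.strong_induction_on generalizing z with
  | _ e ih =>
  rcases Nat.eq_zero_or_pos e with rfl | he
  · exact ⟨z, mem_normFiber_one_iff.1 hz, 0, le_rfl, 0, le_rfl, by simp⟩
  have hdvd : q ∣ z * star z := by
    rw [mem_normFiber_iff.1 hz, Nat.cast_pow]
    exact hqp.trans (dvd_pow_self _ he.ne')
  have hstar : ¬ IsUnit (star q) := fun h => hq.not_isUnit (by simpa using h.star)
  rcases hq.dvd_or_dvd hdvd with ⟨c, rfl⟩ | ⟨c, hc⟩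
  · obtain ⟨e', he', hn⟩ := exists_lt_mem_normFiber_of_mul_mem hp hq.not_isUnit hz
    obtain ⟨w, hw, a, ha, b, hb, rfl⟩ := ih e' he' hn
    exact ⟨w, hw, a + 1, by omega, b, by omega, by ring⟩
  · obtain rfl : z = star q * star c := by rw [← star_star z, hc, star_mul']
    obtain ⟨e', he', hn⟩ := exists_lt_mem_normFiber_of_mul_mem hp hstar hz
    obtain ⟨w, hw, a, ha, b, hb, hwc⟩ := ih e' he' hn
    exact ⟨w, hw, a, by omega, b + 1, by omega, by rw [hwc]; ring⟩

theorem ncard_normFiber_prime_pow_le {p : ℕ} (hp : p.Prime) (e : ℕ) :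
    (normFiber (p ^ e)).ncard ≤ 4 * (e + 1) ^ 2 := by
  have hnonunit : ¬ IsUnit (p : GaussianInt) := by
    rw [← Zsqrtd.norm_eq_one_iff, Zsqrtd.norm_natCast, ← Nat.cast_mul, Int.natAbs_natCast,
      mul_eq_one]
    exact fun h => hp.ne_one h.1
  obtain ⟨q, hq, hqp⟩ := WfDvdMonoid.exists_irreducible_factor hnonunit
    (Nat.cast_ne_zero.2 hp.ne_zero)
  let units := (finite_normFiber 1).toFinset
  let exponents := Finset.range (e + 1) ×ˢ Finset.range (e + 1)
  let products := (units ×ˢ exponents).image fun t => t.1 * q ^ t.2.1 * star q ^ t.2.2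
  have hsub : normFiber (p ^ e) ⊆ products := by
    intro z hz
    obtain ⟨w, hw, a, ha, b, hb, rfl⟩ := exists_eq_unit_mul_pow_mul_star_pow hp hq.prime hqp hz
    refine Finset.mem_image.2 ⟨(w, a, b), ?_, rfl⟩
    simp only [units, exponents, Finset.mem_product, Finset.mem_range, Set.Finite.mem_toFinset,
      mem_normFiber_one_iff]
    exact ⟨hw, by omega, by omega⟩
  calc (normFiber (p ^ e)).ncard ≤ products.card :=
        (Set.ncard_le_ncard hsub (Finset.finite_toSet _)).trans (Set.ncard_coe_finset _).le
    _ ≤ units.card * exponents.card := Finset.card_image_le.trans (Finset.card_product _ _).le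
    _ ≤ 4 * (e + 1) ^ 2 := by
        rw [Finset.card_product, Finset.card_range, sq,
          ← Set.ncard_eq_toFinset_card _ (finite_normFiber 1)]
        exact Nat.mul_le_mul_right _ ncard_normFiber_one_le

theorem normFiber_mul_subset {a b : ℕ} (hab : a.Coprime b) :
    normFiber (a * b) ⊆ Set.image2 (· * ·) (normFiber a) (normFiber b) := by
  intro z hz
  have hdvd : z ∣ (a : GaussianInt) * b := ⟨star z, by
    rw [mem_normFiber_iff.1 hz, Nat.cast_mul]⟩
  obtain ⟨x, y, ⟨x', hx⟩, ⟨y', hy⟩, rfl⟩ := exists_dvd_and_dvd_of_dvd_mul hdvd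
  have natAbs_norm_mul (u v : GaussianInt) :
      (u * v).norm.natAbs = u.norm.natAbs * v.norm.natAbs := by
    rw [Zsqrtd.norm_mul, Int.natAbs_mul]
  have natAbs_norm_natCast (n : ℕ) : (n : GaussianInt).norm.natAbs = n * n := by
    rw [Zsqrtd.norm_natCast, ← Nat.cast_mul, Int.natAbs_natCast]
  have hxa : x.norm.natAbs ∣ a * a :=
    ⟨x'.norm.natAbs, by rw [← natAbs_norm_mul, ← hx, natAbs_norm_natCast]⟩
  have hyb : y.norm.natAbs ∣ b * b :=
    ⟨y'.norm.natAbs, by rw [← natAbs_norm_mul, ← hy, natAbs_norm_natCast]⟩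
  have hxy : x.norm.natAbs * y.norm.natAbs = a * b := (natAbs_norm_mul x y).symm.trans hz
  have hxb : x.norm.natAbs.Coprime b := .of_dvd_left hxa (hab.mul_left hab)
  have hya : y.norm.natAbs.Coprime a := .of_dvd_left hyb (hab.symm.mul_left hab.symm)
  refine ⟨x, Nat.dvd_antisymm ?_ ?_, y, Nat.dvd_antisymm ?_ ?_, rfl⟩
  · exact hxb.dvd_of_dvd_mul_right (Dvd.intro _ hxy)
  · exact hya.symm.dvd_of_dvd_mul_right (Dvd.intro _ hxy.symm)
  · exact hya.dvd_of_dvd_mul_left (Dvd.intro_left _ hxy)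
  · exact hxb.symm.dvd_of_dvd_mul_left (Dvd.intro_left _ hxy.symm)

theorem ncard_normFiber_mul_le {a b : ℕ} (hab : a.Coprime b) :
    (normFiber (a * b)).ncard ≤ (normFiber a).ncard * (normFiber b).ncard := by
  rw [← Set.ncard_prod]
  refine (Set.ncard_le_ncard (normFiber_mul_subset hab)
    ((finite_normFiber a).image2 _ (finite_normFiber b))).trans ?_
  rw [← Set.image_prod]
  exact Set.ncard_image_le ((finite_normFiber a).prod (finite_normFiber b))

theorem exists_const_mul_pow_le_mul_pow (A : ℝ) (k : ℕ) {x : ℝ} (hx : 1 < x) :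
    ∃ B : ℝ, 1 ≤ B ∧ ∀ e : ℕ, A * ((e : ℝ) + 1) ^ k ≤ B * x ^ e := by
  have : 0 < x := one_pos.trans hx
  have hlim : Filter.Tendsto (fun n : ℕ => A * x * (((n + 1 : ℕ) : ℝ) ^ k / x ^ (n + 1)))
      Filter.atTop (nhds (A * x * 0)) :=
    (((tendsto_pow_const_div_const_pow_of_one_lt k hx).comp
      (Filter.tendsto_add_atTop_nat 1)).const_mul _)
  obtain ⟨B, hB⟩ := hlim.bddAbove_range
  refine ⟨max 1 B, le_max_left _ _, fun e => ?_⟩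
  have hBe : A * x * (((e + 1 : ℕ) : ℝ) ^ k / x ^ (e + 1)) ≤ B := hB ⟨e, rfl⟩
  calc A * ((e : ℝ) + 1) ^ k = A * x * (((e + 1 : ℕ) : ℝ) ^ k / x ^ (e + 1)) * x ^ e := by
        push_cast
        field_simp
        ring
    _ ≤ max 1 B * x ^ e := by
        gcongr
        exact hBe.trans (le_max_right _ _)

theorem mul_succ_pow_le_pow (A k : ℕ) {e : ℕ} (he : e ≠ 0) :
    A * (e + 1) ^ k ≤ (A * 2 ^ k) ^ e := by
  rw [mul_pow, ← pow_mul, mul_comm k, pow_mul]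
  gcongr
  · exact Nat.le_self_pow he A
  · exact Nat.lt_two_pow_self

theorem natCast_pow_rpow (p e : ℕ) (ε : ℝ) : ((p ^ e : ℕ) : ℝ) ^ ε = ((p : ℝ) ^ ε) ^ e := by
  rw [Nat.cast_pow, ← Real.rpow_natCast_mul (Nat.cast_nonneg p), mul_comm,
    Real.rpow_mul_natCast (Nat.cast_nonneg p)]

/-- Only the finitely many primes with `p ^ ε < A * 2 ^ k` cost more than a factor `1`. -/
theorem exists_mul_succ_pow_le_ite_mul_rpow (A k : ℕ) {ε : ℝ} (hε : 0 < ε) :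
    ∃ B : ℝ, 1 ≤ B ∧ ∃ P : ℕ, ∀ p e : ℕ, p.Prime → e ≠ 0 →
      (A : ℝ) * ((e : ℝ) + 1) ^ k ≤ (if p < P then B else 1) * ((p ^ e : ℕ) : ℝ) ^ ε := by
  obtain ⟨B, hB1, hB⟩ := exists_const_mul_pow_le_mul_pow A k (Real.one_lt_rpow one_lt_two hε)
  obtain ⟨P, hP⟩ : ∃ P : ℕ, ((A * 2 ^ k : ℕ) : ℝ) ≤ (P : ℝ) ^ ε :=
    (((tendsto_rpow_atTop hε).comp tendsto_natCast_atTop_atTop).eventually_ge_atTop _).exists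
  refine ⟨B, hB1, P, fun p e hp he => ?_⟩
  rw [natCast_pow_rpow]
  split_ifs with hpP
  · have hp2 : (2 : ℝ) ≤ p := mod_cast hp.two_le
    exact (hB e).trans (by gcongr)
  · have hPp : (P : ℝ) ≤ p := mod_cast not_lt.1 hpP
    calc (A : ℝ) * ((e : ℝ) + 1) ^ k ≤ ((A * 2 ^ k : ℕ) : ℝ) ^ e :=
          mod_cast mul_succ_pow_le_pow A k he
      _ ≤ ((p : ℝ) ^ ε) ^ e := by
          gcongr
          exact hP.trans (by gcongr)
      _ = 1 * ((p : ℝ) ^ ε) ^ e := (one_mul _).symm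

theorem prod_ite_lt_le_pow {B : ℝ} (hB : 1 ≤ B) (s : Finset ℕ) (P : ℕ) :
    ∏ p ∈ s, (if p < P then B else 1) ≤ B ^ P := by
  rw [Finset.prod_ite, Finset.prod_const, Finset.prod_const_one, mul_one]
  refine pow_le_pow_right₀ hB ?_
  calc (s.filter (· < P)).card ≤ (Finset.range P).card :=
        Finset.card_le_card fun p hp => Finset.mem_range.2 (Finset.mem_filter.1 hp).2
    _ = P := Finset.card_range P

theorem le_prod_primeFactors_mul_rpow {f : ℕ → ℕ} {h : ℕ → ℝ} {ε : ℝ}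
    (hmul : ∀ a b, a.Coprime b → f (a * b) ≤ f a * f b)
    (hpow : ∀ p e : ℕ, p.Prime → e ≠ 0 → (f (p ^ e) : ℝ) ≤ h p * ((p ^ e : ℕ) : ℝ) ^ ε)
    {m : ℕ} (hm : 1 < m) : (f m : ℝ) ≤ (∏ p ∈ m.primeFactors, h p) * (m : ℝ) ^ ε := by
  induction m using Nat.recOnPosPrimePosCoprime with
  | prime_pow p e hp he =>
    rw [Nat.primeFactors_prime_pow he.ne' hp, Finset.prod_singleton]
    exact hpow p e hp he.ne'
  | zero => exact absurd hm (by decide)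
  | one => exact absurd hm (by decide)
  | coprime a b ha hb hab iha ihb =>
    rw [hab.primeFactors_mul, Finset.prod_union hab.disjoint_primeFactors, Nat.cast_mul,
      Real.mul_rpow (Nat.cast_nonneg _) (Nat.cast_nonneg _)]
    calc (f (a * b) : ℝ) ≤ f a * f b := mod_cast hmul a b hab
      _ ≤ ((∏ p ∈ a.primeFactors, h p) * (a : ℝ) ^ ε) *
          ((∏ p ∈ b.primeFactors, h p) * (b : ℝ) ^ ε) :=
          mul_le_mul (iha ha) (ihb hb) (Nat.cast_nonneg _) ((Nat.cast_nonneg _).trans (iha ha))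
      _ = _ := mul_mul_mul_comm _ _ _ _

theorem exists_le_mul_rpow_of_coprime_mul_le {f : ℕ → ℕ} {A k : ℕ}
    (hmul : ∀ a b, a.Coprime b → f (a * b) ≤ f a * f b)
    (hpow : ∀ p e, p.Prime → f (p ^ e) ≤ A * (e + 1) ^ k) {ε : ℝ} (hε : 0 < ε) :
    ∃ C : ℝ, 0 ≤ C ∧ ∀ m, m ≠ 0 → (f m : ℝ) ≤ C * (m : ℝ) ^ ε := by
  obtain ⟨B, hB1, P, hB⟩ := exists_mul_succ_pow_le_ite_mul_rpow A k hε
  have hB0 : 0 ≤ B ^ P := by positivity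
  refine ⟨A + B ^ P, by positivity, fun m hm => ?_⟩
  rcases (Nat.one_le_iff_ne_zero.2 hm).eq_or_lt with rfl | hm1
  · have hf1 : f 1 ≤ A := by simpa using hpow 2 0 Nat.prime_two
    rw [Nat.cast_one, Real.one_rpow, mul_one]
    exact (Nat.cast_le.2 hf1).trans (le_add_of_nonneg_right hB0)
  · calc (f m : ℝ) ≤ (∏ p ∈ m.primeFactors, if p < P then B else 1) * (m : ℝ) ^ ε :=
          le_prod_primeFactors_mul_rpow hmul
            (fun p e hp he => le_trans (mod_cast hpow p e hp) (hB p e hp he)) hm1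
      _ ≤ (A + B ^ P) * (m : ℝ) ^ ε := by
          gcongr
          exact (prod_ite_lt_le_pow hB1 _ P).trans (le_add_of_nonneg_left (Nat.cast_nonneg A))

theorem exists_ncard_normFiber_le {ε : ℝ} (hε : 0 < ε) :
    ∃ C : ℝ, 0 ≤ C ∧ ∀ m, m ≠ 0 → ((normFiber m).ncard : ℝ) ≤ C * (m : ℝ) ^ ε :=
  exists_le_mul_rpow_of_coprime_mul_le (fun _ _ => ncard_normFiber_mul_le)
    (fun _ e hp => ncard_normFiber_prime_pow_le hp e) hε

/-! ### Lattice points on a circle -/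

/-- The integer `|p|² = ∑ p_j²`, equal to `‖freqVec p‖²`. -/
def sqNorm {d : ℕ} (p : Fin d → ℤ) : ℤ := ∑ j, p j ^ 2

theorem norm_freqVec_sq {d : ℕ} (p : Fin d → ℤ) : ‖freqVec p‖ ^ 2 = sqNorm p := by
  simp only [EuclideanSpace.norm_sq_eq, freqVec, Real.norm_eq_abs, sq_abs, sqNorm, Int.cast_sum,
    Int.cast_pow]

theorem sqNorm_nonneg {d : ℕ} (p : Fin d → ℤ) : 0 ≤ sqNorm p :=
  Finset.sum_nonneg fun _ _ => sq_nonneg _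

theorem sqNorm_eq_zero_iff {d : ℕ} {p : Fin d → ℤ} : sqNorm p = 0 ↔ p = 0 := by
  rw [sqNorm, Finset.sum_eq_zero_iff_of_nonneg fun _ _ => sq_nonneg _, funext_iff]
  simp only [Finset.mem_univ, true_imp_iff, sq_eq_zero_iff, Pi.zero_apply]

theorem sqNorm_sub_pos {d : ℕ} {p q : Fin d → ℤ} (h : p ≠ q) : 0 < sqNorm (p - q) :=
  (sqNorm_nonneg _).lt_of_ne' (sqNorm_eq_zero_iff.not.2 (sub_ne_zero.2 h))

theorem sqNorm_sub_le {d : ℕ} (p q : Fin d → ℤ) :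
    sqNorm (p - q) ≤ 2 * (sqNorm p + sqNorm q) := by
  simp only [sqNorm, ← Finset.sum_add_distrib, Finset.mul_sum, Pi.sub_apply]
  exact Finset.sum_le_sum fun j _ => by nlinarith [sq_nonneg (p j + q j)]

theorem sqNorm_smul {d : ℕ} (n : ℤ) (p : Fin d → ℤ) : sqNorm (n • p) = n ^ 2 * sqNorm p := by
  simp only [sqNorm, Finset.mul_sum, Pi.smul_apply, smul_eq_mul, mul_pow]

/-- Heron's formula for a triangle of circumradius `√m`. -/
theorem four_mul_sq_area {R : Type*} [CommRing R] {m x₁ y₁ x₂ y₂ x₃ y₃ : R}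
    (h₁ : x₁ ^ 2 + y₁ ^ 2 = m) (h₂ : x₂ ^ 2 + y₂ ^ 2 = m) (h₃ : x₃ ^ 2 + y₃ ^ 2 = m) :
    4 * m * ((x₂ - x₁) * (y₃ - y₁) - (x₃ - x₁) * (y₂ - y₁)) ^ 2 =
      ((x₁ - x₂) ^ 2 + (y₁ - y₂) ^ 2) * ((x₂ - x₃) ^ 2 + (y₂ - y₃) ^ 2) *
        ((x₁ - x₃) ^ 2 + (y₁ - y₃) ^ 2) := by
  obtain ⟨a, ha⟩ : ∃ a, a = x₁ * x₂ + y₁ * y₂ := ⟨_, rfl⟩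
  obtain ⟨b, hb⟩ : ∃ b, b = x₂ * x₃ + y₂ * y₃ := ⟨_, rfl⟩
  obtain ⟨c, hc⟩ : ∃ c, c = x₁ * x₃ + y₁ * y₃ := ⟨_, rfl⟩
  have gram : m ^ 3 + 2 * a * b * c = m * (a ^ 2 + b ^ 2 + c ^ 2) := by
    have : (x₁ ^ 2 + y₁ ^ 2) * (x₂ ^ 2 + y₂ ^ 2) * (x₃ ^ 2 + y₃ ^ 2) + 2 * a * b * c =
        (x₁ ^ 2 + y₁ ^ 2) * b ^ 2 + (x₂ ^ 2 + y₂ ^ 2) * c ^ 2 + (x₃ ^ 2 + y₃ ^ 2) * a ^ 2 := by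
      rw [ha, hb, hc]
      ring
    rw [h₁, h₂, h₃] at this
    linear_combination this
  have side₁₂ : (x₁ - x₂) ^ 2 + (y₁ - y₂) ^ 2 = 2 * (m - a) := by
    linear_combination h₁ + h₂ + 2 * ha
  have side₂₃ : (x₂ - x₃) ^ 2 + (y₂ - y₃) ^ 2 = 2 * (m - b) := by
    linear_combination h₂ + h₃ + 2 * hb
  have side₁₃ : (x₁ - x₃) ^ 2 + (y₁ - y₃) ^ 2 = 2 * (m - c) := by
    linear_combination h₁ + h₃ + 2 * hc
  have dot : (x₂ - x₁) * (x₃ - x₁) + (y₂ - y₁) * (y₃ - y₁) = m + b - a - c := by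
    linear_combination h₁ - hb + ha + hc
  have area : ((x₂ - x₁) * (y₃ - y₁) - (x₃ - x₁) * (y₂ - y₁)) ^ 2 =
      2 * (m - a) * (2 * (m - c)) - (m + b - a - c) ^ 2 := by
    rw [← side₁₂, ← side₁₃, ← dot]
    ring
  rw [side₁₂, side₂₃, side₁₃, area]
  linear_combination 4 * gram

/-- The triangle spanned by three lattice points of a circle has area at least `1 / 2`. -/
theorem le_mul_sqNorm_sub_of_sqNorm_eq {m : ℤ} {p q r : Fin 2 → ℤ} (hp : sqNorm p = m)
    (hq : sqNorm q = m) (hr : sqNorm r = m) (hpq : p ≠ q) (hqr : q ≠ r) (hpr : p ≠ r) :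
    m ≤ sqNorm (p - q) * sqNorm (q - r) * sqNorm (p - r) := by
  have hpos := mul_pos (mul_pos (sqNorm_sub_pos hpq) (sqNorm_sub_pos hqr)) (sqNorm_sub_pos hpr)
  have hm : 0 ≤ m := hp ▸ sqNorm_nonneg p
  simp only [sqNorm, Fin.sum_univ_two, Pi.sub_apply] at hp hq hr hpos ⊢
  rw [← four_mul_sq_area hp hq hr] at hpos ⊢
  have harea : 1 ≤ ((q 0 - p 0) * (r 1 - p 1) - (r 0 - p 0) * (q 1 - p 1)) ^ 2 :=
    pos_of_mul_pos_right hpos (by positivity)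
  nlinarith

theorem card_le_ncard_normFiber {m : ℕ} {s : Finset (Fin 2 → ℤ)} (hs : ∀ p ∈ s, sqNorm p = m) :
    s.card ≤ (normFiber m).ncard := by
  rw [Set.ncard_eq_toFinset_card _ (finite_normFiber m)]
  refine Finset.card_le_card_of_injOn (fun p => (⟨p 0, p 1⟩ : GaussianInt)) (fun p hp => ?_)
    fun p _ q _ h => ?_
  · have hp := hs p hp
    rw [sqNorm, Fin.sum_univ_two] at hp
    simp only [Finset.mem_coe, Set.Finite.mem_toFinset, normFiber, Set.mem_ofPred_eq,
      Zsqrtd.norm_def]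
    rw [← Int.natAbs_natCast m, ← hp]
    ring_nf
  · obtain ⟨h₀, h₁⟩ := Zsqrtd.mk.inj h
    exact List.ofFn_inj.1 (by simp [h₀, h₁])

theorem exists_card_arc_le {ε : ℝ} (hε : 0 < ε) :
    ∃ C : ℝ, 0 ≤ C ∧ ∀ (m : ℤ) (B : ℝ), 1 ≤ B → ∀ s : Finset (Fin 2 → ℤ),
      (∀ p ∈ s, sqNorm p = m) → (∀ p ∈ s, ∀ q ∈ s, (sqNorm (p - q) : ℝ) ≤ B) →
        (s.card : ℝ) ≤ C * B ^ ε := by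
  obtain ⟨C, hC0, hC⟩ := exists_ncard_normFiber_le (ε := ε / 3) (by positivity)
  refine ⟨2 + C, by positivity, fun m B hB s hs hsB => ?_⟩
  have hBε : 1 ≤ B ^ ε := Real.one_le_rpow hB hε.le
  rcases le_or_gt s.card 2 with hcard | hcard
  · have hcard : (s.card : ℝ) ≤ 2 := mod_cast hcard
    nlinarith
  obtain ⟨p, hp, q, hq, r, hr, hpq, hpr, hqr⟩ := Finset.two_lt_card.1 hcard
  have hm0 : 0 ≤ m := hs p hp ▸ sqNorm_nonneg p
  have hm : m ≠ 0 := by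
    rintro rfl
    exact hpq ((sqNorm_eq_zero_iff.1 (hs p hp)).trans (sqNorm_eq_zero_iff.1 (hs q hq)).symm)
  have hmB : (m : ℝ) ≤ B ^ 3 := by
    have hmpqr : (m : ℝ) ≤ sqNorm (p - q) * sqNorm (q - r) * sqNorm (p - r) :=
      mod_cast le_mul_sqNorm_sub_of_sqNorm_eq (hs p hp) (hs q hq) (hs r hr) hpq hqr hpr
    have hnonneg (v : Fin 2 → ℤ) : (0 : ℝ) ≤ sqNorm v := mod_cast sqNorm_nonneg v
    calc (m : ℝ) ≤ sqNorm (p - q) * sqNorm (q - r) * sqNorm (p - r) := hmpqr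
      _ ≤ B * B * B := mul_le_mul (mul_le_mul (hsB p hp q hq) (hsB q hq r hr) (hnonneg _)
          (by positivity)) (hsB p hp r hr) (hnonneg _) (by positivity)
      _ = B ^ 3 := by ring
  lift m to ℕ using hm0
  calc (s.card : ℝ) ≤ (normFiber m).ncard := mod_cast card_le_ncard_normFiber hs
    _ ≤ C * (m : ℝ) ^ (ε / 3) := hC m (mod_cast hm)
    _ ≤ C * (B ^ 3) ^ (ε / 3) := by
        gcongr
        exact_mod_cast hmB
    _ = C * B ^ ε := by
        rw [← Real.rpow_natCast_mul (by positivity), Nat.cast_ofNat,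
          mul_div_cancel₀ ε three_ne_zero]
    _ ≤ (2 + C) * B ^ ε := by
        gcongr
        linarith

/-! ### Decaying weights and lattice sums -/

theorem one_le_bracket {E : Type*} [Norm E] (x : E) : 1 ≤ bracket x :=
  Real.one_le_rpow (by nlinarith [sq_nonneg ‖x‖]) (by norm_num)

theorem bracket_pos {E : Type*} [Norm E] (x : E) : 0 < bracket x :=
  one_pos.trans_le (one_le_bracket x)

theorem bracket_eq_sqrt {E : Type*} [Norm E] (x : E) : bracket x = √(1 + ‖x‖ ^ 2) :=
  (Real.sqrt_eq_rpow _).symm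

theorem bracket_sq {E : Type*} [Norm E] (x : E) : bracket x ^ 2 = 1 + ‖x‖ ^ 2 := by
  rw [bracket_eq_sqrt, Real.sq_sqrt (by positivity)]

/-- The decaying weight `⟨x⟩^{-ρ}`, with values in `[0,∞]` so that it can be summed freely. -/
def decay {E : Type*} [Norm E] (ρ : ℝ) (x : E) : ℝ≥0∞ := ENNReal.ofReal (bracket x ^ (-ρ))

theorem rpow_neg_le_tsum_dyadic {x δ : ℝ} (hx : 1 ≤ x) (hδ : 0 ≤ δ) :
    ENNReal.ofReal (x ^ (-δ)) ≤
      ∑' i : ℕ, if x ≤ 2 ^ (i + 1) then ENNReal.ofReal (((2 : ℝ) ^ (-δ)) ^ i) else 0 := by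
  obtain ⟨i, hlow, hup⟩ := exists_nat_pow_near hx one_lt_two
  refine le_trans ?_ (ENNReal.le_tsum i)
  rw [if_pos hup.le, Real.rpow_pow_comm zero_le_two]
  exact ENNReal.ofReal_le_ofReal
    (Real.rpow_le_rpow_of_nonpos (by positivity) hlow (neg_nonpos.2 hδ))

theorem tsum_rpow_neg_le_of_card_le {α : Type*} {N : α → ℝ} {C ε δ : ℝ} (hεδ : ε < δ)
    (hδ : 0 ≤ δ) (hN : ∀ a, 1 ≤ N a)
    (hcard : ∀ R, 1 ≤ R → ∀ s : Finset α, (∀ a ∈ s, N a ≤ R) → (s.card : ℝ) ≤ C * R ^ ε) :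
    ∑' a, ENNReal.ofReal (N a ^ (-δ)) ≤
      ENNReal.ofReal (C * (2 : ℝ) ^ ε * (1 - (2 : ℝ) ^ (ε - δ))⁻¹) := by
  classical
  have hC : 0 ≤ C := by simpa using hcard 1 le_rfl ∅ (by simp)
  have hratio : (2 : ℝ) ^ (ε - δ) < 1 :=
    Real.rpow_lt_one_of_one_lt_of_neg one_lt_two (sub_neg.2 hεδ)
  have hblock (i : ℕ) :
      ∑' a, (if N a ≤ 2 ^ (i + 1) then ENNReal.ofReal (((2 : ℝ) ^ (-δ)) ^ i) else 0) ≤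
        ENNReal.ofReal (C * (2 : ℝ) ^ ε * ((2 : ℝ) ^ (ε - δ)) ^ i) := by
    rw [ENNReal.tsum_eq_iSup_sum]
    refine iSup_le fun s => ?_
    rw [← Finset.sum_filter, Finset.sum_const, nsmul_eq_mul, ← ENNReal.ofReal_natCast,
      ← ENNReal.ofReal_mul (Nat.cast_nonneg _)]
    refine ENNReal.ofReal_le_ofReal ?_
    calc ((s.filter fun a => N a ≤ 2 ^ (i + 1)).card : ℝ) * ((2 : ℝ) ^ (-δ)) ^ i
        ≤ C * ((2 : ℝ) ^ (i + 1)) ^ ε * ((2 : ℝ) ^ (-δ)) ^ i := by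
          gcongr
          exact hcard _ (one_le_pow₀ one_le_two) _ fun a ha => (Finset.mem_filter.1 ha).2
      _ = C * (2 : ℝ) ^ ε * ((2 : ℝ) ^ (ε - δ)) ^ i := by
          rw [← Real.rpow_pow_comm zero_le_two, sub_eq_add_neg, Real.rpow_add two_pos, mul_pow,
            pow_succ]
          ring
  calc ∑' a, ENNReal.ofReal (N a ^ (-δ))
      ≤ ∑' a, ∑' i : ℕ, if N a ≤ 2 ^ (i + 1) then ENNReal.ofReal (((2 : ℝ) ^ (-δ)) ^ i) else 0 :=
        ENNReal.tsum_le_tsum fun a => rpow_neg_le_tsum_dyadic (hN a) hδ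
    _ ≤ ∑' i, ENNReal.ofReal (C * (2 : ℝ) ^ ε * ((2 : ℝ) ^ (ε - δ)) ^ i) := by
        rw [ENNReal.tsum_comm]
        exact ENNReal.tsum_le_tsum hblock
    _ = ENNReal.ofReal (C * (2 : ℝ) ^ ε * (1 - (2 : ℝ) ^ (ε - δ))⁻¹) := by
        rw [← ENNReal.ofReal_tsum_of_nonneg (fun i => by positivity)
          ((summable_geometric_of_lt_one (by positivity) hratio).mul_left _), tsum_mul_left,
          tsum_geometric_of_lt_one (by positivity) hratio]

theorem exists_tsum_circle_decay_le {δ : ℝ} (hδ : 0 < δ) :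
    ∃ K : ℝ≥0, ∀ (k : Fin 2 → ℤ) (m : ℤ),
      ∑' p : {p : Fin 2 → ℤ // sqNorm ((2 : ℤ) • p - k) = m}, decay δ (freqVec p.1) ≤ K := by
  obtain ⟨C, _, hC⟩ := exists_card_arc_le (ε := δ / 4) (by positivity)
  refine ⟨_, fun k m => tsum_rpow_neg_le_of_card_le (C := C * 16 ^ (δ / 4)) (half_lt_self hδ) hδ.le
    (fun p => one_le_bracket _) fun R hR s hs => ?_⟩
  have hinj : Function.Injective
      fun p : {p : Fin 2 → ℤ // sqNorm ((2 : ℤ) • p - k) = m} => (2 : ℤ) • p.1 - k :=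
    fun p q h => Subtype.ext (smul_right_injective _ two_ne_zero (sub_left_injective h))
  have hsq {p} (hp : p ∈ s) : (sqNorm p.1 : ℝ) ≤ R ^ 2 := by
    have := pow_le_pow_left₀ (bracket_pos _).le (hs p hp) 2
    rw [bracket_sq, norm_freqVec_sq] at this
    linarith
  have hdist {p q} (hp : p ∈ s) (hq : q ∈ s) :
      (sqNorm (((2 : ℤ) • p.1 - k) - ((2 : ℤ) • q.1 - k)) : ℝ) ≤ 16 * R ^ 2 := by
    have hle : (sqNorm (p.1 - q.1) : ℝ) ≤ 2 * (sqNorm p.1 + sqNorm q.1) :=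
      mod_cast sqNorm_sub_le p.1 q.1
    rw [sub_sub_sub_cancel_right, ← smul_sub, sqNorm_smul]
    push_cast
    linarith [hsq hp, hsq hq]
  calc (s.card : ℝ) = (s.map ⟨_, hinj⟩).card := by rw [Finset.card_map]
    _ ≤ C * (16 * R ^ 2) ^ (δ / 4) := by
        refine hC m _ (by nlinarith) _ ?_ ?_ <;> simp only [Finset.forall_mem_map]
        · exact fun p _ => p.2
        · exact fun p hp q hq => hdist hp hq
    _ = C * 16 ^ (δ / 4) * R ^ (δ / 2) := by
        rw [Real.mul_rpow (by positivity) (by positivity), ← Real.rpow_natCast_mul (by positivity),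
          mul_assoc]
        congr 3
        push_cast
        ring

section Decay

variable {E F : Type*} [Norm E] [Norm F]

theorem bracket_le_mul_bracket {A : ℝ} (hA : 0 ≤ A) {x : E} {y : F}
    (h : 1 + ‖x‖ ^ 2 ≤ A ^ 2 * (1 + ‖y‖ ^ 2)) : bracket x ≤ A * bracket y := by
  refine le_of_sq_le_sq ?_ (by have := bracket_pos y; positivity)
  rwa [mul_pow, bracket_sq, bracket_sq]

theorem measurable_decay (ρ : ℝ) : Measurable (decay ρ : ℝ → ℝ≥0∞) := by
  unfold decay bracket
  fun_prop

theorem decay_congr {x : E} {y : F} (ρ : ℝ) (h : ‖x‖ = ‖y‖) : decay ρ x = decay ρ y := by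
  rw [decay, decay, bracket, bracket, h]

theorem decay_add (ρ σ : ℝ) (x : E) : decay (ρ + σ) x = decay ρ x * decay σ x := by
  rw [decay, neg_add, Real.rpow_add (bracket_pos x), ENNReal.ofReal_mul
    (Real.rpow_nonneg (bracket_pos x).le _), decay, decay]

theorem decay_le_one {ρ : ℝ} (hρ : 0 ≤ ρ) (x : E) : decay ρ x ≤ 1 := by
  rw [decay, ← ENNReal.ofReal_one]
  exact ENNReal.ofReal_le_ofReal (Real.rpow_le_one_of_one_le_of_nonpos (one_le_bracket x)
    (neg_nonpos.2 hρ))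

theorem decay_le_mul_decay {ρ A : ℝ} (hρ : 0 ≤ ρ) (hA : 0 < A) {x : E} {y : F}
    (h : 1 + ‖y‖ ^ 2 ≤ A ^ 2 * (1 + ‖x‖ ^ 2)) :
    decay ρ x ≤ ENNReal.ofReal (A ^ ρ) * decay ρ y := by
  have hx := bracket_pos x
  have hy := bracket_pos y
  rw [decay, decay, ← ENNReal.ofReal_mul (by positivity)]
  refine ENNReal.ofReal_le_ofReal ?_
  calc bracket x ^ (-ρ) = A ^ ρ * (A * bracket x) ^ (-ρ) := by
        rw [Real.mul_rpow hA.le hx.le, ← mul_assoc, ← Real.rpow_add hA, add_neg_cancel,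
          Real.rpow_zero, one_mul]
    _ ≤ A ^ ρ * bracket y ^ (-ρ) := mul_le_mul_of_nonneg_left (Real.rpow_le_rpow_of_nonpos hy
        (bracket_le_mul_bracket hA.le h) (neg_nonpos.2 hρ)) (by positivity)

theorem decay_anti {G : Type*} [SeminormedAddGroup G] {ρ : ℝ} (hρ : 0 ≤ ρ) {x : E} {y : G}
    (h : ‖y‖ ≤ ‖x‖) : decay ρ x ≤ decay ρ y := by
  simpa using decay_le_mul_decay (A := 1) (x := x) (y := y) hρ one_pos (by
    linarith [pow_le_pow_left₀ (norm_nonneg y) h 2])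

theorem decay_le_mul_decay_two_mul {γ : ℝ} (hγ : 0 ≤ γ) {x : E} {y : F} (h : ‖y‖ ^ 2 ≤ ‖x‖) :
    decay γ x ≤ ENNReal.ofReal (2 ^ γ) * decay (2 * γ) y := by
  have hx := bracket_pos x
  have hy := bracket_pos y
  have hle : bracket y ^ 2 ≤ 2 * bracket x := by
    nlinarith [bracket_sq x, bracket_sq y, one_le_bracket x]
  rw [decay, decay, ← ENNReal.ofReal_mul (by positivity)]
  refine ENNReal.ofReal_le_ofReal ?_
  calc bracket x ^ (-γ) = 2 ^ γ * (2 * bracket x) ^ (-γ) := by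
        rw [Real.mul_rpow zero_le_two hx.le, ← mul_assoc, ← Real.rpow_add two_pos, add_neg_cancel,
          Real.rpow_zero, one_mul]
    _ ≤ 2 ^ γ * (bracket y ^ 2) ^ (-γ) := mul_le_mul_of_nonneg_left
        (Real.rpow_le_rpow_of_nonpos (by positivity) hle (neg_nonpos.2 hγ)) (by positivity)
    _ = 2 ^ γ * bracket y ^ (-(2 * γ)) := by
        rw [← Real.rpow_natCast_mul hy.le, Nat.cast_ofNat, mul_neg]

theorem rpow_neg_mul_rpow_neg_le {a b σ γ δ : ℝ} (ha : 0 < a) (hb : 0 < b) (hγ : 0 ≤ γ)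
    (hγδ : γ ≤ δ) :
    a ^ (-σ) * b ^ (-γ) ≤ a ^ (-(σ + γ)) + a ^ (-(σ + γ - δ)) * b ^ (-δ) := by
  rcases le_total a b with hab | hab
  · calc a ^ (-σ) * b ^ (-γ) ≤ a ^ (-σ) * a ^ (-γ) := mul_le_mul_of_nonneg_left
          (Real.rpow_le_rpow_of_nonpos ha hab (neg_nonpos.2 hγ)) (by positivity)
      _ = a ^ (-(σ + γ)) := by rw [neg_add, Real.rpow_add ha]
      _ ≤ _ := le_add_of_nonneg_right (by positivity)
  · calc a ^ (-σ) * b ^ (-γ) = a ^ (-σ) * b ^ (δ - γ) * b ^ (-δ) := by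
          rw [mul_assoc, ← Real.rpow_add hb]
          ring_nf
      _ ≤ a ^ (-σ) * a ^ (δ - γ) * b ^ (-δ) := by
          gcongr
      _ = a ^ (-(σ + γ - δ)) * b ^ (-δ) := by
          rw [← Real.rpow_add ha]
          ring_nf
      _ ≤ _ := le_add_of_nonneg_left (by positivity)

theorem decay_mul_decay_le_add {β γ : ℝ} (hβ : 0 ≤ β) (hγ : 0 ≤ γ) (x : E) (y : F) :
    decay β x * decay γ y ≤ decay (β + γ) x + decay (β + γ) y := by
  have hx := bracket_pos x
  have hy := bracket_pos y
  rw [decay, decay, decay, decay, ← ENNReal.ofReal_mul (by positivity),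
    ← ENNReal.ofReal_add (by positivity) (by positivity)]
  refine ENNReal.ofReal_le_ofReal ?_
  simpa using rpow_neg_mul_rpow_neg_le (σ := β) hx hy hγ (le_add_of_nonneg_left hβ)

/-- Splitting according to whether `⟨x⟩² ≤ ⟨y⟩`. -/
theorem decay_two_mul_mul_decay_le_add {σ γ δ : ℝ} (hγ : 0 ≤ γ) (hγδ : γ ≤ δ) (x : E) (y : F) :
    decay (2 * σ) x * decay γ y ≤
      decay (2 * (σ + γ)) x + decay (2 * (σ + γ - δ)) x * decay δ y := by
  have hx := bracket_pos x
  have hy := bracket_pos y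
  simp only [decay]
  rw [← ENNReal.ofReal_mul (by positivity), ← ENNReal.ofReal_mul (by positivity),
    ← ENNReal.ofReal_add (by positivity) (by positivity)]
  refine ENNReal.ofReal_le_ofReal ?_
  have hsq (ρ : ℝ) : bracket x ^ (-(2 * ρ)) = (bracket x ^ 2) ^ (-ρ) := by
    rw [← Real.rpow_natCast_mul hx.le, Nat.cast_ofNat, mul_neg]
  rw [hsq, hsq, hsq]
  exact rpow_neg_mul_rpow_neg_le (by positivity) hy hγ hγδ

end Decay

theorem summable_int_bracket_rpow {ρ : ℝ} (hρ : 1 < ρ) :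
    Summable fun j : ℤ => bracket (j : ℝ) ^ (-ρ) := by
  refine Summable.of_nonneg_of_le (fun j => Real.rpow_nonneg (bracket_pos _).le _) (fun j => ?_)
    (((Real.summable_one_div_int_add_rpow (1 / 2) ρ).2 hρ).mul_left (2 ^ ρ))
  have hpos : 0 < |(j : ℝ) + 1 / 2| := by
    refine abs_pos.2 fun h => ?_
    have : (2 * j + 1 : ℤ) = 0 := by exact_mod_cast (by linarith : 2 * (j : ℝ) + 1 = 0)
    omega
  have hle : |(j : ℝ) + 1 / 2| ≤ 2 * bracket (j : ℝ) := by
    refine abs_le_of_sq_le_sq ?_ (by have := bracket_pos (j : ℝ); positivity)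
    rw [mul_pow, bracket_sq, Real.norm_eq_abs, sq_abs]
    nlinarith [sq_nonneg ((j : ℝ) - 1)]
  calc bracket (j : ℝ) ^ (-ρ) = 2 ^ ρ * (2 * bracket (j : ℝ)) ^ (-ρ) := by
        rw [Real.mul_rpow zero_le_two (bracket_pos _).le, ← mul_assoc, ← Real.rpow_add two_pos,
          add_neg_cancel, Real.rpow_zero, one_mul]
    _ ≤ 2 ^ ρ * (1 / |(j : ℝ) + 1 / 2| ^ ρ) := by
        rw [one_div, ← Real.rpow_neg (abs_nonneg _)]
        exact mul_le_mul_of_nonneg_left (Real.rpow_le_rpow_of_nonpos hpos hle (by linarith))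
          (by positivity)

theorem exists_tsum_decay_sub_le {ρ : ℝ} (hρ : 1 < ρ) :
    ∃ K : ℝ≥0, ∀ c : ℝ, ∑' j : ℤ, decay ρ (j - c) ≤ K := by
  refine ⟨((2 : ℝ) ^ ρ).toNNReal * (∑' j : ℤ, bracket (j : ℝ) ^ (-ρ)).toNNReal, fun c => ?_⟩
  have hshift (j : ℤ) : decay ρ (j - c) ≤ ENNReal.ofReal (2 ^ ρ) * decay ρ ((j - ⌊c⌋ : ℤ) : ℝ) := by
    refine decay_le_mul_decay (by linarith) two_pos ?_
    simp only [Real.norm_eq_abs, sq_abs]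
    push_cast
    have hlow := Int.floor_le c
    have hup := (Int.lt_floor_add_one c).le
    nlinarith [sq_nonneg ((j : ℝ) - c - (c - ⌊c⌋))]
  calc ∑' j : ℤ, decay ρ (j - c)
      ≤ ∑' j : ℤ, ENNReal.ofReal (2 ^ ρ) * decay ρ ((j - ⌊c⌋ : ℤ) : ℝ) :=
        ENNReal.tsum_le_tsum hshift
    _ = ENNReal.ofReal (2 ^ ρ) * ∑' j : ℤ, decay ρ (j : ℝ) := by
        rw [ENNReal.tsum_mul_left]
        exact congrArg _ ((Equiv.subRight ⌊c⌋).tsum_eq fun j : ℤ => decay ρ (j : ℝ))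
    _ = ENNReal.ofReal (2 ^ ρ) * ENNReal.ofReal (∑' j : ℤ, bracket (j : ℝ) ^ (-ρ)) := by
        rw [ENNReal.ofReal_tsum_of_nonneg (fun j => Real.rpow_nonneg (bracket_pos _).le _)
          (summable_int_bracket_rpow hρ)]
        rfl
    _ = _ := (ENNReal.coe_mul _ _).symm

theorem tsum_fin_succ {d : ℕ} (f : (Fin (d + 1) → ℤ) → ℝ≥0∞) :
    ∑' p, f p = ∑' (j : ℤ) (p : Fin d → ℤ), f (Fin.cons j p) := by
  rw [← (Fin.consEquiv fun _ => ℤ).tsum_eq, ENNReal.tsum_prod']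
  rfl

theorem sqNorm_cons {d : ℕ} (j : ℤ) (p : Fin d → ℤ) :
    sqNorm (Fin.cons j p : Fin (d + 1) → ℤ) = j ^ 2 + sqNorm p := by
  simp only [sqNorm, Fin.sum_univ_succ, Fin.cons_zero, Fin.cons_succ]

theorem norm_freqVec_cons_sq {d : ℕ} (j : ℤ) (p : Fin d → ℤ) :
    ‖freqVec (Fin.cons j p : Fin (d + 1) → ℤ)‖ ^ 2 = (j : ℝ) ^ 2 + ‖freqVec p‖ ^ 2 := by
  rw [norm_freqVec_sq, norm_freqVec_sq, sqNorm_cons]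
  push_cast
  rfl

theorem norm_head_le_norm_freqVec_cons {d : ℕ} (j : ℤ) (p : Fin d → ℤ) :
    ‖(j : ℝ)‖ ≤ ‖freqVec (Fin.cons j p : Fin (d + 1) → ℤ)‖ := by
  refine le_of_sq_le_sq ?_ (norm_nonneg _)
  rw [norm_freqVec_cons_sq, Real.norm_eq_abs, sq_abs]
  exact le_add_of_nonneg_right (sq_nonneg _)

theorem norm_tail_le_norm_freqVec_cons {d : ℕ} (j : ℤ) (p : Fin d → ℤ) :
    ‖freqVec p‖ ≤ ‖freqVec (Fin.cons j p : Fin (d + 1) → ℤ)‖ := by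
  refine le_of_sq_le_sq ?_ (norm_nonneg _)
  rw [norm_freqVec_cons_sq]
  exact le_add_of_nonneg_left (sq_nonneg _)

theorem decay_freqVec_cons_le {d : ℕ} {ρ σ : ℝ} (hρ : 0 ≤ ρ) (hσ : 0 ≤ σ) (j : ℤ)
    (p : Fin d → ℤ) :
    decay (ρ + σ) (freqVec (Fin.cons j p : Fin (d + 1) → ℤ)) ≤
      decay ρ (j : ℝ) * decay σ (freqVec p) := by
  rw [decay_add]
  exact mul_le_mul' (decay_anti hρ (norm_head_le_norm_freqVec_cons j p))
    (decay_anti hσ (norm_tail_le_norm_freqVec_cons j p))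

theorem exists_tsum_decay_freqVec_le (d : ℕ) {ρ : ℝ} (hρ : (d : ℝ) < ρ) :
    ∃ K : ℝ≥0, ∑' p : Fin d → ℤ, decay ρ (freqVec p) ≤ K := by
  induction d generalizing ρ with
  | zero =>
    refine ⟨1, ?_⟩
    rw [tsum_fintype, Fintype.sum_unique]
    exact decay_le_one (by simpa using hρ.le) _
  | succ d ih =>
    push_cast at hρ
    have : (0 : ℝ) ≤ d := d.cast_nonneg
    obtain ⟨σ, hdσ, hσρ⟩ : ∃ σ, (d : ℝ) < σ ∧ σ < ρ - 1 := exists_between (by linarith)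
    obtain ⟨K, hK⟩ := ih hdσ
    obtain ⟨K', hK'⟩ := exists_tsum_decay_sub_le (ρ := ρ - σ) (by linarith)
    refine ⟨K' * K, ?_⟩
    calc ∑' p : Fin (d + 1) → ℤ, decay ρ (freqVec p)
        ≤ ∑' (j : ℤ) (p : Fin d → ℤ), decay (ρ - σ) (j : ℝ) * decay σ (freqVec p) := by
          rw [tsum_fin_succ]
          refine ENNReal.tsum_le_tsum fun j => ENNReal.tsum_le_tsum fun p => ?_
          refine (le_of_eq ?_).trans (decay_freqVec_cons_le (by linarith) (by linarith) j p)
          rw [sub_add_cancel]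
      _ = (∑' j : ℤ, decay (ρ - σ) (j : ℝ)) * ∑' p : Fin d → ℤ, decay σ (freqVec p) := by
          simp only [ENNReal.tsum_mul_left, ENNReal.tsum_mul_right]
      _ ≤ ↑(K' * K) := by
          push_cast
          exact mul_le_mul' (by simpa using hK' 0) hK

theorem abs_sub_sqrt_sq_le (t e : ℝ) : (|t| - √e) ^ 2 ≤ |t ^ 2 - e| := by
  rcases le_total e 0 with he | he
  · rw [Real.sqrt_eq_zero_of_nonpos he, sub_zero, sq_abs, abs_of_nonneg (by nlinarith)]
    linarith
  · have hfactor : t ^ 2 - e = (|t| - √e) * (|t| + √e) := by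
      nlinarith [Real.sq_sqrt he, sq_abs t]
    rw [hfactor, abs_mul, abs_of_nonneg (by positivity : 0 ≤ |t| + √e), ← sq_abs, sq]
    refine mul_le_mul_of_nonneg_left ?_ (abs_nonneg _)
    rw [abs_le]
    constructor <;> linarith [abs_nonneg t, Real.sqrt_nonneg e]

theorem decay_sq_sub_le {γ : ℝ} (hγ : 0 ≤ γ) (t e : ℝ) :
    decay γ (t ^ 2 - e) ≤
      ENNReal.ofReal (2 ^ γ) * (decay (2 * γ) (t - √e) + decay (2 * γ) (t + √e)) := by
  refine (decay_le_mul_decay_two_mul (y := |t| - √e) hγ ?_).trans (by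
    gcongr
    rcases abs_choice t with h | h <;> rw [h]
    · exact le_self_add
    · rw [decay_congr (2 * γ) (y := t + √e) (by rw [← norm_neg]; ring_nf)]
      exact le_add_self)
  rw [Real.norm_eq_abs, sq_abs]
  exact abs_sub_sqrt_sq_le t e

theorem exists_tsum_decay_mul_decay_sq_sub_le {β γ : ℝ} (hβ : 0 ≤ β) (hγ : 0 ≤ γ)
    (hβγ : 1 < β + 2 * γ) :
    ∃ K : ℝ≥0, ∀ t e : ℝ, ∑' j : ℤ, decay β (j : ℝ) * decay γ ((j - t) ^ 2 - e) ≤ K := by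
  obtain ⟨K, hK⟩ := exists_tsum_decay_sub_le hβγ
  have hlinear (c : ℝ) : ∑' j : ℤ, decay β (j : ℝ) * decay (2 * γ) (j - c) ≤ K + K := by
    refine (ENNReal.tsum_le_tsum fun j : ℤ =>
      decay_mul_decay_le_add hβ (by positivity) (j : ℝ) (j - c : ℝ)).trans ?_
    rw [ENNReal.tsum_add]
    exact add_le_add (by simpa using hK 0) (hK c)
  refine ⟨((2 : ℝ) ^ γ).toNNReal * ((K + K) + (K + K)), fun t e => ?_⟩
  calc ∑' j : ℤ, decay β (j : ℝ) * decay γ ((j - t) ^ 2 - e)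
      ≤ ∑' j : ℤ, decay β (j : ℝ) * (ENNReal.ofReal (2 ^ γ) *
          (decay (2 * γ) (j - (t + √e)) + decay (2 * γ) (j - (t - √e)))) := by
        refine ENNReal.tsum_le_tsum fun j => mul_le_mul_right ?_ _
        convert decay_sq_sub_le hγ (j - t) e using 4 <;> ring
    _ = ENNReal.ofReal (2 ^ γ) * (∑' j : ℤ, decay β (j : ℝ) * decay (2 * γ) (j - (t + √e)) +
          ∑' j : ℤ, decay β (j : ℝ) * decay (2 * γ) (j - (t - √e))) := by
        rw [← ENNReal.tsum_add, ← ENNReal.tsum_mul_left]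
        exact tsum_congr fun j => by ring
    _ ≤ ENNReal.ofReal (2 ^ γ) * ((K + K) + (K + K)) := by
        gcongr <;> exact hlinear _
    _ = _ := by push_cast; rfl

theorem exists_tsum_decay_sub_half_le {ρ : ℝ} (hρ : 1 < ρ) :
    ∃ K : ℝ≥0, ∀ c : ℝ, ∑' m : ℤ, decay ρ (c - m / 2) ≤ K := by
  obtain ⟨K, hK⟩ := exists_tsum_decay_sub_le hρ
  refine ⟨((2 : ℝ) ^ ρ).toNNReal * K, fun c => ?_⟩
  calc ∑' m : ℤ, decay ρ (c - m / 2)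
      ≤ ∑' m : ℤ, ENNReal.ofReal (2 ^ ρ) * decay ρ (m - 2 * c) := by
        refine ENNReal.tsum_le_tsum fun m => decay_le_mul_decay (by linarith) two_pos ?_
        simp only [Real.norm_eq_abs, sq_abs]
        nlinarith
    _ ≤ ENNReal.ofReal (2 ^ ρ) * K := by
        rw [ENNReal.tsum_mul_left]
        gcongr
        exact hK _
    _ = _ := (ENNReal.coe_mul _ _).symm

theorem tsum_mul_comp_le {α β : Type*} (f : α → ℝ≥0∞) (g : α → β) (h : β → ℝ≥0∞) {K : ℝ≥0∞}
    (hf : ∀ b, ∑' a : {a // g a = b}, f a ≤ K) : ∑' a, f a * h (g a) ≤ K * ∑' b, h b := by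
  rw [← (Equiv.sigmaFiberEquiv g).tsum_eq, ENNReal.tsum_sigma', ← ENNReal.tsum_mul_left]
  refine ENNReal.tsum_le_tsum fun b => ?_
  calc ∑' a : {a // g a = b}, f a * h (g a) = (∑' a : {a // g a = b}, f a) * h b := by
        rw [← ENNReal.tsum_mul_right]
        exact tsum_congr fun a => by rw [a.2]
    _ ≤ K * h b := by
        gcongr
        exact hf b

section LatticeSum

variable {σ γ : ℝ}

theorem sub_sqNorm_cons_eq {d : ℕ} (c : ℝ) (j : ℤ) (p : Fin d → ℤ) (k : Fin (d + 1) → ℤ) :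
    c - sqNorm ((2 : ℤ) • (Fin.cons j p : Fin (d + 1) → ℤ) - k) / 2 =
      c - (2 * j - k 0) ^ 2 / 2 - sqNorm ((2 : ℤ) • p - Fin.tail k) / 2 := by
  have h : (2 : ℤ) • (Fin.cons j p : Fin (d + 1) → ℤ) - k =
      Fin.cons (2 * j - k 0) ((2 : ℤ) • p - Fin.tail k) := by
    funext i
    refine Fin.cases ?_ (fun i => ?_) i <;> simp [Fin.tail]
  rw [h, sqNorm_cons]
  push_cast
  ring

theorem exists_tsum_lattice_one_le (hσ : 0 < σ) (hγ : 0 < γ) (hσγ : 1 / 2 < σ + γ) :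
    ∃ K : ℝ≥0, ∀ (c : ℝ) (k : Fin 1 → ℤ), ∑' p : Fin 1 → ℤ,
      decay (2 * σ) (freqVec p) * decay γ (c - sqNorm ((2 : ℤ) • p - k) / 2) ≤ K := by
  obtain ⟨K, hK⟩ := exists_tsum_decay_mul_decay_sq_sub_le (β := 2 * σ) (γ := γ) (by positivity)
    hγ.le (by linarith)
  refine ⟨K, fun c k => ?_⟩
  rw [tsum_fin_succ]
  refine (ENNReal.tsum_le_tsum fun j => ?_).trans (hK (k 0 / 2) (c / 2))
  rw [tsum_fintype, Fintype.sum_subsingleton _ 0, sub_sqNorm_cons_eq]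
  have hsq : sqNorm ((2 : ℤ) • 0 - Fin.tail k) = 0 := Fin.sum_univ_zero _
  refine mul_le_mul' (decay_anti (by positivity) (norm_head_le_norm_freqVec_cons j _))
    (decay_anti hγ.le ?_)
  rw [hsq, Int.cast_zero, zero_div, sub_zero, show c - (2 * j - k 0 : ℝ) ^ 2 / 2 =
    -2 * ((j - k 0 / 2) ^ 2 - c / 2) by ring, norm_mul, norm_neg, Real.norm_two]
  linarith [norm_nonneg (((j : ℝ) - k 0 / 2) ^ 2 - c / 2)]

theorem exists_tsum_lattice_two_le (hγ : 0 < γ) (hγ1 : γ < 1) (hσγ : 1 < σ + γ) :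
    ∃ K : ℝ≥0, ∀ (c : ℝ) (k : Fin 2 → ℤ), ∑' p : Fin 2 → ℤ,
      decay (2 * σ) (freqVec p) * decay γ (c - sqNorm ((2 : ℤ) • p - k) / 2) ≤ K := by
  obtain ⟨δ, hδ1, hδ⟩ := exists_between hσγ
  obtain ⟨K₁, hK₁⟩ := exists_tsum_decay_freqVec_le 2 (ρ := 2 * (σ + γ)) (by push_cast; linarith)
  obtain ⟨K₂, hK₂⟩ := exists_tsum_circle_decay_le (δ := 2 * (σ + γ - δ)) (by linarith)
  obtain ⟨K₃, hK₃⟩ := exists_tsum_decay_sub_half_le hδ1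
  refine ⟨K₁ + K₂ * K₃, fun c k => ?_⟩
  calc ∑' p : Fin 2 → ℤ, decay (2 * σ) (freqVec p) * decay γ (c - sqNorm ((2 : ℤ) • p - k) / 2)
      ≤ ∑' p : Fin 2 → ℤ, (decay (2 * (σ + γ)) (freqVec p) + decay (2 * (σ + γ - δ)) (freqVec p) *
          decay δ (c - sqNorm ((2 : ℤ) • p - k) / 2)) :=
        ENNReal.tsum_le_tsum fun p => decay_two_mul_mul_decay_le_add hγ.le (by linarith) _ _
    _ ≤ K₁ + K₂ * ∑' m : ℤ, decay δ (c - m / 2) := by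
        rw [ENNReal.tsum_add]
        exact add_le_add hK₁ (tsum_mul_comp_le (fun p => decay (2 * (σ + γ - δ)) (freqVec p))
          (fun p => sqNorm ((2 : ℤ) • p - k)) (fun m => decay δ (c - m / 2)) (hK₂ k))
    _ ≤ ↑(K₁ + K₂ * K₃) := by
        push_cast
        gcongr
        exact hK₃ c

theorem exists_tsum_lattice_succ_le {d : ℕ} {σ' : ℝ} (hσ' : 0 ≤ σ') (hσ : σ' + 1 / 2 < σ)
    (h : ∃ K : ℝ≥0, ∀ (c : ℝ) (k : Fin d → ℤ), ∑' p : Fin d → ℤ,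
      decay (2 * σ') (freqVec p) * decay γ (c - sqNorm ((2 : ℤ) • p - k) / 2) ≤ K) :
    ∃ K : ℝ≥0, ∀ (c : ℝ) (k : Fin (d + 1) → ℤ), ∑' p : Fin (d + 1) → ℤ,
      decay (2 * σ) (freqVec p) * decay γ (c - sqNorm ((2 : ℤ) • p - k) / 2) ≤ K := by
  obtain ⟨K, hK⟩ := h
  obtain ⟨K', hK'⟩ := exists_tsum_decay_sub_le (ρ := 2 * (σ - σ')) (by linarith)
  refine ⟨K' * K, fun c k => ?_⟩
  calc ∑' p : Fin (d + 1) → ℤ,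
        decay (2 * σ) (freqVec p) * decay γ (c - sqNorm ((2 : ℤ) • p - k) / 2)
      ≤ ∑' (j : ℤ) (p : Fin d → ℤ), decay (2 * (σ - σ')) (j : ℝ) * (decay (2 * σ') (freqVec p) *
          decay γ (c - (2 * j - k 0) ^ 2 / 2 - sqNorm ((2 : ℤ) • p - Fin.tail k) / 2)) := by
        rw [tsum_fin_succ]
        refine ENNReal.tsum_le_tsum fun j => ENNReal.tsum_le_tsum fun p => ?_
        rw [sub_sqNorm_cons_eq, ← mul_assoc, show 2 * σ = 2 * (σ - σ') + 2 * σ' by ring]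
        gcongr
        exact decay_freqVec_cons_le (by linarith) (by positivity) j p
    _ ≤ ∑' j : ℤ, decay (2 * (σ - σ')) (j : ℝ) * K := by
        simp only [ENNReal.tsum_mul_left]
        gcongr with j
        exact hK _ _
    _ ≤ ↑(K' * K) := by
        rw [ENNReal.tsum_mul_right, ENNReal.coe_mul]
        gcongr
        simpa using hK' 0

theorem exists_tsum_lattice_le (d : ℕ) (hσ : 0 < σ) (hγ : 0 < γ) (hγ1 : γ < 1)
    (hσγ : (d : ℝ) / 2 < σ + γ) :
    ∃ K : ℝ≥0, ∀ (c : ℝ) (k : Fin d → ℤ), ∑' p : Fin d → ℤ,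
      decay (2 * σ) (freqVec p) * decay γ (c - sqNorm ((2 : ℤ) • p - k) / 2) ≤ K := by
  match d with
  | 0 =>
    refine ⟨1, fun c k => ?_⟩
    rw [tsum_fintype, Fintype.sum_unique]
    exact mul_le_one' (decay_le_one (by positivity) _) (decay_le_one hγ.le _)
  | 1 => exact exists_tsum_lattice_one_le hσ hγ (by simpa using hσγ)
  | d + 2 =>
    induction d generalizing σ with
    | zero => exact exists_tsum_lattice_two_le hγ hγ1 (by simpa using hσγ)
    | succ d ih =>
      push_cast at hσγ
      obtain ⟨σ', hσ'd, hσ'⟩ : ∃ σ', ((d : ℝ) + 2) / 2 - γ < σ' ∧ σ' < σ - 1 / 2 :=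
        exists_between (by linarith)
      have : 0 < σ' := by linarith [d.cast_nonneg (α := ℝ)]
      exact exists_tsum_lattice_succ_le this.le (by linarith)
        (ih this (by push_cast; linarith))

end LatticeSum

/-! ### Time frequencies on a circle -/

theorem lintegral_comp_abs_eq {g : ℝ → ℝ≥0∞} (hg : Measurable g) :
    ∫⁻ t, g |t| = 2 * ∫⁻ t in Set.Ioi 0, g t := by
  have h_pos : ∫⁻ t in Set.Ioi 0, g |t| = ∫⁻ t in Set.Ioi 0, g t :=
    setLIntegral_congr_fun measurableSet_Ioi fun t ht => by rw [abs_of_pos ht]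
  have h_neg : ∫⁻ t in Set.Iic 0, g |t| = ∫⁻ t in Set.Ioi 0, g t := by
    rw [setLIntegral_congr Iio_ae_eq_Iic.symm,
      ← (Measure.measurePreserving_neg (volume : Measure ℝ)).setLIntegral_comp_preimage
        measurableSet_Ioi hg, show Neg.neg ⁻¹' Set.Ioi (0 : ℝ) = Set.Iio 0 by ext; simp]
    exact setLIntegral_congr_fun measurableSet_Iio fun t ht => by rw [abs_of_neg ht]
  rw [← lintegral_add_compl _ (measurableSet_Ioi (a := (0 : ℝ))), Set.compl_Ioi, h_pos, h_neg,
    two_mul]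

theorem lintegral_addCircle_comp_norm_le {T : ℝ} [hT : Fact (0 < T)] {g : ℝ → ℝ≥0∞}
    (hg : Measurable g) : ∫⁻ x : AddCircle T, g ‖x‖ ≤ 2 * ∫⁻ t in Set.Ioi 0, g t := by
  rw [← AddCircle.lintegral_preimage T (-(T / 2)), ← lintegral_comp_abs_eq hg]
  refine le_of_eq_of_le (setLIntegral_congr_fun measurableSet_Ioc fun t ht => ?_)
    (setLIntegral_le_lintegral (Set.Ioc (-(T / 2)) (-(T / 2) + T)) _)
  rw [(AddCircle.norm_coe_eq_abs_iff T hT.out.ne').2]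
  rw [abs_of_pos hT.out, abs_le]
  exact ⟨ht.1.le, by linarith [ht.2]⟩

theorem decay_le_ofReal_rpow {ρ t : ℝ} (hρ : 0 ≤ ρ) (ht : 0 < t) :
    decay ρ t ≤ ENNReal.ofReal (t ^ (-ρ)) := by
  refine ENNReal.ofReal_le_ofReal (Real.rpow_le_rpow_of_nonpos ht ?_ (by linarith))
  rw [bracket_eq_sqrt]
  refine Real.le_sqrt_of_sq_le ?_
  simp

theorem setLIntegral_Ioc_rpow_neg {a Z : ℝ} (ha : a < 1) (hZ : 0 < Z) :
    ∫⁻ t in Set.Ioc 0 Z, ENNReal.ofReal (t ^ (-a)) = ENNReal.ofReal (Z ^ (1 - a) / (1 - a)) := by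
  have h_int : IntervalIntegrable (fun t : ℝ => t ^ (-a)) volume 0 Z :=
    intervalIntegral.intervalIntegrable_rpow' (by linarith)
  rw [← ofReal_integral_eq_lintegral_ofReal
      ((intervalIntegrable_iff_integrableOn_Ioc_of_le hZ.le).1 h_int)
      (ae_restrict_of_forall_mem measurableSet_Ioc fun t ht => Real.rpow_nonneg ht.1.le _),
    ← intervalIntegral.integral_of_le hZ.le, integral_rpow (Or.inl (by linarith)),
    Real.zero_rpow (by linarith), sub_zero, neg_add_eq_sub]

theorem setLIntegral_Ioi_rpow_neg {a Z : ℝ} (ha : 1 < a) (hZ : 0 < Z) :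
    ∫⁻ t in Set.Ioi Z, ENNReal.ofReal (t ^ (-a)) = ENNReal.ofReal (Z ^ (1 - a) / (a - 1)) := by
  rw [← ofReal_integral_eq_lintegral_ofReal (integrableOn_Ioi_rpow_of_lt (by linarith) hZ)
      (ae_restrict_of_forall_mem measurableSet_Ioi fun t ht =>
        Real.rpow_nonneg (hZ.trans ht).le _),
    integral_Ioi_rpow_of_lt (by linarith) hZ, neg_add_eq_sub, ← neg_sub a 1, neg_div_neg_eq]

theorem lintegral_Ioi_decay_mul_decay_max_le {a : ℝ} (ha : 1 / 2 < a) (ha1 : a < 1) {r : ℝ}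
    (hr : 0 ≤ r) :
    ∫⁻ t in Set.Ioi 0, decay a t * decay a (max t r) ≤
      ENNReal.ofReal (1 / (1 - a) + 1 / (2 * a - 1)) * decay (2 * a - 1) r := by
  set Z := bracket r
  have hZ : 0 < Z := bracket_pos r
  have : 0 < 1 - a := by linarith
  have : 0 < 2 * a - 1 := by linarith
  have h_decay : decay (2 * a - 1) r = ENNReal.ofReal (Z ^ (1 - 2 * a)) := by
    rw [decay, neg_sub]
  have h_near : ∫⁻ t in Set.Ioc 0 Z, decay a t * decay a (max t r) ≤
      ENNReal.ofReal (1 / (1 - a)) * decay (2 * a - 1) r := calc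
    _ ≤ ∫⁻ t in Set.Ioc 0 Z, ENNReal.ofReal (t ^ (-a)) * decay a r := by
      refine setLIntegral_mono' measurableSet_Ioc fun t ht =>
        mul_le_mul' (decay_le_ofReal_rpow (by linarith) ht.1) (decay_anti (by linarith) ?_)
      exact abs_le_abs_of_nonneg hr (le_max_right _ _)
    _ = ENNReal.ofReal (1 / (1 - a)) * decay (2 * a - 1) r := by
      rw [lintegral_mul_const' (decay a r) _ ENNReal.ofReal_ne_top,
        setLIntegral_Ioc_rpow_neg ha1 hZ, h_decay, decay,
        ← ENNReal.ofReal_mul (by positivity), ← ENNReal.ofReal_mul (by positivity),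
        show 1 - 2 * a = 1 - a + -a by ring, Real.rpow_add hZ]
      congr 1
      ring
  have h_far : ∫⁻ t in Set.Ioi Z, decay a t * decay a (max t r) ≤
      ENNReal.ofReal (1 / (2 * a - 1)) * decay (2 * a - 1) r := calc
    _ ≤ ∫⁻ t in Set.Ioi Z, ENNReal.ofReal (t ^ (-(2 * a))) := by
      refine setLIntegral_mono' measurableSet_Ioi fun t ht => ?_
      have ht0 : 0 < t := hZ.trans ht
      rw [show -(2 * a) = -a + -a by ring, Real.rpow_add ht0, ENNReal.ofReal_mul (by positivity)]
      refine mul_le_mul' (decay_le_ofReal_rpow (by linarith) ht0)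
        ((decay_le_ofReal_rpow (by linarith) (lt_max_of_lt_left ht0)).trans ?_)
      exact ENNReal.ofReal_le_ofReal
        (Real.rpow_le_rpow_of_nonpos ht0 (le_max_left _ _) (by linarith))
    _ = ENNReal.ofReal (1 / (2 * a - 1)) * decay (2 * a - 1) r := by
      rw [setLIntegral_Ioi_rpow_neg (by linarith) hZ, h_decay,
        ← ENNReal.ofReal_mul (by positivity), one_div_mul_eq_div]
  rw [← Set.Ioc_union_Ioi_eq_Ioi hZ.le, ENNReal.ofReal_add (by positivity) (by positivity),
    add_mul]
  exact (lintegral_union_le _ _ _).trans (add_le_add h_near h_far)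

theorem decay_mul_decay_sub_le {E : Type*} [NormedAddCommGroup E] {a : ℝ} (ha : 0 ≤ a) (x y : E) :
    decay a x * decay a (y - x) ≤
      ENNReal.ofReal (2 ^ a) * (decay a ‖x‖ * decay a (max ‖x‖ ‖y‖) +
        decay a ‖y - x‖ * decay a (max ‖y - x‖ ‖y‖)) := by
  have h_of_le : ∀ u v : E, ‖u‖ ≤ ‖v‖ → ‖y‖ ≤ ‖u‖ + ‖v‖ →
      decay a u * decay a v ≤ ENNReal.ofReal (2 ^ a) * (decay a ‖u‖ * decay a (max ‖u‖ ‖y‖)) := by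
    intro u v huv hy
    have h_max : max ‖u‖ ‖y‖ ≤ 2 * ‖v‖ := max_le (by linarith [norm_nonneg v]) (by linarith)
    have h_sq : max ‖u‖ ‖y‖ ^ 2 ≤ (2 * ‖v‖) ^ 2 := by gcongr
    rw [decay_congr a (norm_norm u), mul_left_comm]
    gcongr
    refine decay_le_mul_decay ha two_pos ?_
    rw [Real.norm_eq_abs, sq_abs]
    linarith
  rcases le_total ‖x‖ ‖y - x‖ with h | h
  · refine (h_of_le x (y - x) h ?_).trans (by gcongr; exact le_self_add)
    simpa using norm_add_le x (y - x)
  · rw [mul_comm (decay a x)]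
    refine (h_of_le (y - x) x h ?_).trans (by gcongr; exact le_add_self)
    simpa using norm_add_le (y - x) x

theorem exists_lintegral_decay_mul_decay_sub_le {a : ℝ} (ha : 1 / 2 < a) (ha1 : a < 1) :
    ∃ C : ℝ≥0, ∀ (T : ℝ) [Fact (0 < T)] (y : AddCircle T),
      ∫⁻ x, decay a x * decay a (y - x) ≤ C * decay (2 * a - 1) y := by
  set K : ℝ≥0∞ := ENNReal.ofReal (1 / (1 - a) + 1 / (2 * a - 1))
  refine ⟨(ENNReal.ofReal (2 ^ a) * (4 * K)).toNNReal, fun T _ y => ?_⟩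
  rw [ENNReal.coe_toNNReal (by finiteness)]
  let ψ : ℝ → ℝ≥0∞ := fun t => decay a t * decay a (max t ‖y‖)
  have hψ : Measurable ψ :=
    (measurable_decay a).mul ((measurable_decay a).comp (measurable_id.max measurable_const))
  have hψ_int : ∫⁻ x : AddCircle T, ψ ‖x‖ ≤ 2 * (K * decay (2 * a - 1) y) := by
    rw [← decay_congr _ (norm_norm y)]
    refine (lintegral_addCircle_comp_norm_le hψ).trans ?_
    gcongr
    exact lintegral_Ioi_decay_mul_decay_max_le ha ha1 (norm_nonneg y)
  calc ∫⁻ x, decay a x * decay a (y - x)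
      ≤ ∫⁻ x, ENNReal.ofReal (2 ^ a) * (ψ ‖x‖ + ψ ‖y - x‖) :=
        lintegral_mono fun x => decay_mul_decay_sub_le (by linarith) x y
    _ = ENNReal.ofReal (2 ^ a) * ((∫⁻ x : AddCircle T, ψ ‖x‖) + ∫⁻ x : AddCircle T, ψ ‖x‖) := by
        rw [lintegral_const_mul' _ _ ENNReal.ofReal_ne_top,
          lintegral_add_left (f := fun x : AddCircle T => ψ ‖x‖) (hψ.comp measurable_norm),
          lintegral_sub_left_eq_self (fun x : AddCircle T => ψ ‖x‖) y]
    _ ≤ ENNReal.ofReal (2 ^ a) *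
          (2 * (K * decay (2 * a - 1) y) + 2 * (K * decay (2 * a - 1) y)) :=
        mul_le_mul' le_rfl (add_le_add hψ_int hψ_int)
    _ = ENNReal.ofReal (2 ^ a) * (4 * K) * decay (2 * a - 1) y := by ring

theorem exists_coe_eq_and_abs_eq_norm {p : ℝ} (x : AddCircle p) :
    ∃ t : ℝ, (t : AddCircle p) = x ∧ |t| = ‖x‖ := by
  induction x using QuotientAddGroup.induction_on with | _ t
  refine ⟨t - round (p⁻¹ * t) * p, ?_, (AddCircle.norm_eq p).symm⟩
  rw [AddCircle.coe_sub, ← zsmul_eq_mul, AddCircle.coe_zsmul, AddCircle.coe_period, smul_zero,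
    sub_zero]

theorem decay_coe_le_sum {T ρ t : ℝ} (hT : 0 < T) {N : ℕ} (ht : |t| ≤ N * T) :
    decay ρ (t : AddCircle T) ≤ ∑ j ∈ Finset.Icc (-N : ℤ) N, decay ρ (t - j * T) := by
  set j := round (T⁻¹ * t)
  have hj : j ∈ Finset.Icc (-N : ℤ) N := by
    have h_div : |T⁻¹ * t| ≤ N := by
      rwa [abs_mul, abs_of_pos (inv_pos.2 hT), inv_mul_le_iff₀' hT]
    have h_round := abs_le.1 (abs_sub_round (T⁻¹ * t))
    have h_lt : ((-N - 1 : ℤ) : ℝ) < j ∧ (j : ℝ) < (N + 1 : ℤ) := by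
      push_cast
      constructor <;> linarith [abs_le.1 h_div]
    rw [Int.cast_lt, Int.cast_lt] at h_lt
    rw [Finset.mem_Icc]
    omega
  calc decay ρ (t : AddCircle T) = decay ρ (t - j * T) :=
        decay_congr ρ (by rw [AddCircle.norm_eq, Real.norm_eq_abs])
    _ ≤ _ := Finset.single_le_sum (f := fun j : ℤ => decay ρ (t - j * T)) (fun _ _ => zero_le) hj

instance fact_two_pi_div_pos (τ : ℝ) [hτ : Fact (0 < τ)] : Fact (0 < 2 * Real.pi / τ) :=
  ⟨div_pos Real.two_pi_pos hτ.out⟩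

/-- The circle `ℝ / (2π/τ)ℤ` of time frequencies. -/
abbrev TimeCircle (τ : ℝ) : Type := AddCircle (2 * Real.pi / τ)

/-- The function `d_τ` on the circle of time frequencies. -/
def dCircle (τ : ℝ) (x : TimeCircle τ) : ℂ := (fourier 1 x - 1) / τ

theorem fourier_timeCircle_coe {τ : ℝ} (hτ : 0 < τ) (n : ℤ) (σ : ℝ) :
    fourier n (σ : TimeCircle τ) = timeMode τ n σ := by
  rw [fourier_coe_apply, timeMode]
  congr 1
  have hπ : (Real.pi : ℂ) ≠ 0 := by exact_mod_cast Real.pi_ne_zero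
  have hτ' : (τ : ℂ) ≠ 0 := by exact_mod_cast hτ.ne'
  push_cast
  field_simp

theorem dCircle_coe {τ : ℝ} (hτ : 0 < τ) (σ : ℝ) : dCircle τ (σ : TimeCircle τ) = dTau τ σ := by
  rw [dCircle, fourier_timeCircle_coe hτ, timeMode, dTau]
  push_cast
  rw [mul_one]

theorem continuous_dCircle (τ : ℝ) : Continuous (dCircle τ) := by
  unfold dCircle
  fun_prop

theorem norm_timeCircle_le {τ : ℝ} (hτ : 0 < τ) (x : TimeCircle τ) : ‖x‖ ≤ Real.pi / τ := by
  have hT := div_pos Real.two_pi_pos hτ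
  refine (AddCircle.norm_le_half_period _ hT.ne').trans_eq ?_
  rw [abs_of_pos hT, div_div, mul_comm τ 2, mul_div_mul_left _ _ two_ne_zero]

theorem norm_le_norm_dCircle {τ : ℝ} (hτ : 0 < τ) (x : TimeCircle τ) :
    2 / Real.pi * ‖x‖ ≤ ‖dCircle τ x‖ := by
  obtain ⟨σ, rfl, hσ⟩ := exists_coe_eq_and_abs_eq_norm x
  have h_half : |τ * σ / 2| = τ * |σ| / 2 := by rw [abs_div, abs_mul, abs_of_pos hτ, abs_two]
  have h_le : |τ * σ / 2| ≤ Real.pi / 2 := by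
    have h := norm_timeCircle_le hτ (σ : TimeCircle τ)
    rw [← hσ, le_div_iff₀ hτ] at h
    rw [h_half]
    linarith
  have h_sin := Real.mul_abs_le_abs_sin h_le
  have h_norm : ‖dCircle τ (σ : TimeCircle τ)‖ = 2 * |Real.sin (τ * σ / 2)| / τ := by
    rw [dCircle_coe hτ, dTau, norm_div, Complex.norm_of_nonneg hτ.le,
      show Complex.I * τ * σ = Complex.I * ((τ * σ : ℝ) : ℂ) by push_cast; ring,
      Complex.norm_exp_I_mul_ofReal_sub_one, norm_mul, Real.norm_eq_abs, Real.norm_eq_abs, abs_two]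
  rw [h_half] at h_sin
  rw [h_norm, ← hσ, le_div_iff₀ hτ]
  linarith

theorem decay_dCircle_le {τ a : ℝ} (hτ : 0 < τ) (ha : 0 ≤ a) (x : TimeCircle τ) :
    decay a (dCircle τ x) ≤ ENNReal.ofReal (2 ^ a) * decay a x := by
  refine decay_le_mul_decay ha two_pos ?_
  have h_pi : 1 / 2 ≤ 2 / Real.pi := by
    rw [div_le_div_iff₀ two_pos Real.pi_pos]
    linarith [Real.pi_le_four]
  have h_norm : ‖x‖ ≤ 2 * ‖dCircle τ x‖ := by
    nlinarith [norm_nonneg x, norm_le_norm_dCircle hτ x]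
  nlinarith [norm_nonneg x]

/-- The group of time and space frequencies. -/
abbrev FreqGroup (τ : ℝ) (d : ℕ) : Type := TimeCircle τ × (Fin d → ℤ)

/-- Haar measure `dσ dk` on the group of frequencies. -/
def freqMeasure (τ : ℝ) (d : ℕ) [Fact (0 < τ)] : Measure (FreqGroup τ d) :=
  volume.prod Measure.count

/-- The frequencies kept by the filter `Π_τ`. -/
def filterBand (τ : ℝ) (d : ℕ) : Set (FreqGroup τ d) := {z | z.2 ∈ filterSet d τ}

/-- The modulation weight `⟨d_τ(σ - |k|²)⟩`, which measures the distance of `(σ, k)` to the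
paraboloid `σ = |k|²`. -/
def modWeight {τ : ℝ} {d : ℕ} (z : FreqGroup τ d) : ℝ :=
  bracket (dCircle τ (z.1 - ((‖freqVec z.2‖ ^ 2 : ℝ) : TimeCircle τ)))

/-- The weight `⟨k⟩^s ⟨d_τ(σ - |k|²)⟩^b` in the norm of `X^{s,b}_τ`. -/
def weight {τ : ℝ} {d : ℕ} (s b : ℝ) (z : FreqGroup τ d) : ℝ≥0∞ :=
  ENNReal.ofReal (bracket (freqVec z.2) ^ s * modWeight z ^ b)

section Frequencies

variable {τ : ℝ} {d : ℕ}

theorem measurableSet_filterBand : MeasurableSet (filterBand τ d) :=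
  measurable_snd (Set.to_countable {p : Fin d → ℤ | p ∈ filterSet d τ}).measurableSet

theorem modWeight_pos (z : FreqGroup τ d) : 0 < modWeight z := bracket_pos _

theorem measurable_weight (s b : ℝ) : Measurable (weight s b : FreqGroup τ d → ℝ≥0∞) := by
  refine measurable_from_prod_countable_left fun k => ?_
  have h_bracket : Measurable (bracket : ℂ → ℝ) := by
    unfold bracket
    fun_prop
  have h_mod : Measurable fun x : TimeCircle τ => modWeight (x, k) :=
    h_bracket.comp ((continuous_dCircle τ).comp (by fun_prop)).measurable
  simp only [weight]
  fun_prop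

theorem lintegral_freqMeasure [Fact (0 < τ)] {f : FreqGroup τ d → ℝ≥0∞} (hf : Measurable f) :
    ∫⁻ z, f z ∂(freqMeasure τ d) = ∑' k, ∫⁻ x, f (x, k) := by
  rw [freqMeasure, lintegral_prod_symm' _ hf, lintegral_count]

theorem weight_mul_weight (s s' b b' : ℝ) (z : FreqGroup τ d) :
    weight s b z * weight s' b' z = weight (s + s') (b + b') z := by
  have hk := bracket_pos (freqVec z.2)
  have hσ := modWeight_pos z
  rw [weight, weight, weight, ← ENNReal.ofReal_mul (by positivity), Real.rpow_add hk,
    Real.rpow_add hσ]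
  congr 1
  ring

theorem weight_neg_neg (ρ a : ℝ) (z : FreqGroup τ d) :
    weight (-ρ) (-a) z = decay ρ (freqVec z.2) *
      decay a (dCircle τ (z.1 - ((‖freqVec z.2‖ ^ 2 : ℝ) : TimeCircle τ))) :=
  ENNReal.ofReal_mul (Real.rpow_nonneg (bracket_pos _).le _)

theorem weight_zero_neg (a : ℝ) (z : FreqGroup τ d) :
    weight 0 (-a) z = decay a (dCircle τ (z.1 - ((‖freqVec z.2‖ ^ 2 : ℝ) : TimeCircle τ))) := by
  rw [weight, Real.rpow_zero, one_mul, decay, modWeight]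

theorem norm_freqVec_sq_le (hτ : 0 < τ) {k : Fin d → ℤ} (hk : k ∈ filterSet d τ) :
    ‖freqVec k‖ ^ 2 ≤ d / τ := by
  rw [mem_filterSet] at hk
  have h_coord : ∀ j, (k j : ℝ) ^ 2 ≤ 1 / τ := fun j => calc
    (k j : ℝ) ^ 2 ≤ (τ ^ (-(1 / 2) : ℝ)) ^ 2 :=
      sq_le_sq' (abs_le.1 (hk j)).1 (abs_le.1 (hk j)).2
    _ = 1 / τ := by
      rw [← Real.rpow_natCast, ← Real.rpow_mul hτ.le]
      norm_num [Real.rpow_neg_one]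
  calc ‖freqVec k‖ ^ 2 = ∑ j, (k j : ℝ) ^ 2 := by
        rw [norm_freqVec_sq, sqNorm]
        push_cast
        rfl
    _ ≤ ∑ _j : Fin d, 1 / τ := Finset.sum_le_sum fun j _ => h_coord j
    _ = d / τ := by simp [div_eq_mul_inv]

theorem norm_freqVec_sq_add_norm_freqVec_sub_sq (k p : Fin d → ℤ) :
    ‖freqVec p‖ ^ 2 + ‖freqVec (k - p)‖ ^ 2 =
      ‖freqVec k‖ ^ 2 / 2 + sqNorm ((2 : ℤ) • p - k) / 2 := by
  simp only [norm_freqVec_sq, sqNorm, Pi.sub_apply, Pi.smul_apply, smul_eq_mul]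
  push_cast
  rw [← add_div, ← Finset.sum_add_distrib, ← Finset.sum_add_distrib, Finset.sum_div]
  refine Finset.sum_congr rfl fun i _ => ?_
  ring

theorem decay_coe_sub_le_sum (hτ : 0 < τ) {γ σ : ℝ} (hσ : |σ| ≤ Real.pi / τ) {k p : Fin d → ℤ}
    (hp : p ∈ filterSet d τ) (hkp : k - p ∈ filterSet d τ) :
    decay γ ((σ : TimeCircle τ) - ((‖freqVec p‖ ^ 2 : ℝ) : TimeCircle τ) -
        ((‖freqVec (k - p)‖ ^ 2 : ℝ) : TimeCircle τ)) ≤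
      ∑ j ∈ Finset.Icc (-(d + 1 : ℕ) : ℤ) (d + 1 : ℕ),
        decay γ (σ - j * (2 * Real.pi / τ) - ‖freqVec k‖ ^ 2 / 2 -
          sqNorm ((2 : ℤ) • p - k) / 2) := by
  have h_sum := norm_freqVec_sq_add_norm_freqVec_sub_sq k p
  have h_abs : |σ - (‖freqVec p‖ ^ 2 + ‖freqVec (k - p)‖ ^ 2)| ≤
      (d + 1 : ℕ) * (2 * Real.pi / τ) := by
    have h_le := add_le_add (norm_freqVec_sq_le hτ hp) (norm_freqVec_sq_le hτ hkp)
    have h_d : (d : ℝ) / τ ≤ d * (Real.pi / τ) := by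
      rw [← mul_div_assoc]
      gcongr
      nlinarith [Real.pi_gt_three, (Nat.cast_nonneg d : (0 : ℝ) ≤ d)]
    have h_pi : 0 ≤ Real.pi / τ := by positivity
    have h_nonneg : 0 ≤ ‖freqVec p‖ ^ 2 + ‖freqVec (k - p)‖ ^ 2 := by positivity
    have h_d0 : 0 ≤ d * (Real.pi / τ) := by positivity
    rw [abs_le] at hσ ⊢
    push_cast
    rw [mul_div_assoc]
    constructor <;> linarith
  convert decay_coe_le_sum (ρ := γ) (div_pos Real.two_pi_pos hτ) h_abs using 2
  · rw [← AddCircle.coe_sub, ← AddCircle.coe_sub, sub_sub]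
  · congr 1
    linarith

end Frequencies

theorem exists_lintegral_decay_dCircle_mul_le {a : ℝ} (ha : 1 / 2 < a) (ha1 : a < 1) :
    ∃ C : ℝ≥0, ∀ (τ : ℝ) [Fact (0 < τ)] (x₀ q₁ q₂ : TimeCircle τ),
      ∫⁻ x, decay a (dCircle τ (x - q₁)) * decay a (dCircle τ (x₀ - x - q₂)) ≤
        C * decay (2 * a - 1) (x₀ - q₁ - q₂) := by
  obtain ⟨C, hC⟩ := exists_lintegral_decay_mul_decay_sub_le ha ha1
  set A : ℝ≥0∞ := ENNReal.ofReal (2 ^ a)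
  refine ⟨(A ^ 2 * C).toNNReal, fun τ hτ x₀ q₁ q₂ => ?_⟩
  rw [ENNReal.coe_toNNReal (by finiteness)]
  have h_decay := decay_dCircle_le hτ.out (one_half_pos.trans ha).le
  calc ∫⁻ x, decay a (dCircle τ (x - q₁)) * decay a (dCircle τ (x₀ - x - q₂))
      ≤ ∫⁻ x, A ^ 2 * (decay a (x - q₁) * decay a (x₀ - q₁ - q₂ - (x - q₁))) :=
        lintegral_mono fun x => (mul_le_mul' (h_decay _) (h_decay _)).trans_eq (by
          rw [show x₀ - q₁ - q₂ - (x - q₁) = x₀ - x - q₂ by abel]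
          ring)
    _ = A ^ 2 * ∫⁻ x, decay a x * decay a (x₀ - q₁ - q₂ - x) := by
        rw [lintegral_const_mul' _ _ (by finiteness), lintegral_sub_right_eq_self
          (fun x => decay a x * decay a (x₀ - q₁ - q₂ - x)) q₁]
    _ ≤ A ^ 2 * (C * decay (2 * a - 1) (x₀ - q₁ - q₂)) := by
        gcongr
        exact hC _ _
    _ = A ^ 2 * C * decay (2 * a - 1) (x₀ - q₁ - q₂) := (mul_assoc _ _ _).symm

theorem exists_lintegral_weight_mul_weight_le {a : ℝ} (ha : 1 / 2 < a) (ha1 : a < 1) :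
    ∃ C : ℝ≥0, ∀ (d : ℕ) (τ ρ : ℝ) [Fact (0 < τ)] (z : FreqGroup τ d) (p : Fin d → ℤ),
      ∫⁻ x, weight (-ρ) (-a) (x, p) * weight 0 (-a) (z - (x, p)) ≤
        C * (decay ρ (freqVec p) * decay (2 * a - 1) (z.1 - ((‖freqVec p‖ ^ 2 : ℝ) : TimeCircle τ) -
          ((‖freqVec (z.2 - p)‖ ^ 2 : ℝ) : TimeCircle τ))) := by
  obtain ⟨C, hC⟩ := exists_lintegral_decay_dCircle_mul_le ha ha1
  refine ⟨C, fun d τ ρ _ z p => ?_⟩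
  simp only [weight_neg_neg, weight_zero_neg, mul_assoc, Prod.fst_sub, Prod.snd_sub]
  rw [lintegral_const_mul' (decay ρ (freqVec p)) _ ENNReal.ofReal_ne_top, mul_left_comm]
  gcongr
  exact hC τ _ _ _

theorem exists_lconvolution_weight_le {d : ℕ} {s b : ℝ} (hs : 0 < s) (hb : 1 / 4 < b)
    (hb' : b < 1 / 2) (h : (d : ℝ) / 2 < s + (4 * b - 1)) :
    ∃ K : ℝ≥0, ∀ (τ : ℝ) [Fact (0 < τ)] (z : FreqGroup τ d),
      ((filterBand τ d).indicator (weight (-(2 * s)) (-(2 * b))) ⋆ₗ[freqMeasure τ d]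
        (filterBand τ d).indicator (weight 0 (-(2 * b)))) z ≤ K := by
  obtain ⟨C, hC⟩ := exists_lintegral_weight_mul_weight_le (a := 2 * b) (by linarith) (by linarith)
  obtain ⟨K, hK⟩ := exists_tsum_lattice_le d hs (γ := 4 * b - 1) (by linarith) (by linarith) h
  let J := Finset.Icc (-(d + 1 : ℕ) : ℤ) (d + 1 : ℕ)
  refine ⟨C * (J.card * K), fun τ hτF ⟨x₀, k⟩ => ?_⟩
  have hτ : 0 < τ := hτF.out
  obtain ⟨σ, rfl, hσ⟩ := exists_coe_eq_and_abs_eq_norm x₀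
  replace hσ : |σ| ≤ Real.pi / τ := hσ.trans_le (norm_timeCircle_le hτ _)
  set w : FreqGroup τ d → ℝ≥0∞ := (filterBand τ d).indicator (weight (-(2 * s)) (-(2 * b)))
  set v : FreqGroup τ d → ℝ≥0∞ := (filterBand τ d).indicator (weight 0 (-(2 * b)))
  have hw_meas : Measurable w := (measurable_weight _ _).indicator measurableSet_filterBand
  have hv_meas : Measurable v := (measurable_weight _ _).indicator measurableSet_filterBand
  have h_fixed : ∀ p : Fin d → ℤ, ∫⁻ x, w (x, p) * v (-(x, p) + ((σ : TimeCircle τ), k)) ≤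
      C * ∑ j ∈ J, decay (2 * s) (freqVec p) * decay (4 * b - 1)
        (σ - j * (2 * Real.pi / τ) - ‖freqVec k‖ ^ 2 / 2 - sqNorm ((2 : ℤ) • p - k) / 2) := by
    intro p
    by_cases hp : p ∈ filterSet d τ ∧ k - p ∈ filterSet d τ
    · have h_mem : ∀ x, (x, p) ∈ filterBand τ d ∧
          ((σ : TimeCircle τ), k) - (x, p) ∈ filterBand τ d := fun _ => hp
      simp only [w, v, neg_add_eq_sub, Set.indicator_of_mem (h_mem _).1,
        Set.indicator_of_mem (h_mem _).2]
      refine (hC d τ (2 * s) _ p).trans ?_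
      rw [← Finset.mul_sum, show 2 * (2 * b) - 1 = 4 * b - 1 by ring]
      gcongr
      exact decay_coe_sub_le_sum hτ hσ hp.1 hp.2
    · have h_zero : ∀ x : TimeCircle τ,
          w (x, p) * v (-(x, p) + ((σ : TimeCircle τ), k)) = 0 := by
        intro x
        rw [neg_add_eq_sub, mul_eq_zero]
        exact (not_and_or.1 hp).imp (fun h => Set.indicator_of_notMem h _)
          fun h => Set.indicator_of_notMem h _
      rw [lintegral_congr h_zero, lintegral_zero]
      exact zero_le
  calc (w ⋆ₗ[freqMeasure τ d] v) (σ, k)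
      = ∑' p, ∫⁻ x, w (x, p) * v (-(x, p) + ((σ : TimeCircle τ), k)) := by
        rw [lconvolution_def, lintegral_freqMeasure (by fun_prop)]
    _ ≤ _ := ENNReal.tsum_le_tsum h_fixed
    _ = C * ∑ j ∈ J, ∑' p : Fin d → ℤ, decay (2 * s) (freqVec p) * decay (4 * b - 1)
        (σ - j * (2 * Real.pi / τ) - ‖freqVec k‖ ^ 2 / 2 - sqNorm ((2 : ℤ) • p - k) / 2) := by
        rw [ENNReal.tsum_mul_left, Summable.tsum_finsetSum fun _ _ => ENNReal.summable]
    _ ≤ C * ∑ _j ∈ J, (K : ℝ≥0∞) := by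
        gcongr with j
        exact hK _ _
    _ = (C * (J.card * K) : ℝ≥0) := by simp

/-! ### Convolution of nonnegative functions -/

theorem sq_lintegral_le_of_sq_le_mul {α : Type*} [MeasurableSpace α] {μ : Measure α}
    {a p q : α → ℝ≥0∞} (hp : AEMeasurable p μ) (hq : AEMeasurable q μ)
    (h : ∀ x, a x ^ 2 ≤ p x * q x) : (∫⁻ x, a x ∂μ) ^ 2 ≤ (∫⁻ x, p x ∂μ) * ∫⁻ x, q x ∂μ := by
  have h_sq : ∀ r : ℝ≥0∞, (r ^ (1 / 2 : ℝ)) ^ 2 = r := fun r => by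
    rw [← ENNReal.rpow_natCast, ← ENNReal.rpow_mul]
    norm_num
  have h_root : ∀ x, a x ≤ ((fun x => p x ^ (1 / 2 : ℝ)) * fun x => q x ^ (1 / 2 : ℝ)) x :=
    fun x => by
      refine (ENNReal.pow_le_pow_left_iff two_ne_zero).1 ?_
      rw [Pi.mul_apply, mul_pow, h_sq, h_sq]
      exact h x
  have h_holder := (lintegral_mono h_root).trans (ENNReal.lintegral_mul_le_Lp_mul_Lq μ
    (by constructor <;> norm_num : Real.HolderConjugate 2 2) (hp.pow_const _) (hq.pow_const _))
  simp only [ENNReal.rpow_two, h_sq] at h_holder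
  calc (∫⁻ x, a x ∂μ) ^ 2
      ≤ ((∫⁻ x, p x ∂μ) ^ (1 / 2 : ℝ) * (∫⁻ x, q x ∂μ) ^ (1 / 2 : ℝ)) ^ 2 := by gcongr
    _ = (∫⁻ x, p x ∂μ) * ∫⁻ x, q x ∂μ := by rw [mul_pow, h_sq, h_sq]

theorem sq_lintegral_mul_le {α : Type*} [MeasurableSpace α] {μ : Measure α}
    {f g : α → ℝ≥0∞} (hf : Measurable f) (hg : Measurable g) :
    (∫⁻ x, f x * g x ∂μ) ^ 2 ≤ (∫⁻ x, f x ^ 2 ∂μ) * ∫⁻ x, g x ^ 2 ∂μ :=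
  sq_lintegral_le_of_sq_le_mul (hf.pow_const 2).aemeasurable (hg.pow_const 2).aemeasurable
    fun _ => (mul_pow _ _ _).le

theorem le_of_sq_le_mul_self {a K : ℝ≥0∞} (ha : a ≠ ∞) (h : a ^ 2 ≤ K * a) : a ≤ K := by
  rcases eq_or_ne a 0 with rfl | h0
  · exact zero_le
  · exact (ENNReal.mul_le_mul_iff_left h0 ha).1 (sq a ▸ h)

theorem lintegral_sq_le_of_forall_sq_lintegral_mul_le {α : Type*} [MeasurableSpace α]
    {μ : Measure α} [SigmaFinite μ] {Φ : α → ℝ≥0∞} (hΦ : Measurable Φ) {K : ℝ≥0∞}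
    (h : ∀ H : α → ℝ≥0∞, Measurable H → (∫⁻ x, H x * Φ x ∂μ) ^ 2 ≤ K * ∫⁻ x, H x ^ 2 ∂μ) :
    ∫⁻ x, Φ x ^ 2 ∂μ ≤ K := by
  -- Testing against `Φ` itself needs a finite integral, so `Φ` is truncated.
  let F : ℕ → α → ℝ≥0∞ := fun n => (spanningSets μ n).indicator fun x => min (Φ x) n
  have hF : ∀ n, Measurable (F n) := fun n =>
    (hΦ.min measurable_const).indicator (measurableSet_spanningSets μ n)
  have hF_le : ∀ n x, F n x ≤ Φ x := fun n x =>
    Set.indicator_apply_le' (fun _ => min_le_left _ _) fun _ => zero_le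
  have hF_mono : ∀ x, Monotone fun n => F n x ^ 2 := fun x m n hmn => by
    have h_min : min (Φ x) m ≤ min (Φ x) n := by gcongr
    have h_subset : spanningSets μ m ⊆ spanningSets μ n := monotone_spanningSets μ hmn
    by_cases hx : x ∈ spanningSets μ m
    · simp only [F, Set.indicator_of_mem hx, Set.indicator_of_mem (h_subset hx)]
      gcongr
    · simp [F, hx]
  have hF_tendsto : ∀ x, Filter.Tendsto (fun n => F n x ^ 2) Filter.atTop (nhds (Φ x ^ 2)) := by
    intro x
    have h_min : Filter.Tendsto (fun n : ℕ => min (Φ x) n) Filter.atTop (nhds (Φ x)) := by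
      simpa using (tendsto_const_nhds (x := Φ x)).min ENNReal.tendsto_nat_nhds_top
    refine ((ENNReal.continuous_pow 2).tendsto _).comp (h_min.congr' ?_)
    filter_upwards [eventually_mem_spanningSets μ x] with n hn
    exact (Set.indicator_of_mem hn fun x => min (Φ x) n).symm
  have hF_finite : ∀ n, ∫⁻ x, F n x ^ 2 ∂μ ≠ ∞ := fun n => by
    have h_le : ∀ x, F n x ^ 2 ≤ (spanningSets μ n).indicator (fun _ => (n : ℝ≥0∞) ^ 2) x := by
      intro x
      by_cases hx : x ∈ spanningSets μ n
      · simp only [F, Set.indicator_of_mem hx]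
        gcongr
        exact min_le_right _ _
      · simp [F, hx]
    refine ne_top_of_le_ne_top ?_ (lintegral_mono h_le)
    rw [lintegral_indicator_const (measurableSet_spanningSets μ n)]
    exact ENNReal.mul_ne_top (by finiteness) (measure_spanningSets_lt_top μ n).ne
  refine le_of_tendsto' (lintegral_tendsto_of_tendsto_of_monotone
    (fun n => ((hF n).pow_const 2).aemeasurable) (ae_of_all _ hF_mono)
    (ae_of_all _ hF_tendsto)) fun n => le_of_sq_le_mul_self (hF_finite n) ?_
  refine le_trans ?_ (h (F n) (hF n))
  gcongr with x
  rw [sq]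
  gcongr
  exact hF_le n x

section Group

variable {G : Type*} [AddCommGroup G] [MeasurableSpace G] {μ : Measure G}

theorem lconvolution_mono_left {f f' : G → ℝ≥0∞} (hf : ∀ x, f x ≤ f' x) (g : G → ℝ≥0∞) (z : G) :
    (f ⋆ₗ[μ] g) z ≤ (f' ⋆ₗ[μ] g) z :=
  lintegral_mono fun _ => mul_le_mul_left (hf _) _

variable [MeasurableAdd₂ G] [MeasurableNeg G]

theorem mul_lconvolution_le {m : G → ℝ≥0∞} (hm : Measurable m) {c : ℝ≥0∞}
    (hmc : ∀ x y, m (x + y) ≤ c * (m x + m y)) {f g : G → ℝ≥0∞} (hf : Measurable f)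
    (hg : Measurable g) (z : G) :
    m z * (f ⋆ₗ[μ] g) z ≤
      c * (((fun x => m x * f x) ⋆ₗ[μ] g) z + (f ⋆ₗ[μ] fun x => m x * g x) z) := by
  simp only [lconvolution_def]
  rw [← lintegral_add_left (by fun_prop), ← lintegral_const_mul _ (by fun_prop),
    ← lintegral_const_mul _ (by fun_prop)]
  refine lintegral_mono fun y => ?_
  have h := hmc y (-y + z)
  rw [add_neg_cancel_left] at h
  calc m z * (f y * g (-y + z)) ≤ c * (m y + m (-y + z)) * (f y * g (-y + z)) := by gcongr
    _ = c * (m y * f y * g (-y + z) + f y * (m (-y + z) * g (-y + z))) := by ring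

theorem const_mul_add_lconvolution {f g h : G → ℝ≥0∞} (c : ℝ≥0∞) (hf : Measurable f)
    (hg : Measurable g) (hh : Measurable h) (z : G) :
    ((fun x => c * (f x + g x)) ⋆ₗ[μ] h) z = c * ((f ⋆ₗ[μ] h) z + (g ⋆ₗ[μ] h) z) := by
  simp only [lconvolution_def]
  rw [← lintegral_add_left (by fun_prop), ← lintegral_const_mul _ (by fun_prop)]
  exact lintegral_congr fun y => by ring

theorem sq_lconvolution_le {f g w v F H : G → ℝ≥0∞} (hw : Measurable w)
    (hv : Measurable v) (hF : Measurable F) (hH : Measurable H)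
    (hf : ∀ x, f x ^ 2 ≤ w x * F x) (hg : ∀ x, g x ^ 2 ≤ v x * H x) (z : G) :
    (f ⋆ₗ[μ] g) z ^ 2 ≤ (w ⋆ₗ[μ] v) z * (F ⋆ₗ[μ] H) z := by
  simp only [lconvolution_def]
  refine sq_lintegral_le_of_sq_le_mul (by fun_prop) (by fun_prop) fun y => ?_
  calc (f y * g (-y + z)) ^ 2 = f y ^ 2 * g (-y + z) ^ 2 := mul_pow _ _ _
    _ ≤ w y * F y * (v (-y + z) * H (-y + z)) := mul_le_mul' (hf y) (hg _)
    _ = w y * v (-y + z) * (F y * H (-y + z)) := by ring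

variable [SFinite μ]

theorem lintegral_mul_lconvolution_neg {f g h : G → ℝ≥0∞} (hf : Measurable f) (hg : Measurable g)
    (hh : Measurable h) :
    ∫⁻ z, h z * (f ⋆ₗ[μ] fun x => g (-x)) z ∂μ = ∫⁻ z, f z * (h ⋆ₗ[μ] g) z ∂μ := by
  simp only [lconvolution_def]
  calc ∫⁻ z, h z * ∫⁻ y, f y * g (-(-y + z)) ∂μ ∂μ
      = ∫⁻ z, ∫⁻ y, h z * (f y * g (-(-y + z))) ∂μ ∂μ :=
        lintegral_congr fun z => (lintegral_const_mul _ (by fun_prop)).symm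
    _ = ∫⁻ y, ∫⁻ z, h z * (f y * g (-(-y + z))) ∂μ ∂μ := lintegral_lintegral_swap (by fun_prop)
    _ = ∫⁻ y, ∫⁻ z, f y * (h z * g (-z + y)) ∂μ ∂μ :=
        lintegral_congr fun y => lintegral_congr fun z => by
          rw [neg_add, neg_neg, add_comm y (-z)]
          ring
    _ = ∫⁻ y, f y * ∫⁻ z, h z * g (-z + y) ∂μ ∂μ :=
        lintegral_congr fun y => lintegral_const_mul _ (by fun_prop)

variable [μ.IsAddLeftInvariant]

theorem lintegral_lconvolution {f g : G → ℝ≥0∞} (hf : Measurable f) (hg : Measurable g) :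
    ∫⁻ z, (f ⋆ₗ[μ] g) z ∂μ = (∫⁻ x, f x ∂μ) * ∫⁻ x, g x ∂μ := by
  simp only [lconvolution_def]
  calc ∫⁻ z, ∫⁻ y, f y * g (-y + z) ∂μ ∂μ
      = ∫⁻ y, ∫⁻ z, f y * g (-y + z) ∂μ ∂μ := lintegral_lintegral_swap (by fun_prop)
    _ = ∫⁻ y, f y * ∫⁻ z, g z ∂μ ∂μ := lintegral_congr fun y => by
        rw [lintegral_const_mul _ (by fun_prop), lintegral_add_left_eq_self]
    _ = (∫⁻ x, f x ∂μ) * ∫⁻ x, g x ∂μ := lintegral_mul_const _ hf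

theorem lintegral_sq_lconvolution_le {f g w v F H : G → ℝ≥0∞} (hw : Measurable w)
    (hv : Measurable v) (hF : Measurable F) (hH : Measurable H)
    (hf : ∀ x, f x ^ 2 ≤ w x * F x) (hg : ∀ x, g x ^ 2 ≤ v x * H x) {K : ℝ≥0∞}
    (hK : ∀ z, (w ⋆ₗ[μ] v) z ≤ K) :
    ∫⁻ z, (f ⋆ₗ[μ] g) z ^ 2 ∂μ ≤ K * ((∫⁻ x, F x ∂μ) * ∫⁻ x, H x ∂μ) := by
  calc ∫⁻ z, (f ⋆ₗ[μ] g) z ^ 2 ∂μ ≤ ∫⁻ z, K * (F ⋆ₗ[μ] H) z ∂μ := by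
        gcongr with z
        exact (sq_lconvolution_le hw hv hF hH hf hg z).trans (by gcongr; exact hK z)
    _ = K * ((∫⁻ x, F x ∂μ) * ∫⁻ x, H x ∂μ) := by
        rw [lintegral_const_mul _ (measurable_lconvolution μ hF hH), lintegral_lconvolution hF hH]

variable [μ.IsNegInvariant]

theorem lconvolution_right_comm {f g h : G → ℝ≥0∞} (hf : Measurable f) (hg : Measurable g)
    (hh : Measurable h) : (f ⋆ₗ[μ] g) ⋆ₗ[μ] h = (f ⋆ₗ[μ] h) ⋆ₗ[μ] g := by
  rw [← lconvolution_assoc hf hg hh, ← lconvolution_assoc hf hh hg, lconvolution_comm (f := g)]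

theorem lintegral_sq_lconvolution_neg {f g : G → ℝ≥0∞} (hf : Measurable f) (hg : Measurable g) :
    ∫⁻ z, (f ⋆ₗ[μ] fun x => g (-x)) z ^ 2 ∂μ = ∫⁻ z, (f ⋆ₗ[μ] g) z ^ 2 ∂μ := by
  have hg' : Measurable fun x => g (-x) := by fun_prop
  simp only [sq]
  rw [lintegral_mul_lconvolution_neg hf hg (measurable_lconvolution μ hf hg'),
    lconvolution_right_comm hf hg' hg, lintegral_mul_lconvolution_neg
      (measurable_lconvolution μ hf hg) hg hf]

end Group

/-! ### The bilinear and trilinear estimates on the Fourier side -/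

section Weighted

variable {τ : ℝ} {d : ℕ}

theorem weight_mul_weight_neg (s b : ℝ) (z : FreqGroup τ d) :
    weight s b z * weight (-s) (-b) z = 1 := by
  rw [weight_mul_weight]
  simp [weight]

theorem weight_sq (s b : ℝ) (z : FreqGroup τ d) : weight s b z ^ 2 = weight (2 * s) (2 * b) z := by
  rw [sq, weight_mul_weight, two_mul, two_mul]

theorem weight_mono (s : ℝ) {b b' : ℝ} (h : b ≤ b') (z : FreqGroup τ d) :
    weight s b z ≤ weight s b' z := by
  unfold weight
  gcongr
  · exact Real.rpow_nonneg (bracket_pos _).le _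
  · exact one_le_bracket _

theorem bracket_add_le {E : Type*} [NormedAddCommGroup E] (x y : E) :
    bracket (x + y) ≤ bracket x + bracket y := by
  have h_norm_le : ∀ z : E, ‖z‖ ≤ bracket z := fun z => by
    rw [bracket_eq_sqrt]
    exact Real.le_sqrt_of_sq_le (by linarith)
  refine (sq_le_sq₀ (bracket_pos _).le (add_pos (bracket_pos x) (bracket_pos y)).le).1 ?_
  have h_mul := mul_le_mul (h_norm_le x) (h_norm_le y) (norm_nonneg y) (bracket_pos x).le
  have h_sq : ‖x + y‖ ^ 2 ≤ (‖x‖ + ‖y‖) ^ 2 := by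
    gcongr
    exact norm_add_le x y
  rw [bracket_sq, add_sq, bracket_sq, bracket_sq]
  linarith

theorem weight_add_le {s : ℝ} (hs : 0 ≤ s) (x y : FreqGroup τ d) :
    weight s 0 (x + y) ≤ ENNReal.ofReal (2 ^ s) * (weight s 0 x + weight s 0 y) := by
  have h_freq : freqVec (x + y).2 = freqVec x.2 + freqVec y.2 := by
    ext j
    simp [freqVec]
  simp only [weight, Real.rpow_zero, mul_one, h_freq]
  have hX := bracket_pos (freqVec x.2)
  have hY := bracket_pos (freqVec y.2)
  have h_add := bracket_add_le (freqVec x.2) (freqVec y.2)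
  have h_pos := bracket_pos (freqVec x.2 + freqVec y.2)
  set X := bracket (freqVec x.2)
  set Y := bracket (freqVec y.2)
  rw [← ENNReal.ofReal_add (by positivity) (by positivity), ← ENNReal.ofReal_mul (by positivity)]
  refine ENNReal.ofReal_le_ofReal ?_
  have h_max : max X Y ^ s ≤ X ^ s + Y ^ s := by
    rcases max_choice X Y with h | h <;> rw [h]
    · exact le_add_of_nonneg_right (by positivity)
    · exact le_add_of_nonneg_left (by positivity)
  calc bracket (freqVec x.2 + freqVec y.2) ^ s ≤ (2 * max X Y) ^ s := by
        gcongr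
        exact h_add.trans (by linarith [le_max_left X Y, le_max_right X Y])
    _ = 2 ^ s * max X Y ^ s := Real.mul_rpow two_pos.le (hX.le.trans (le_max_left _ _))
    _ ≤ 2 ^ s * (X ^ s + Y ^ s) := by gcongr

theorem weight_neg (s : ℝ) (x : FreqGroup τ d) : weight s 0 (-x) = weight s 0 x := by
  have h : freqVec (-x).2 = -freqVec x.2 := by
    ext j
    simp [freqVec]
  rw [weight, weight, h]
  simp [bracket]

/-- Functions of the frequency whose support lies in the band kept by the filter. -/
def IsFiltered (f : FreqGroup τ d → ℝ≥0∞) : Prop := ∀ z ∉ filterBand τ d, f z = 0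

theorem IsFiltered.mul_left {f : FreqGroup τ d → ℝ≥0∞} (hf : IsFiltered f)
    (w : FreqGroup τ d → ℝ≥0∞) : IsFiltered fun z => w z * f z :=
  fun z hz => by simp [hf z hz]

theorem isFiltered_indicator (f : FreqGroup τ d → ℝ≥0∞) :
    IsFiltered ((filterBand τ d).indicator f) := fun _ hz => Set.indicator_of_notMem hz f

theorem IsFiltered.sq_le {f : FreqGroup τ d → ℝ≥0∞} (hf : IsFiltered f) (s b : ℝ)
    (z : FreqGroup τ d) :
    f z ^ 2 ≤ (filterBand τ d).indicator (weight (-(2 * s)) (-(2 * b))) z *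
      (weight s b z * f z) ^ 2 := by
  by_cases hz : z ∈ filterBand τ d
  · rw [Set.indicator_of_mem hz, mul_pow, weight_sq, ← mul_assoc, mul_comm (weight _ _ _),
      weight_mul_weight_neg, one_mul]
  · simp [hf z hz]

theorem one_le_weight_mul_add_weight_mul (s : ℝ) (x y : FreqGroup τ d) :
    1 ≤ weight (-s) 0 x * weight s 0 y + weight s 0 x * weight (-s) 0 y := by
  have h_inv : ∀ z : FreqGroup τ d, weight s 0 z * weight (-s) 0 z = 1 := fun z => by
    simpa using weight_mul_weight_neg s 0 z
  rcases le_total (weight s 0 x) (weight s 0 y) with h | h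
  · refine le_add_right ?_
    rw [← h_inv x, mul_comm]
    gcongr
  · refine le_add_left ?_
    rw [← h_inv y]
    gcongr

/-- The family `f` with `⟨k⟩^s` applied to its `i`-th member. -/
def updateWeight (s : ℝ) (f : Fin 3 → FreqGroup τ d → ℝ≥0∞) (i : Fin 3) :
    Fin 3 → FreqGroup τ d → ℝ≥0∞ :=
  Function.update f i fun z => weight s 0 z * f i z

theorem measurable_updateWeight {f : Fin 3 → FreqGroup τ d → ℝ≥0∞}
    (hf : ∀ i, Measurable (f i)) (s : ℝ) (i j : Fin 3) :
    Measurable (updateWeight s f i j) := by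
  rcases eq_or_ne j i with rfl | h
  · rw [updateWeight, Function.update_self]
    exact (measurable_weight s 0).mul (hf j)
  · simpa only [updateWeight, Function.update_of_ne h] using hf j

theorem isFiltered_updateWeight {f : Fin 3 → FreqGroup τ d → ℝ≥0∞}
    (hf : ∀ i, IsFiltered (f i)) (s : ℝ) (i j : Fin 3) :
    IsFiltered (updateWeight s f i j) := by
  rcases eq_or_ne j i with rfl | h
  · simpa only [updateWeight, Function.update_self] using (hf j).mul_left (weight s 0)
  · simpa only [updateWeight, Function.update_of_ne h] using hf j

variable [Fact (0 < τ)]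

instance : SigmaFinite (freqMeasure τ d) := by
  unfold freqMeasure
  infer_instance

instance : (freqMeasure τ d).IsAddLeftInvariant := by
  unfold freqMeasure
  infer_instance

instance : (freqMeasure τ d).IsNegInvariant :=
  ⟨((Measure.measurePreserving_neg (volume : Measure (TimeCircle τ))).prod
    (Measure.measurePreserving_neg (Measure.count : Measure (Fin d → ℤ)))).map_eq⟩

/-- The square of the norm of `X^{s,b}_τ`, on the Fourier side. -/
def weightedSq (s b : ℝ) (f : FreqGroup τ d → ℝ≥0∞) : ℝ≥0∞ :=
  ∫⁻ z, (weight s b z * f z) ^ 2 ∂(freqMeasure τ d)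

theorem weightedSq_weight_mul (s s' b b' : ℝ) (f : FreqGroup τ d → ℝ≥0∞) :
    weightedSq s b (fun z => weight s' b' z * f z) = weightedSq (s + s') (b + b') f := by
  simp only [weightedSq, ← mul_assoc, weight_mul_weight]

theorem weightedSq_mono (s : ℝ) {b b' : ℝ} (h : b ≤ b') (f : FreqGroup τ d → ℝ≥0∞) :
    weightedSq s b f ≤ weightedSq s b' f := by
  unfold weightedSq
  gcongr
  exact weight_mono s h _

/-- The bilinear estimate `‖f * g‖²_{L²} ≤ K ‖f‖²_{X^{s,b}} ‖g‖²_{X^{0,b}}` on the Fourier side,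
for functions in the frequency band of the filter. -/
def BilinearBound (τ : ℝ) (d : ℕ) [Fact (0 < τ)] (s b : ℝ) (K : ℝ≥0∞) : Prop :=
  ∀ f g : FreqGroup τ d → ℝ≥0∞, Measurable f → Measurable g → IsFiltered f → IsFiltered g →
    ∫⁻ z, (f ⋆ₗ[freqMeasure τ d] g) z ^ 2 ∂(freqMeasure τ d) ≤
      K * (weightedSq s b f * weightedSq 0 b g)

theorem bilinearBound_of_lconvolution_weight_le {s b : ℝ} {K : ℝ≥0∞}
    (hK : ∀ z : FreqGroup τ d,
      ((filterBand τ d).indicator (weight (-(2 * s)) (-(2 * b))) ⋆ₗ[freqMeasure τ d]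
        (filterBand τ d).indicator (weight 0 (-(2 * b)))) z ≤ K) :
    BilinearBound τ d s b K := by
  intro f g hf hg hfS hgS
  have h_weight : ∀ s b, Measurable ((filterBand τ d).indicator (weight s b)) := fun s b =>
    (measurable_weight s b).indicator measurableSet_filterBand
  exact lintegral_sq_lconvolution_le (h_weight _ _) (h_weight _ _)
    (((measurable_weight _ _).mul hf).pow_const 2) (((measurable_weight _ _).mul hg).pow_const 2)
    (hfS.sq_le s b) (by simpa using hgS.sq_le 0 b) hK

namespace BilinearBound

variable {s b : ℝ} {K : ℝ≥0∞}

theorem mono (hB : BilinearBound τ d s b K) {b' : ℝ} (h : b ≤ b') : BilinearBound τ d s b' K :=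
  fun f g hf hg hfS hgS => (hB f g hf hg hfS hgS).trans (by
    gcongr
    · exact weightedSq_mono s h f
    · exact weightedSq_mono 0 h g)

theorem swap (hB : BilinearBound τ d s b K)
    {f g : FreqGroup τ d → ℝ≥0∞} (hf : Measurable f) (hg : Measurable g) (hfS : IsFiltered f)
    (hgS : IsFiltered g) :
    ∫⁻ z, (f ⋆ₗ[freqMeasure τ d] g) z ^ 2 ∂(freqMeasure τ d) ≤
      K * (weightedSq 0 b f * weightedSq s b g) := by
  rw [lconvolution_comm, mul_comm (weightedSq 0 b f)]
  exact hB g f hg hf hgS hfS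

end BilinearBound

theorem lconvolution_self_le (s : ℝ) {f : FreqGroup τ d → ℝ≥0∞} (hf : Measurable f)
    (z : FreqGroup τ d) :
    (f ⋆ₗ[freqMeasure τ d] f) z ≤ 2 * ((fun z => weight (-s) 0 z * f z) ⋆ₗ[freqMeasure τ d]
      fun z => weight s 0 z * f z) z := by
  have hm : ∀ s, Measurable (weight s 0 : FreqGroup τ d → ℝ≥0∞) := fun s => measurable_weight s 0
  set A : FreqGroup τ d → ℝ≥0∞ := fun z => weight (-s) 0 z * f z with hA
  set B : FreqGroup τ d → ℝ≥0∞ := fun z => weight s 0 z * f z with hB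
  have h_comm : 2 * (A ⋆ₗ[freqMeasure τ d] B) z =
      (A ⋆ₗ[freqMeasure τ d] B) z + (B ⋆ₗ[freqMeasure τ d] A) z := by
    rw [two_mul, lconvolution_comm (f := B)]
  rw [h_comm]
  simp only [lconvolution_def, hA, hB]
  rw [← lintegral_add_left (by fun_prop)]
  gcongr with y
  calc f y * f (-y + z)
      ≤ (weight (-s) 0 y * weight s 0 (-y + z) + weight s 0 y * weight (-s) 0 (-y + z)) *
          (f y * f (-y + z)) :=
        le_mul_of_one_le_left zero_le (one_le_weight_mul_add_weight_mul s y _)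
    _ = weight (-s) 0 y * f y * (weight s 0 (-y + z) * f (-y + z)) +
          weight s 0 y * f y * (weight (-s) 0 (-y + z) * f (-y + z)) := by ring

theorem lintegral_sq_lconvolution_self_le {s b : ℝ} {K : ℝ≥0∞} (hB : BilinearBound τ d s b K)
    {f : FreqGroup τ d → ℝ≥0∞} (hf : Measurable f) (hfS : IsFiltered f) :
    ∫⁻ z, (f ⋆ₗ[freqMeasure τ d] f) z ^ 2 ∂(freqMeasure τ d) ≤
      4 * K * weightedSq (s / 2) b f ^ 2 := by
  set A : FreqGroup τ d → ℝ≥0∞ := fun z => weight (-(s / 2)) 0 z * f z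
  set B : FreqGroup τ d → ℝ≥0∞ := fun z => weight (s / 2) 0 z * f z
  have hA : Measurable A := (measurable_weight _ _).mul hf
  have hB' : Measurable B := (measurable_weight _ _).mul hf
  have h_left : weightedSq s b A = weightedSq (s / 2) b f := by
    rw [weightedSq_weight_mul, add_zero, show s + -(s / 2) = s / 2 by ring]
  have h_right : weightedSq 0 b B = weightedSq (s / 2) b f := by
    rw [weightedSq_weight_mul, add_zero, zero_add]
  calc ∫⁻ z, (f ⋆ₗ[freqMeasure τ d] f) z ^ 2 ∂(freqMeasure τ d)
      ≤ ∫⁻ z, 2 ^ 2 * (A ⋆ₗ[freqMeasure τ d] B) z ^ 2 ∂(freqMeasure τ d) := by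
        simp only [← mul_pow]
        gcongr with z
        exact lconvolution_self_le (s / 2) hf z
    _ = 4 * ∫⁻ z, (A ⋆ₗ[freqMeasure τ d] B) z ^ 2 ∂(freqMeasure τ d) := by
        rw [lintegral_const_mul _ ((measurable_lconvolution _ hA hB').pow_const 2)]
        norm_num
    _ ≤ 4 * (K * (weightedSq s b A * weightedSq 0 b B)) := by
        gcongr
        exact hB A B hA hB' (hfS.mul_left _) (hfS.mul_left _)
    _ = 4 * K * weightedSq (s / 2) b f ^ 2 := by
        rw [h_left, h_right]
        ring

/-- The Fourier side `f₀ * f₂ * f̃₁`, with `f̃₁(z) = f₁(-z)`, of the cubic term. -/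
def triConv (f : Fin 3 → FreqGroup τ d → ℝ≥0∞) : FreqGroup τ d → ℝ≥0∞ :=
  (f 0 ⋆ₗ[freqMeasure τ d] f 2) ⋆ₗ[freqMeasure τ d] fun z => f 1 (-z)

variable {f : Fin 3 → FreqGroup τ d → ℝ≥0∞} {s b : ℝ} {K : ℝ≥0∞}

theorem measurable_triConv (hf : ∀ i, Measurable (f i)) : Measurable (triConv f) :=
  measurable_lconvolution _ (measurable_lconvolution _ (hf 0) (hf 2))
    ((hf 1).comp measurable_neg)

theorem sq_lintegral_mul_triConv_le_zero_two (hf : ∀ i, Measurable (f i)) {h : FreqGroup τ d → ℝ≥0∞}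
    (hh : Measurable h) :
    (∫⁻ z, h z * triConv f z ∂(freqMeasure τ d)) ^ 2 ≤
      (∫⁻ z, (f 0 ⋆ₗ[freqMeasure τ d] f 2) z ^ 2 ∂(freqMeasure τ d)) *
        ∫⁻ z, (h ⋆ₗ[freqMeasure τ d] f 1) z ^ 2 ∂(freqMeasure τ d) := by
  have h02 := measurable_lconvolution (freqMeasure τ d) (hf 0) (hf 2)
  rw [triConv, lintegral_mul_lconvolution_neg h02 (hf 1) hh]
  exact sq_lintegral_mul_le h02 (measurable_lconvolution _ hh (hf 1))

theorem sq_lintegral_mul_triConv_le_zero_one (hf : ∀ i, Measurable (f i)) {h : FreqGroup τ d → ℝ≥0∞}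
    (hh : Measurable h) :
    (∫⁻ z, h z * triConv f z ∂(freqMeasure τ d)) ^ 2 ≤
      (∫⁻ z, (f 0 ⋆ₗ[freqMeasure τ d] f 1) z ^ 2 ∂(freqMeasure τ d)) *
        ∫⁻ z, (h ⋆ₗ[freqMeasure τ d] f 2) z ^ 2 ∂(freqMeasure τ d) := by
  have h_neg : ∀ j, Measurable fun z => f j (-z) := fun j => (hf j).comp measurable_neg
  have h01 := measurable_lconvolution (freqMeasure τ d) (hf 0) (h_neg 1)
  have h_dual := lintegral_mul_lconvolution_neg (μ := freqMeasure τ d) h01 (h_neg 2) hh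
  simp only [neg_neg] at h_dual
  rw [triConv, lconvolution_right_comm (hf 0) (hf 2) (h_neg 1), h_dual,
    ← lintegral_sq_lconvolution_neg (hf 0) (hf 1), ← lintegral_sq_lconvolution_neg hh (hf 2)]
  exact sq_lintegral_mul_le h01 (measurable_lconvolution _ hh (h_neg 2))

theorem BilinearBound.sq_lintegral_mul_triConv_le (hB : BilinearBound τ d s b K)
    (hf : ∀ i, Measurable (f i)) (hfS : ∀ i, IsFiltered (f i))
    {h : FreqGroup τ d → ℝ≥0∞} (hh : Measurable h) (hhS : IsFiltered h) (i : Fin 3) :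
    (∫⁻ z, h z * triConv f z ∂(freqMeasure τ d)) ^ 2 ≤
      K ^ 2 * (∏ j, weightedSq (if j = i then 0 else s) b (f j)) * weightedSq 0 b h := by
  rw [Fin.prod_univ_three]
  fin_cases i
  · refine (sq_lintegral_mul_triConv_le_zero_two hf hh).trans
      ((mul_le_mul' (hB.swap (hf 0) (hf 2) (hfS 0) (hfS 2))
        (hB.swap hh (hf 1) hhS (hfS 1))).trans_eq ?_)
    simp only [Fin.isValue, Fin.zero_eta, ↓reduceIte, one_ne_zero, Fin.reduceEq]
    ring
  · refine (sq_lintegral_mul_triConv_le_zero_one hf hh).trans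
      ((mul_le_mul' (hB _ _ (hf 0) (hf 1) (hfS 0) (hfS 1))
        (hB.swap hh (hf 2) hhS (hfS 2))).trans_eq ?_)
    simp only [Fin.isValue, Fin.mk_one, zero_ne_one, ↓reduceIte, Fin.reduceEq]
    ring
  · refine (sq_lintegral_mul_triConv_le_zero_two hf hh).trans
      ((mul_le_mul' (hB _ _ (hf 0) (hf 2) (hfS 0) (hfS 2))
        (hB.swap hh (hf 1) hhS (hfS 1))).trans_eq ?_)
    simp only [Fin.isValue, Fin.reduceFinMk, Fin.reduceEq, ↓reduceIte]
    ring

theorem weightedSq_triConv_le (hB : BilinearBound τ d s b K)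
    (hf : ∀ i, Measurable (f i)) (hfS : ∀ i, IsFiltered (f i)) (i : Fin 3) :
    weightedSq 0 (-b) ((filterBand τ d).indicator (triConv f)) ≤
      K ^ 2 * ∏ j, weightedSq (if j = i then 0 else s) b (f j) := by
  refine lintegral_sq_le_of_forall_sq_lintegral_mul_le ((measurable_weight _ _).mul
    ((measurable_triConv hf).indicator measurableSet_filterBand)) fun h hh => ?_
  set H : FreqGroup τ d → ℝ≥0∞ := (filterBand τ d).indicator fun z => weight 0 (-b) z * h z
  have hH : Measurable H := ((measurable_weight _ _).mul hh).indicator measurableSet_filterBand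
  have h_pair : ∀ z, h z * (weight 0 (-b) z * (filterBand τ d).indicator (triConv f) z) =
      H z * triConv f z := fun z => by
    by_cases hz : z ∈ filterBand τ d
    · simp only [H, Set.indicator_of_mem hz]
      ring
    · simp [H, hz]
  have hH_norm : weightedSq 0 b H ≤ ∫⁻ z, h z ^ 2 ∂(freqMeasure τ d) := by
    unfold weightedSq
    gcongr with z
    by_cases hz : z ∈ filterBand τ d
    · have h_inv : weight 0 b z * weight 0 (-b) z = 1 := by
        simpa using weight_mul_weight_neg 0 b z
      simp only [H, Set.indicator_of_mem hz, ← mul_assoc, h_inv, one_mul, le_refl]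
    · simp [H, hz]
  simp only [Pi.mul_apply, h_pair]
  refine (hB.sq_lintegral_mul_triConv_le hf hfS hH (isFiltered_indicator _) i).trans ?_
  gcongr

theorem weight_mul_triConv_le (hs : 0 ≤ s) (hf : ∀ i, Measurable (f i)) (z : FreqGroup τ d) :
    weight s 0 z * triConv f z ≤
      ENNReal.ofReal (2 ^ s) ^ 2 * ∑ i, triConv (updateWeight s f i) z := by
  have hm := measurable_weight (τ := τ) (d := d) s 0
  have h_neg : Measurable fun z => f 1 (-z) := (hf 1).comp measurable_neg
  have h_outer := mul_lconvolution_le (μ := freqMeasure τ d) hm (weight_add_le hs)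
    (measurable_lconvolution (freqMeasure τ d) (hf 0) (hf 2)) h_neg z
  set c := ENNReal.ofReal ((2 : ℝ) ^ s)
  have hc : 1 ≤ c := ENNReal.one_le_ofReal.2 (Real.one_le_rpow one_le_two hs)
  have h_inner : ((fun x => weight s 0 x * (f 0 ⋆ₗ[freqMeasure τ d] f 2) x) ⋆ₗ[freqMeasure τ d]
      fun z => f 1 (-z)) z ≤
      c * (triConv (updateWeight s f 0) z + triConv (updateWeight s f 2) z) := by
    simp only [triConv, updateWeight, Function.update_self, ne_eq, Fin.reduceEq,
      not_false_eq_true, Function.update_of_ne]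
    refine (lconvolution_mono_left
      (mul_lconvolution_le hm (weight_add_le hs) (hf 0) (hf 2)) _ z).trans_eq ?_
    exact const_mul_add_lconvolution _ (measurable_lconvolution _ (hm.mul (hf 0)) (hf 2))
      (measurable_lconvolution _ (hf 0) (hm.mul (hf 2))) h_neg z
  have h_reflected : ((f 0 ⋆ₗ[freqMeasure τ d] f 2) ⋆ₗ[freqMeasure τ d]
      fun x => weight s 0 x * f 1 (-x)) z = triConv (updateWeight s f 1) z := by
    simp only [triConv, updateWeight, Function.update_self, ne_eq, Fin.reduceEq,
      not_false_eq_true, Function.update_of_ne, weight_neg]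
  rw [h_reflected] at h_outer
  rw [Fin.sum_univ_three]
  set t₀ := triConv (updateWeight s f 0) z
  set t₁ := triConv (updateWeight s f 1) z
  set t₂ := triConv (updateWeight s f 2) z
  calc weight s 0 z * triConv f z ≤ c * (c * (t₀ + t₂) + t₁) := h_outer.trans (by gcongr)
    _ ≤ c * (c * (t₀ + t₂) + c * t₁) := by
        gcongr
        exact le_mul_of_one_le_left zero_le hc
    _ = c ^ 2 * (t₀ + t₁ + t₂) := by ring

theorem weightedSq_updateWeight (s b : ℝ) (f : Fin 3 → FreqGroup τ d → ℝ≥0∞) (i j : Fin 3) :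
    weightedSq (if j = i then 0 else s) b (updateWeight s f i j) = weightedSq s b (f j) := by
  rcases eq_or_ne j i with rfl | h
  · rw [if_pos rfl, updateWeight, Function.update_self, weightedSq_weight_mul, zero_add, add_zero]
  · rw [if_neg h, updateWeight, Function.update_of_ne h]

theorem sq_sum_le_card_mul_sum_sq {ι : Type*} (t : Finset ι) (a : ι → ℝ≥0∞) :
    (∑ i ∈ t, a i) ^ 2 ≤ t.card * ∑ i ∈ t, a i ^ 2 := by
  have h := ENNReal.rpow_sum_le_const_mul_sum_rpow t a (p := 2) one_le_two
  norm_num at h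
  exact h

theorem sq_weight_mul_triConv_le (hs : 0 ≤ s) (hf : ∀ i, Measurable (f i)) (b : ℝ)
    (z : FreqGroup τ d) :
    (weight s b z * (filterBand τ d).indicator (triConv f) z) ^ 2 ≤
      3 * ENNReal.ofReal (2 ^ s) ^ 4 * ∑ i,
        (weight 0 b z * (filterBand τ d).indicator (triConv (updateWeight s f i)) z) ^ 2 := by
  by_cases hz : z ∈ filterBand τ d
  swap
  · simp [hz]
  simp only [Set.indicator_of_mem hz]
  set c := ENNReal.ofReal ((2 : ℝ) ^ s)
  have h_weight : weight s b z = weight 0 b z * weight s 0 z := by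
    rw [weight_mul_weight, zero_add, add_zero]
  calc (weight s b z * triConv f z) ^ 2
      ≤ (weight 0 b z * (c ^ 2 * ∑ i, triConv (updateWeight s f i) z)) ^ 2 := by
        rw [h_weight, mul_assoc]
        gcongr ?_ ^ 2
        exact mul_le_mul_right (weight_mul_triConv_le hs hf z) _
    _ = c ^ 4 * (∑ i, weight 0 b z * triConv (updateWeight s f i) z) ^ 2 := by
        rw [← Finset.mul_sum]
        ring
    _ ≤ c ^ 4 * (3 * ∑ i, (weight 0 b z * triConv (updateWeight s f i) z) ^ 2) := by
        gcongr
        exact sq_sum_le_card_mul_sum_sq Finset.univ _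
    _ = 3 * c ^ 4 * ∑ i, (weight 0 b z * triConv (updateWeight s f i) z) ^ 2 := by ring

theorem weightedSq_triConv_le_of_nonneg (hs : 0 ≤ s) (hB : BilinearBound τ d s b K)
    (hf : ∀ i, Measurable (f i)) (hfS : ∀ i, IsFiltered (f i)) :
    weightedSq s (-b) ((filterBand τ d).indicator (triConv f)) ≤
      9 * ENNReal.ofReal (2 ^ s) ^ 4 * K ^ 2 * ∏ j, weightedSq s b (f j) := by
  set c := ENNReal.ofReal ((2 : ℝ) ^ s)
  let Φ (i : Fin 3) (z : FreqGroup τ d) : ℝ≥0∞ :=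
    (weight 0 (-b) z * (filterBand τ d).indicator (triConv (updateWeight s f i)) z) ^ 2
  have hΦ : ∀ i, Measurable (Φ i) := fun i => ((measurable_weight _ _).mul ((measurable_triConv
    (measurable_updateWeight hf s i)).indicator measurableSet_filterBand)).pow_const 2
  have hΦ_le : ∀ i, ∫⁻ z, Φ i z ∂(freqMeasure τ d) ≤ K ^ 2 * ∏ j, weightedSq s b (f j) := by
    intro i
    refine (weightedSq_triConv_le hB (measurable_updateWeight hf s i)
      (isFiltered_updateWeight hfS s i) i).trans_eq ?_
    simp only [weightedSq_updateWeight]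
  calc weightedSq s (-b) ((filterBand τ d).indicator (triConv f))
      ≤ ∫⁻ z, 3 * c ^ 4 * ∑ i, Φ i z ∂(freqMeasure τ d) :=
        lintegral_mono (sq_weight_mul_triConv_le hs hf (-b))
    _ = 3 * c ^ 4 * ∑ i, ∫⁻ z, Φ i z ∂(freqMeasure τ d) := by
        rw [lintegral_const_mul _ (by fun_prop), lintegral_finsetSum _ fun i _ => hΦ i]
    _ ≤ 3 * c ^ 4 * ∑ _i : Fin 3, K ^ 2 * ∏ j, weightedSq s b (f j) := by
        gcongr with i
        exact hΦ_le i
    _ = 9 * c ^ 4 * K ^ 2 * ∏ j, weightedSq s b (f j) := by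
        rw [Fin.sum_univ_three]
        ring

end Weighted

/-! ### Trigonometric polynomials on the torus -/

theorem enorm_sq_eq_ofReal {E : Type*} [SeminormedAddCommGroup E] (x : E) :
    ‖x‖ₑ ^ 2 = ENNReal.ofReal (‖x‖ ^ 2) := by
  rw [ENNReal.ofReal_pow (norm_nonneg _), ofReal_norm]

theorem integral_fourier {T : ℝ} [hT : Fact (0 < T)] (n : ℤ) :
    ∫ x : AddCircle T, fourier n x = if n = 0 then (T : ℂ) else 0 := by
  have h_haar : T⁻¹ • ∫ x : AddCircle T, fourier n x = (Pi.single n 1 : ℤ → ℂ) 0 := by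
    rw [← AddCircle.integral_haarAddCircle, ← fourierCoeff_fourier (T := T), fourierCoeff]
    simp only [neg_zero, fourier_zero, one_smul]
  rw [inv_smul_eq_iff₀ hT.out.ne'] at h_haar
  rw [h_haar, Pi.single_apply]
  simp only [eq_comm (a := (0 : ℤ)), smul_ite, smul_zero, Complex.real_smul, mul_one]

section Torus

variable {d : ℕ}

theorem continuous_character (k : Fin d → ℤ) : Continuous (character k) := by
  unfold character
  fun_prop

theorem character_add (k l : Fin d → ℤ) (x : Torus d) :
    character (k + l) x = character k x * character l x := by
  simp only [character, Pi.add_apply, fourier_add, Finset.prod_mul_distrib]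

theorem character_neg (k : Fin d → ℤ) (x : Torus d) :
    character (-k) x = starRingEnd ℂ (character k x) := by
  simp only [character, Pi.neg_apply, fourier_neg, map_prod]

theorem norm_fourier_apply {T : ℝ} (n : ℤ) (x : AddCircle T) : ‖fourier n x‖ = 1 := by
  rw [fourier_apply, Circle.norm_coe]

theorem norm_character (k : Fin d → ℤ) (x : Torus d) : ‖character k x‖ = 1 := by
  rw [character, norm_prod]
  exact Finset.prod_eq_one fun j _ => norm_fourier_apply _ _

theorem integral_character (k : Fin d → ℤ) :
    ∫ x, character k x = if k = 0 then ((2 * Real.pi) ^ d : ℂ) else 0 := by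
  unfold character
  rw [integral_fintype_prod_volume_eq_prod fun j (y : AddCircle (2 * Real.pi)) => fourier (k j) y]
  simp only [integral_fourier]
  split_ifs with hk
  · simp [hk]
  · obtain ⟨j, hj⟩ := Function.ne_iff.1 hk
    exact Finset.prod_eq_zero (Finset.mem_univ j) (if_neg hj)

theorem integrable_of_continuous {X E : Type*} [TopologicalSpace X] [CompactSpace X]
    [MeasurableSpace X] [OpensMeasurableSpace X] [NormedAddCommGroup E]
    [SecondCountableTopologyEither X E] {μ : Measure X} [IsFiniteMeasureOnCompacts μ] {f : X → E}
    (hf : Continuous f) : Integrable f μ :=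
  hf.integrable_of_hasCompactSupport (HasCompactSupport.of_compactSpace f)

/-- The trigonometric polynomial with coefficients `c` and frequencies in `F`. -/
def trigPoly (F : Finset (Fin d → ℤ)) (c : (Fin d → ℤ) → ℂ) (x : Torus d) : ℂ :=
  ∑ k ∈ F, c k * character k x

variable (F : Finset (Fin d → ℤ)) (c : (Fin d → ℤ) → ℂ)

theorem continuous_trigPoly : Continuous (trigPoly F c) := by
  unfold trigPoly
  have := continuous_character (d := d)
  fun_prop

theorem integral_trigPoly_mul_character (l : Fin d → ℤ) :
    ∫ x, trigPoly F c x * character (-l) x = (2 * Real.pi) ^ d * if l ∈ F then c l else 0 := by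
  have h_expand (x : Torus d) :
      trigPoly F c x * character (-l) x = ∑ k ∈ F, c k * character (k + -l) x := by
    simp only [trigPoly, Finset.sum_mul, character_add, mul_assoc]
  simp only [h_expand]
  rw [integral_finsetSum _ fun k _ =>
    (integrable_of_continuous (continuous_character _)).const_mul _]
  simp only [integral_const_mul, integral_character, add_neg_eq_zero, mul_ite, mul_zero]
  rw [Finset.sum_ite_eq', mul_comm]

theorem two_pi_ne_zero : (2 * Real.pi : ℂ) ≠ 0 := by exact_mod_cast Real.two_pi_pos.ne'

theorem spaceCoeff_trigPoly (l : Fin d → ℤ) :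
    spaceCoeff (trigPoly F c) l = if l ∈ F then c l else 0 := by
  rw [spaceCoeff, integral_trigPoly_mul_character, one_div,
    inv_mul_cancel_left₀ (pow_ne_zero _ two_pi_ne_zero)]

theorem integral_norm_sq_trigPoly :
    ∫ x, ‖trigPoly F c x‖ ^ 2 = (2 * Real.pi) ^ d * ∑ k ∈ F, ‖c k‖ ^ 2 := by
  have h_expand (x : Torus d) : ((‖trigPoly F c x‖ ^ 2 : ℝ) : ℂ) =
      ∑ k ∈ F, starRingEnd ℂ (c k) * (trigPoly F c x * character (-k) x) := by
    push_cast
    rw [← Complex.mul_conj']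
    nth_rewrite 2 [trigPoly]
    simp only [map_sum, Finset.mul_sum, map_mul, character_neg]
    exact Finset.sum_congr rfl fun k _ => mul_left_comm _ _ _
  have h_int (k : Fin d → ℤ) : Integrable fun x => trigPoly F c x * character (-k) x :=
    integrable_of_continuous ((continuous_trigPoly F c).mul (continuous_character _))
  rw [← Complex.ofReal_inj, ← integral_complex_ofReal]
  simp only [h_expand]
  rw [integral_finsetSum _ fun k _ => (h_int k).const_mul _]
  simp only [integral_const_mul, integral_trigPoly_mul_character]
  push_cast
  rw [Finset.mul_sum]
  refine Finset.sum_congr rfl fun k hk => ?_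
  rw [if_pos hk, mul_left_comm, Complex.conj_mul']

theorem lintegral_enorm_sq_trigPoly :
    ∫⁻ x, ‖trigPoly F c x‖ₑ ^ 2 = ENNReal.ofReal ((2 * Real.pi) ^ d) * ∑ k ∈ F, ‖c k‖ₑ ^ 2 := by
  simp only [enorm_sq_eq_ofReal]
  rw [← ofReal_integral_eq_lintegral_ofReal
      (integrable_of_continuous (f := fun x => ‖trigPoly F c x‖ ^ 2)
        ((continuous_trigPoly F c).norm.pow 2))
      (Filter.Eventually.of_forall fun x => by positivity),
    integral_norm_sq_trigPoly, ENNReal.ofReal_mul (by positivity),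
    ENNReal.ofReal_sum_of_nonneg fun k _ => by positivity]

theorem spaceCoeff_filterOp (τ : ℝ) (f : Torus d → ℂ) (k : Fin d → ℤ) :
    spaceCoeff (filterOp τ f) k = if k ∈ filterSet d τ then spaceCoeff f k else 0 :=
  spaceCoeff_trigPoly (filterSet d τ) (spaceCoeff f) k

theorem spaceCoeff_conj (f : Torus d → ℂ) (k : Fin d → ℤ) :
    spaceCoeff (fun y => starRingEnd ℂ (f y)) k = starRingEnd ℂ (spaceCoeff f (-k)) := by
  simp only [spaceCoeff, map_mul, ← integral_conj, ← character_neg, neg_neg, map_div₀, map_one,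
    map_pow, Complex.conj_ofReal, map_ofNat]

theorem neg_mem_filterSet {τ : ℝ} {k : Fin d → ℤ} : -k ∈ filterSet d τ ↔ k ∈ filterSet d τ := by
  simp [mem_filterSet]

theorem filterOp_conj (τ : ℝ) (f : Torus d → ℂ) (x : Torus d) :
    filterOp τ (fun y => starRingEnd ℂ (f y)) x = starRingEnd ℂ (filterOp τ f x) := by
  simp only [filterOp, map_sum, map_mul, spaceCoeff_conj, ← character_neg]
  exact Finset.sum_equiv (Equiv.neg _) (fun k => neg_mem_filterSet.symm) fun k _ => by simp

end Torus

/-! ### The time transform on the circle -/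

section Time

theorem timeFreqMeasure_eq (τ : ℝ) :
    timeFreqMeasure τ = volume.restrict
      (Set.Ioc (-(Real.pi / τ)) (-(Real.pi / τ) + 2 * Real.pi / τ)) := by
  rw [timeFreqMeasure]
  congr 2
  ring

theorem hasSum_sq_norm_fourierCoeff {T : ℝ} [hT : Fact (0 < T)] {A : AddCircle T → ℂ}
    (hA : MemLp A 2) : HasSum (fun n => ‖fourierCoeff A n‖ ^ 2) (T⁻¹ * ∫ x, ‖A x‖ ^ 2) := by
  have hA' := memLp_haarAddCircle_iff.2 hA
  have h_parseval := hasSum_sq_fourierCoeff (hA'.toLp A)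
  rw [fourierCoeff_congr_ae hA'.coeFn_toLp] at h_parseval
  have h_int : ∫ x, ‖hA'.toLp A x‖ ^ 2 ∂AddCircle.haarAddCircle =
      ∫ x, ‖A x‖ ^ 2 ∂AddCircle.haarAddCircle := by
    refine integral_congr_ae ?_
    filter_upwards [hA'.coeFn_toLp] with x hx
    rw [hx]
  rwa [h_int, AddCircle.integral_haarAddCircle, smul_eq_mul] at h_parseval

theorem tsum_enorm_sq_fourierCoeff {T : ℝ} [hT : Fact (0 < T)] {A : AddCircle T → ℂ}
    (hA : MemLp A 2) :
    ∑' n, ‖fourierCoeff A n‖ₑ ^ 2 = ENNReal.ofReal T⁻¹ * ∫⁻ x, ‖A x‖ₑ ^ 2 := by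
  have h_sum := hasSum_sq_norm_fourierCoeff hA
  simp only [enorm_sq_eq_ofReal]
  rw [← ENNReal.ofReal_tsum_of_nonneg (fun n => by positivity) h_sum.summable, h_sum.tsum_eq,
    ENNReal.ofReal_mul (inv_nonneg.2 hT.out.le), ofReal_integral_eq_lintegral_ofReal
      (hA.integrable_norm_pow two_ne_zero) (Filter.Eventually.of_forall fun x => by positivity)]

theorem ae_eq_of_fourierCoeff_eq {T : ℝ} [hT : Fact (0 < T)] {A B : AddCircle T → ℂ}
    (hA : MemLp A 2) (hB : MemLp B 2) (h : fourierCoeff A = fourierCoeff B) :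
    A =ᵐ[volume] B := by
  have hA' := memLp_haarAddCircle_iff.2 hA
  have hB' := memLp_haarAddCircle_iff.2 hB
  have h_toLp : hA'.toLp A = hB'.toLp B := by
    apply fourierBasis.repr.injective
    ext n
    rw [fourierBasis_repr, fourierBasis_repr, fourierCoeff_congr_ae hA'.coeFn_toLp,
      fourierCoeff_congr_ae hB'.coeFn_toLp, h]
  rw [AddCircle.volume_eq_smul_haarAddCircle]
  exact Measure.smul_absolutelyContinuous.ae_eq ((MemLp.toLp_eq_toLp_iff hA' hB').1 h_toLp)

theorem memLp_two_of_lintegral_ne_top {α E : Type*} [MeasurableSpace α] [NormedAddCommGroup E]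
    {μ : Measure α} {A : α → E} (hA : AEStronglyMeasurable A μ) (h : ∫⁻ x, ‖A x‖ₑ ^ 2 ∂μ ≠ ∞) :
    MemLp A 2 μ := by
  refine ⟨hA, ?_⟩
  rw [eLpNorm_lt_top_iff_lintegral_rpow_enorm_lt_top (by norm_num) (by norm_num)]
  simpa using h.lt_top

variable {τ : ℝ} [hτ : Fact (0 < τ)]

theorem integral_timeFreqMeasure (f : TimeCircle τ → ℂ) :
    ∫ σ, f (σ : TimeCircle τ) ∂(timeFreqMeasure τ) = ∫ x, f x := by
  rw [timeFreqMeasure_eq, AddCircle.integral_preimage]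

theorem lintegral_timeFreqMeasure (f : TimeCircle τ → ℝ≥0∞) :
    ∫⁻ σ, f (σ : TimeCircle τ) ∂(timeFreqMeasure τ) = ∫⁻ x, f x := by
  rw [timeFreqMeasure_eq, AddCircle.lintegral_preimage]

theorem fourierCoeff_timeCircle (A : TimeCircle τ → ℂ) (n : ℤ) :
    fourierCoeff A n = τ * ((2 * Real.pi : ℂ)⁻¹ * ∫ x, fourier (-n) x * A x) := by
  rw [fourierCoeff, AddCircle.integral_haarAddCircle, Complex.real_smul, inv_div, div_eq_mul_inv,
    ← mul_assoc]
  push_cast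
  rfl

/-- The element `e^{imτσ}` of `L²(dσ)`. -/
def modeLp (τ : ℝ) (m : ℤ) : Lp ℂ 2 (timeFreqMeasure τ) := (memLp_timeMode τ m).toLp (timeMode τ m)

theorem inner_modeLp (m : ℤ) (g : Lp ℂ 2 (timeFreqMeasure τ)) :
    inner ℂ (modeLp τ m) g = ∫ σ, fourier (-m) (σ : TimeCircle τ) * g σ ∂(timeFreqMeasure τ) := by
  rw [L2.inner_def]
  refine integral_congr_ae ?_
  filter_upwards [(memLp_timeMode τ m).coeFn_toLp] with σ hσ
  rw [RCLike.inner_apply', modeLp, hσ, ← fourier_timeCircle_coe hτ.out, fourier_neg]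

theorem inner_modeLp_modeLp (m n : ℤ) :
    inner ℂ (modeLp τ m) (modeLp τ n) = if m = n then (2 * Real.pi / τ : ℂ) else 0 := by
  have h_mul : ∫ σ, fourier (-m) (σ : TimeCircle τ) * modeLp τ n σ ∂(timeFreqMeasure τ) =
      ∫ σ, fourier (-m + n) (σ : TimeCircle τ) ∂(timeFreqMeasure τ) := by
    refine integral_congr_ae ?_
    filter_upwards [(memLp_timeMode τ n).coeFn_toLp] with σ hσ
    rw [modeLp, hσ, ← fourier_timeCircle_coe hτ.out, fourier_add]
  rw [inner_modeLp, h_mul, integral_timeFreqMeasure fun x => fourier (-m + n) x, integral_fourier]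
  simp only [neg_add_eq_zero]
  push_cast
  rfl

theorem summable_smul_modeLp {c : ℤ → ℂ} (hc : Summable fun m => ‖c m‖ ^ 2) :
    Summable fun m => c m • modeLp τ m := by
  set r : ℝ := √(2 * Real.pi / τ)
  have hr : (r : ℂ) * r = 2 * Real.pi / τ := by
    exact_mod_cast Real.mul_self_sqrt (div_pos Real.two_pi_pos hτ.out).le
  have hr0 : (r : ℂ) ≠ 0 := by
    exact_mod_cast (Real.sqrt_pos.2 (div_pos Real.two_pi_pos hτ.out)).ne'
  have h_orth : Orthonormal ℂ fun m => (r⁻¹ : ℂ) • modeLp τ m := by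
    rw [orthonormal_iff_ite]
    intro m n
    rw [inner_smul_left, inner_smul_right, inner_modeLp_modeLp, ← hr]
    split_ifs
    · simp [hr0]
    · simp
  refine ((h_orth.orthogonalFamily.summable_iff_norm_sq_summable fun m => c m * r).2 ?_).congr
    fun m => ?_
  · simp only [norm_mul, mul_pow]
    exact hc.mul_right _
  · rw [LinearIsometry.toSpanSingleton_apply, smul_smul, mul_assoc, mul_inv_cancel₀ hr0, mul_one]

/-- The lift to the circle of a function over one period. -/
def circleLift (g : ℝ → ℂ) : TimeCircle τ → ℂ :=
  AddCircle.liftIoc (2 * Real.pi / τ) (-(Real.pi / τ)) g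

theorem circleLift_coe (g : ℝ → ℂ) :
    ∀ᵐ σ : ℝ ∂(timeFreqMeasure τ), circleLift g (σ : TimeCircle τ) = g σ := by
  rw [timeFreqMeasure_eq]
  filter_upwards [ae_restrict_mem measurableSet_Ioc] with σ hσ
  exact AddCircle.liftIoc_coe_apply hσ

theorem measurable_circleLift {g : ℝ → ℂ} (hg : Measurable g) :
    Measurable (circleLift g : TimeCircle τ → ℂ) :=
  (hg.comp measurable_subtype_coe).comp
    (AddCircle.measurableEquivIoc (2 * Real.pi / τ) (-(Real.pi / τ))).measurable

theorem memLp_circleLift {g : ℝ → ℂ} (hg : MemLp g 2 (timeFreqMeasure τ)) :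
    MemLp (circleLift g : TimeCircle τ → ℂ) 2 := by
  rw [timeFreqMeasure_eq] at hg
  exact hg.memLp_liftIoc

theorem fourierCoeff_circleLift (g : Lp ℂ 2 (timeFreqMeasure τ)) (n : ℤ) :
    fourierCoeff (circleLift g : TimeCircle τ → ℂ) n =
      τ * ((2 * Real.pi : ℂ)⁻¹ * inner ℂ (modeLp τ n) g) := by
  rw [fourierCoeff_timeCircle, inner_modeLp, ← integral_timeFreqMeasure]
  congr 2
  refine integral_congr_ae ?_
  filter_upwards [circleLift_coe g] with σ hσ
  rw [hσ]

variable {d : ℕ} {u : ℤ → Torus d → ℂ} {k : Fin d → ℤ}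

theorem fourierCoeff_circleLift_transform (h : Summable (transformTerm τ u k)) (n : ℤ) :
    fourierCoeff (circleLift (transform τ u k) : TimeCircle τ → ℂ) n =
      τ * spaceCoeff (u n) k := by
  have hτ0 : (τ : ℂ) ≠ 0 := by exact_mod_cast hτ.out.ne'
  have h_term (m : ℤ) : innerSL ℂ (modeLp τ n) (transformTerm τ u k m) =
      if m = n then (2 * Real.pi * spaceCoeff (u n) k : ℂ) else 0 := by
    rw [innerSL_apply_apply, transformTerm, inner_smul_right]
    change _ * inner ℂ (modeLp τ n) (modeLp τ m) = _
    rw [inner_modeLp_modeLp]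
    rcases eq_or_ne m n with rfl | hmn
    · simp only [if_true]
      field_simp
    · rw [if_neg hmn.symm, if_neg hmn, mul_zero]
  have h_inner := h.hasSum.mapL (innerSL ℂ (modeLp τ n))
  simp only [h_term] at h_inner
  rw [fourierCoeff_circleLift, ← innerSL_apply_apply (𝕜 := ℂ), transform,
    h_inner.unique (hasSum_ite_eq n _), inv_mul_cancel_left₀ two_pi_ne_zero]

theorem summable_transformTerm {A : TimeCircle τ → ℂ} (hA : MemLp A 2)
    (h : ∀ n, fourierCoeff A n = τ * spaceCoeff (u n) k) : Summable (transformTerm τ u k) := by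
  refine summable_smul_modeLp ?_
  simp only [← h]
  exact (hasSum_sq_norm_fourierCoeff hA).summable

theorem circleLift_transform_ae_eq {A : TimeCircle τ → ℂ} (hA : MemLp A 2)
    (h : ∀ n, fourierCoeff A n = τ * spaceCoeff (u n) k) :
    circleLift (transform τ u k) =ᵐ[volume] A :=
  ae_eq_of_fourierCoeff_eq (memLp_circleLift (Lp.memLp _)) hA <| funext fun n => by
    rw [fourierCoeff_circleLift_transform (summable_transformTerm hA h), h]

end Time

/-! ### The Fourier transform on the group of frequencies -/

section InvTransform

variable {τ : ℝ} {d : ℕ}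

/-- The character `(σ, k) ↦ e^{-inτσ} e^{i⟨k,x⟩}` of the group of frequencies. -/
def freqChar (n : ℤ) (x : Torus d) (z : FreqGroup τ d) : ℂ := fourier (-n) z.1 * character z.2 x

theorem freqChar_add (n : ℤ) (x : Torus d) (z w : FreqGroup τ d) :
    freqChar n x (z + w) = freqChar n x z * freqChar n x w := by
  simp only [freqChar, Prod.fst_add, Prod.snd_add, character_add, fourier_apply, smul_add,
    AddCircle.toCircle_add, Circle.coe_mul]
  exact mul_mul_mul_comm _ _ _ _

theorem freqChar_neg (n : ℤ) (x : Torus d) (z : FreqGroup τ d) :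
    freqChar n x (-z) = starRingEnd ℂ (freqChar n x z) := by
  simp only [freqChar, Prod.fst_neg, Prod.snd_neg, character_neg, map_mul, ← fourier_neg]
  simp only [fourier_apply, neg_neg, smul_neg, neg_smul]

theorem norm_freqChar (n : ℤ) (x : Torus d) (z : FreqGroup τ d) : ‖freqChar n x z‖ = 1 := by
  rw [freqChar, norm_mul, norm_character, norm_fourier_apply, mul_one]

theorem measurable_freqChar (n : ℤ) (x : Torus d) :
    Measurable (freqChar n x : FreqGroup τ d → ℂ) := by
  refine measurable_from_prod_countable_left fun k => ?_
  simp only [freqChar]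
  fun_prop

/-- The function `A` of the frequencies vanishes unless the space frequency lies in `F`. -/
def BandLimited (F : Finset (Fin d → ℤ)) (A : FreqGroup τ d → ℂ) : Prop := ∀ z, z.2 ∉ F → A z = 0

/-- The function `z ↦ conj (A (-z))`: the transform of the conjugate of a function with
transform `A`. -/
def reflect (A : FreqGroup τ d → ℂ) (z : FreqGroup τ d) : ℂ := starRingEnd ℂ (A (-z))

theorem measurable_reflect {A : FreqGroup τ d → ℂ} (hA : Measurable A) : Measurable (reflect A) :=
  Complex.continuous_conj.measurable.comp (hA.comp measurable_neg)

theorem BandLimited.reflect {F : Finset (Fin d → ℤ)} {A : FreqGroup τ d → ℂ}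
    (hA : BandLimited F A) : BandLimited (F.image (- ·)) (reflect A) := by
  intro z hz
  rw [DiscBourgain.reflect, hA (-z), map_zero]
  exact fun h => hz (Finset.mem_image.2 ⟨-z.2, h, neg_neg _⟩)

variable [Fact (0 < τ)] {A B : FreqGroup τ d → ℂ} {F : Finset (Fin d → ℤ)}

theorem integrable_reflect (hA : Integrable A (freqMeasure τ d)) :
    Integrable (reflect A) (freqMeasure τ d) :=
  (LinearIsometryEquiv.integrable_comp_iff Complex.conjLIE).2
    (Integrable.comp_neg (μ := freqMeasure τ d) hA)

/-- The transform `(2π)⁻¹ ∑_k ∫ e^{-inτσ} e^{i⟨k,x⟩} A(σ,k) dσ`, which recovers a sequence of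
functions on the torus from its time-space Fourier transform. -/
def invTransform (A : FreqGroup τ d → ℂ) (n : ℤ) (x : Torus d) : ℂ :=
  (2 * Real.pi : ℂ)⁻¹ * ∫ z, freqChar n x z * A z ∂(freqMeasure τ d)

/-- Convolution on the group of frequencies, normalized so that `invTransform` takes it to the
pointwise product. -/
def conv (A B : FreqGroup τ d → ℂ) (z : FreqGroup τ d) : ℂ :=
  (2 * Real.pi : ℂ)⁻¹ * convolution A B (ContinuousLinearMap.mul ℂ ℂ) (freqMeasure τ d) z

theorem integrable_freqChar_mul (hA : Integrable A (freqMeasure τ d)) (n : ℤ) (x : Torus d) :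
    Integrable (fun z => freqChar n x z * A z) (freqMeasure τ d) :=
  hA.bdd_mul (c := 1) (measurable_freqChar n x).aestronglyMeasurable
    (Filter.Eventually.of_forall fun z => (norm_freqChar n x z).le)

theorem integrable_conv (hA : Integrable A (freqMeasure τ d))
    (hB : Integrable B (freqMeasure τ d)) : Integrable (conv A B) (freqMeasure τ d) :=
  (hA.integrable_convolution _ hB).const_mul _

theorem measurable_conv (hA : Measurable A) (hB : Measurable B) : Measurable (conv A B) := by
  have h_meas : Measurable fun p : FreqGroup τ d × FreqGroup τ d => A p.2 * B (p.1 - p.2) := by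
    fun_prop
  exact (h_meas.stronglyMeasurable.integral_prod_right' (ν := freqMeasure τ d)).measurable.const_mul
    _

theorem BandLimited.conv {F' : Finset (Fin d → ℤ)} (hA : BandLimited F A)
    (hB : BandLimited F' B) : BandLimited (Finset.image₂ (· + ·) F F') (conv A B) := by
  intro z hz
  have h_zero (y : FreqGroup τ d) : A y * B (z - y) = 0 := by
    by_cases hy : y.2 ∈ F
    · rw [hB (z - y) fun hzy => hz (Finset.mem_image₂.2 ⟨_, hy, _, hzy, add_sub_cancel _ _⟩),
        mul_zero]
    · rw [hA _ hy, zero_mul]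
  simp only [DiscBourgain.conv, convolution_def, ContinuousLinearMap.mul_apply', h_zero,
    integral_zero, mul_zero]

theorem enorm_conv_le (A B : FreqGroup τ d → ℂ) (z : FreqGroup τ d) :
    ‖conv A B z‖ₑ ≤ ((fun z => ‖A z‖ₑ) ⋆ₗ[freqMeasure τ d] fun z => ‖B z‖ₑ) z := by
  have h_const : ‖(2 * Real.pi : ℂ)⁻¹‖ₑ ≤ 1 := by
    rw [← ofReal_norm, ENNReal.ofReal_le_one, norm_inv, norm_mul,
      Complex.norm_of_nonneg Real.pi_pos.le, Complex.norm_two]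
    exact inv_le_one_of_one_le₀ (by linarith [Real.pi_gt_three])
  calc ‖conv A B z‖ₑ
      ≤ ‖∫ y, A y * B (z - y) ∂(freqMeasure τ d)‖ₑ := by
        rw [conv, enorm_mul]
        exact mul_le_of_le_one_left zero_le h_const
    _ ≤ ∫⁻ y, ‖A y * B (z - y)‖ₑ ∂(freqMeasure τ d) := enorm_integral_le_lintegral_enorm _
    _ = ((fun z => ‖A z‖ₑ) ⋆ₗ[freqMeasure τ d] fun z => ‖B z‖ₑ) z := by
        simp only [lconvolution_def, enorm_mul, neg_add_eq_sub]

theorem freqChar_mul_convolution (A B : FreqGroup τ d → ℂ) (n : ℤ) (x : Torus d)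
    (z : FreqGroup τ d) :
    freqChar n x z * convolution A B (ContinuousLinearMap.mul ℂ ℂ) (freqMeasure τ d) z =
      convolution (fun y => freqChar n x y * A y) (fun y => freqChar n x y * B y)
        (ContinuousLinearMap.mul ℂ ℂ) (freqMeasure τ d) z := by
  simp only [convolution_def, ContinuousLinearMap.mul_apply', ← integral_const_mul]
  congr with y
  rw [mul_mul_mul_comm, ← freqChar_add, add_sub_cancel]

theorem invTransform_conv (hA : Integrable A (freqMeasure τ d))
    (hB : Integrable B (freqMeasure τ d)) (n : ℤ) (x : Torus d) :
    invTransform (conv A B) n x = invTransform A n x * invTransform B n x := by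
  have h_mul := integral_convolution (ContinuousLinearMap.mul ℂ ℂ)
    (integrable_freqChar_mul hA n x) (integrable_freqChar_mul hB n x)
  rw [ContinuousLinearMap.mul_apply'] at h_mul
  simp only [invTransform, conv, mul_left_comm (freqChar n x _), integral_const_mul,
    freqChar_mul_convolution, h_mul]
  ring

theorem invTransform_reflect (A : FreqGroup τ d → ℂ) (n : ℤ) (x : Torus d) :
    invTransform (reflect A) n x = starRingEnd ℂ (invTransform A n x) := by
  simp only [invTransform, map_mul, map_inv₀, Complex.conj_ofReal, map_ofNat, ← integral_conj]
  rw [← integral_neg_eq_self]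
  simp only [reflect, neg_neg, freqChar_neg]

theorem BandLimited.lintegral_enorm_sq (hF : BandLimited F A) (hA : Measurable A) :
    ∫⁻ z, ‖A z‖ₑ ^ 2 ∂(freqMeasure τ d) = ∑ k ∈ F, ∫⁻ x, ‖A (x, k)‖ₑ ^ 2 := by
  rw [lintegral_freqMeasure (hA.enorm.pow_const 2), tsum_eq_sum]
  intro k hk
  have h_zero (x : TimeCircle τ) : A (x, k) = 0 := hF _ hk
  simp [h_zero]

theorem BandLimited.integrable (hF : BandLimited F A) (hA : Measurable A)
    (h : ∀ k ∈ F, Integrable fun x => A (x, k)) : Integrable A (freqMeasure τ d) := by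
  refine ⟨hA.aestronglyMeasurable, ?_⟩
  rw [HasFiniteIntegral, lintegral_freqMeasure hA.enorm, tsum_eq_sum (s := F)]
  · exact ENNReal.sum_lt_top.2 fun k hk => (h k hk).2
  · intro k hk
    have h_zero (x : TimeCircle τ) : A (x, k) = 0 := hF _ hk
    simp [h_zero]

theorem BandLimited.invTransform_eq (hF : BandLimited F A) (hA : Integrable A (freqMeasure τ d))
    (n : ℤ) :
    invTransform A n = trigPoly F fun k => (τ : ℂ)⁻¹ * fourierCoeff (fun σ => A (σ, k)) n := by
  ext x
  have hτ : (τ : ℂ) ≠ 0 := by exact_mod_cast (Fact.out : 0 < τ).ne'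
  have h_int := integrable_freqChar_mul hA n x
  have h_zero : ∀ k ∉ (F : Set (Fin d → ℤ)),
      ∫ σ : TimeCircle τ, freqChar n x (σ, k) * A (σ, k) = 0 := by
    intro k hk
    have h_fibre (σ : TimeCircle τ) : A (σ, k) = 0 := hF _ hk
    simp only [h_fibre, mul_zero, integral_zero]
  rw [freqMeasure] at h_int
  rw [invTransform, freqMeasure, integral_prod_symm _ h_int,
    ← setIntegral_eq_integral_of_forall_compl_eq_zero h_zero,
    setIntegral_finset _ h_int.integral_prod_right.integrableOn, trigPoly, Finset.mul_sum]
  refine Finset.sum_congr rfl fun k _ => ?_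
  rw [Measure.real, Measure.count_singleton, ENNReal.toReal_one, one_smul, fourierCoeff_timeCircle,
    inv_mul_cancel_left₀ hτ, mul_assoc, ← integral_mul_const]
  simp only [freqChar, mul_right_comm]

theorem BandLimited.fourierCoeff_eq (hF : BandLimited F A) (hA : Integrable A (freqMeasure τ d))
    (n : ℤ) (k : Fin d → ℤ) :
    fourierCoeff (fun σ => A (σ, k)) n = τ * spaceCoeff (invTransform A n) k := by
  have hτ : (τ : ℂ) ≠ 0 := by exact_mod_cast (Fact.out : 0 < τ).ne'
  rw [hF.invTransform_eq hA, spaceCoeff_trigPoly]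
  split_ifs with hk
  · rw [mul_inv_cancel_left₀ hτ]
  · have h_zero (σ : TimeCircle τ) : A (σ, k) = 0 := hF _ hk
    simp [fourierCoeff, h_zero]

theorem tsum_lintegral_enorm_sq_invTransform (hF : BandLimited F A) (hA : Measurable A)
    (hA' : Integrable A (freqMeasure τ d)) (h : ∫⁻ z, ‖A z‖ₑ ^ 2 ∂(freqMeasure τ d) ≠ ∞) :
    ∑' n, ∫⁻ x, ‖invTransform A n x‖ₑ ^ 2 =
      ENNReal.ofReal ((2 * Real.pi) ^ d) * (ENNReal.ofReal (2 * Real.pi * τ)⁻¹ *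
        ∫⁻ z, ‖A z‖ₑ ^ 2 ∂(freqMeasure τ d)) := by
  have hτ : 0 < τ := Fact.out
  have h_fibre : ∀ k ∈ F, MemLp (fun σ => A (σ, k)) 2 := fun k hk =>
    memLp_two_of_lintegral_ne_top (hA.comp measurable_prodMk_right).aestronglyMeasurable
      (ENNReal.sum_ne_top.1 (hF.lintegral_enorm_sq hA ▸ h) k hk)
  have h_const : ‖(τ : ℂ)⁻¹‖ₑ ^ 2 * ENNReal.ofReal (2 * Real.pi / τ)⁻¹ =
      ENNReal.ofReal (2 * Real.pi * τ)⁻¹ := by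
    rw [enorm_sq_eq_ofReal, ← ENNReal.ofReal_mul (by positivity), norm_inv,
      Complex.norm_of_nonneg hτ.le]
    congr 1
    field_simp
  simp only [hF.invTransform_eq hA', lintegral_enorm_sq_trigPoly, enorm_mul, mul_pow]
  rw [ENNReal.tsum_mul_left, Summable.tsum_finsetSum fun _ _ => ENNReal.summable,
    hF.lintegral_enorm_sq hA, Finset.mul_sum (s := F) (a := ENNReal.ofReal (2 * Real.pi * τ)⁻¹)]
  congr 1
  refine Finset.sum_congr rfl fun k hk => ?_
  rw [ENNReal.tsum_mul_left, tsum_enorm_sq_fourierCoeff (h_fibre k hk), ← mul_assoc, h_const]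

end InvTransform

section FreqLift

theorem MemBourgain.summable {τ s b : ℝ} {d : ℕ} {u : ℤ → Torus d → ℂ}
    (hu : MemBourgain τ s b u) : ∀ k, Summable (transformTerm τ u k) := by
  by_contra h
  exact hu.2.ne (if_neg h)

variable {τ : ℝ} {d : ℕ} [hτ : Fact (0 < τ)]

/-- The time-space Fourier transform of `Π_τ u`, as a function on the group of frequencies. -/
def freqLift (u : ℤ → Torus d → ℂ) : FreqGroup τ d → ℂ :=
  (filterBand τ d).indicator fun z => circleLift (transform τ u z.2) z.1

theorem measurable_freqLift (u : ℤ → Torus d → ℂ) :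
    Measurable (freqLift u : FreqGroup τ d → ℂ) :=
  (measurable_from_prod_countable_left fun k =>
    measurable_circleLift (Lp.stronglyMeasurable (transform τ u k)).measurable).indicator
    measurableSet_filterBand

theorem bandLimited_freqLift (u : ℤ → Torus d → ℂ) :
    BandLimited (filterSet d τ) (freqLift u : FreqGroup τ d → ℂ) :=
  fun z hz => Set.indicator_of_notMem (s := filterBand τ d) (a := z) hz _

theorem isFiltered_freqLift (u : ℤ → Torus d → ℂ) :
    IsFiltered fun z : FreqGroup τ d => ‖freqLift u z‖ₑ := fun z hz => by
  simp only [bandLimited_freqLift u z hz, enorm_zero]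

theorem freqLift_apply (u : ℤ → Torus d → ℂ) {k : Fin d → ℤ} (hk : k ∈ filterSet d τ)
    (x : TimeCircle τ) : freqLift u (x, k) = circleLift (transform τ u k) x :=
  Set.indicator_of_mem (s := filterBand τ d) (a := (x, k)) hk _

theorem integrable_freqLift (u : ℤ → Torus d → ℂ) :
    Integrable (freqLift u : FreqGroup τ d → ℂ) (freqMeasure τ d) := by
  refine (bandLimited_freqLift u).integrable (measurable_freqLift u) fun k hk => ?_
  simp only [freqLift_apply u hk]
  exact (memLp_circleLift (Lp.memLp _)).integrable one_le_two

theorem invTransform_freqLift {u : ℤ → Torus d → ℂ} (hu : ∀ k, Summable (transformTerm τ u k))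
    (n : ℤ) : invTransform (freqLift u : FreqGroup τ d → ℂ) n = filterOp τ (u n) := by
  have hτ0 : (τ : ℂ) ≠ 0 := by exact_mod_cast hτ.out.ne'
  rw [(bandLimited_freqLift u).invTransform_eq (integrable_freqLift u)]
  ext x
  refine Finset.sum_congr rfl fun k hk => ?_
  simp only [freqLift_apply u hk]
  rw [fourierCoeff_circleLift_transform (hu k), inv_mul_cancel_left₀ hτ0]

theorem lintegral_transform_eq (s b : ℝ) (u : ℤ → Torus d → ℂ) (k : Fin d → ℤ) :
    ∫⁻ σ, ENNReal.ofReal (bracket (freqVec k) ^ s *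
      bracket (dTau τ (σ - ‖freqVec k‖ ^ 2)) ^ b * ‖transform τ u k σ‖) ^ 2 ∂(timeFreqMeasure τ) =
    ∫⁻ x : TimeCircle τ, (weight s b (x, k) * ‖circleLift (transform τ u k) x‖ₑ) ^ 2 := by
  rw [← lintegral_timeFreqMeasure]
  refine lintegral_congr_ae ?_
  filter_upwards [circleLift_coe (τ := τ) (transform τ u k)] with σ hσ
  have hk := bracket_pos (freqVec k)
  have h_mod := bracket_pos (dTau τ (σ - ‖freqVec k‖ ^ 2))
  rw [hσ, weight, modWeight, ← AddCircle.coe_sub, dCircle_coe hτ.out,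
    ENNReal.ofReal_mul (by positivity), ofReal_norm]

theorem bourgainNorm_sq_eq_tsum {u : ℤ → Torus d → ℂ} (hu : ∀ k, Summable (transformTerm τ u k))
    (s b : ℝ) :
    bourgainNorm τ s b u ^ 2 = ∑' k, ∫⁻ x : TimeCircle τ,
      (weight s b (x, k) * ‖circleLift (transform τ u k) x‖ₑ) ^ 2 := by
  rw [bourgainNorm, if_pos hu, ← ENNReal.rpow_natCast, ← ENNReal.rpow_mul]
  norm_num [lintegral_transform_eq]

theorem weightedSq_eq_tsum {f : FreqGroup τ d → ℝ≥0∞} (hf : Measurable f) (s b : ℝ) :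
    weightedSq s b f = ∑' k, ∫⁻ x, (weight s b (x, k) * f (x, k)) ^ 2 :=
  lintegral_freqMeasure (((measurable_weight s b).mul hf).pow_const 2)

theorem weightedSq_freqLift_le {u : ℤ → Torus d → ℂ} (hu : ∀ k, Summable (transformTerm τ u k))
    (s b : ℝ) :
    weightedSq s b (fun z : FreqGroup τ d => ‖freqLift u z‖ₑ) ≤ bourgainNorm τ s b u ^ 2 := by
  rw [bourgainNorm_sq_eq_tsum hu, weightedSq_eq_tsum (measurable_freqLift u).enorm]
  gcongr with k x
  exact enorm_indicator_le_enorm_self _ _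

theorem exists_ne_zero_le_weight (τ : ℝ) [Fact (0 < τ)] (s b : ℝ) (k : Fin d → ℤ) :
    ∃ c : ℝ≥0∞, c ≠ 0 ∧ ∀ x : TimeCircle τ, c ≤ weight s b (x, k) := by
  have h_cont : Continuous fun x : TimeCircle τ =>
      bracket (freqVec k) ^ s * modWeight (x, k) ^ b := by
    have h_mod : Continuous fun x : TimeCircle τ => modWeight (x, k) := by
      have := continuous_dCircle τ
      unfold modWeight bracket
      fun_prop (disch := norm_num)
    exact continuous_const.mul (h_mod.rpow_const fun x => Or.inl (modWeight_pos _).ne')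
  obtain ⟨x₀, -, hx₀⟩ := isCompact_univ.exists_isMinOn Set.univ_nonempty h_cont.continuousOn
  refine ⟨weight s b (x₀, k), ?_, fun x => ENNReal.ofReal_le_ofReal (hx₀ (Set.mem_univ x))⟩
  have hk := bracket_pos (freqVec k)
  have h_mod := modWeight_pos (x₀, k)
  exact (ENNReal.ofReal_pos.2 (by positivity)).ne'

theorem memLp_two_of_weightedSq_ne_top {s b : ℝ} {A : FreqGroup τ d → ℂ} (hA : Measurable A)
    (h : weightedSq s b (fun z => ‖A z‖ₑ) ≠ ∞) (k : Fin d → ℤ) :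
    MemLp (fun σ : TimeCircle τ => A (σ, k)) 2 := by
  have h_meas : Measurable fun σ : TimeCircle τ => A (σ, k) := hA.comp measurable_prodMk_right
  refine memLp_two_of_lintegral_ne_top h_meas.aestronglyMeasurable fun h_top => h ?_
  obtain ⟨c, hc, hc_le⟩ := exists_ne_zero_le_weight τ s b k
  rw [← top_le_iff, weightedSq_eq_tsum hA.enorm]
  calc ∞ = c ^ 2 * ∫⁻ x, ‖A (x, k)‖ₑ ^ 2 := by
        rw [h_top, ENNReal.mul_top (pow_ne_zero 2 hc)]
    _ = ∫⁻ x, (c * ‖A (x, k)‖ₑ) ^ 2 := by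
        simp only [mul_pow]
        rw [lintegral_const_mul _ (h_meas.enorm.pow_const 2)]
    _ ≤ ∫⁻ x, (weight s b (x, k) * ‖A (x, k)‖ₑ) ^ 2 := by
        gcongr with x
        exact hc_le x
    _ ≤ _ := ENNReal.le_tsum k

theorem bourgainNorm_sq_eq_weightedSq {s b : ℝ} {v : ℤ → Torus d → ℂ} {A : FreqGroup τ d → ℂ}
    (hA : Measurable A) (hv : ∀ k n, fourierCoeff (fun σ => A (σ, k)) n = τ * spaceCoeff (v n) k)
    (h : weightedSq s b (fun z => ‖A z‖ₑ) ≠ ∞) :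
    bourgainNorm τ s b v ^ 2 = weightedSq s b fun z => ‖A z‖ₑ := by
  have h_mem := memLp_two_of_weightedSq_ne_top hA h
  rw [bourgainNorm_sq_eq_tsum fun k => summable_transformTerm (h_mem k) (hv k),
    weightedSq_eq_tsum hA.enorm]
  refine tsum_congr fun k => lintegral_congr_ae ?_
  filter_upwards [circleLift_transform_ae_eq (h_mem k) (hv k)] with x hx
  rw [hx]

end FreqLift

/-! ### The estimates for sequences of functions -/

section Estimates

variable {τ : ℝ} {d : ℕ}

theorem seqLpNorm_four_pow_four (τ : ℝ) (u : ℤ → Torus d → ℂ) :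
    seqLpNorm 4 τ u ^ 4 = ENNReal.ofReal τ * ∑' n, ∫⁻ x, ‖u n x‖ₑ ^ 4 := by
  have h_pow (n : ℤ) : eLpNorm (u n) (4 : ℝ≥0) volume ^ ((4 : ℝ≥0) : ℝ) =
      ∫⁻ x, ‖u n x‖ₑ ^ 4 := by
    rw [eLpNorm_nnreal_pow_eq_lintegral four_ne_zero]
    simp only [NNReal.coe_ofNat, ENNReal.rpow_ofNat]
  simp only [seqLpNorm, h_pow]
  rw [← ENNReal.rpow_natCast, ← ENNReal.rpow_mul]
  norm_num

variable [hτ : Fact (0 < τ)]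

theorem lintegral_enorm_sq_conv_freqLift_le {s b : ℝ} {K : ℝ≥0∞} (hB : BilinearBound τ d s b K)
    {u : ℤ → Torus d → ℂ} (hu : ∀ k, Summable (transformTerm τ u k)) :
    ∫⁻ z, ‖conv (freqLift u) (freqLift u) z‖ₑ ^ 2 ∂(freqMeasure τ d) ≤
      4 * K * bourgainNorm τ (s / 2) b u ^ 4 := calc
  _ ≤ ∫⁻ z, ((fun z => ‖freqLift u z‖ₑ) ⋆ₗ[freqMeasure τ d] fun z => ‖freqLift u z‖ₑ) z ^ 2
        ∂(freqMeasure τ d) := by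
      gcongr with z
      exact enorm_conv_le _ _ z
  _ ≤ 4 * K * weightedSq (s / 2) b (fun z => ‖freqLift u z‖ₑ) ^ 2 :=
      lintegral_sq_lconvolution_self_le hB (measurable_freqLift u).enorm (isFiltered_freqLift u)
  _ ≤ 4 * K * (bourgainNorm τ (s / 2) b u ^ 2) ^ 2 := by
      gcongr
      exact weightedSq_freqLift_le hu _ _
  _ = 4 * K * bourgainNorm τ (s / 2) b u ^ 4 := by rw [← pow_mul]

theorem seqLpNorm_filterOp_pow_four {u : ℤ → Torus d → ℂ}
    (hu : ∀ k, Summable (transformTerm τ u k))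
    (h : ∫⁻ z, ‖conv (freqLift u) (freqLift u) z‖ₑ ^ 2 ∂(freqMeasure τ d) ≠ ∞) :
    seqLpNorm 4 τ (fun n => filterOp τ (u n)) ^ 4 =
      ENNReal.ofReal ((2 * Real.pi) ^ d / (2 * Real.pi)) *
        ∫⁻ z, ‖conv (freqLift u) (freqLift u) z‖ₑ ^ 2 ∂(freqMeasure τ d) := by
  have h_int := integrable_freqLift (τ := τ) u
  have h_band := bandLimited_freqLift (τ := τ) u
  have h_meas := measurable_freqLift (τ := τ) u
  have h_sq (n : ℤ) (x : Torus d) :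
      ‖filterOp τ (u n) x‖ₑ ^ 4 =
        ‖invTransform (conv (freqLift u) (freqLift u : FreqGroup τ d → ℂ)) n x‖ₑ ^ 2 := by
    rw [invTransform_conv h_int h_int, invTransform_freqLift hu, enorm_mul]
    ring
  have h_const : ENNReal.ofReal τ * (ENNReal.ofReal ((2 * Real.pi) ^ d) *
      ENNReal.ofReal (2 * Real.pi * τ)⁻¹) = ENNReal.ofReal ((2 * Real.pi) ^ d / (2 * Real.pi)) := by
    have hτ0 := hτ.out
    rw [← ENNReal.ofReal_mul (by positivity), ← ENNReal.ofReal_mul hτ0.le]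
    congr 1
    field_simp
  simp only [seqLpNorm_four_pow_four, h_sq]
  rw [tsum_lintegral_enorm_sq_invTransform (h_band.conv h_band) (measurable_conv h_meas h_meas)
    (integrable_conv h_int h_int) h, ← h_const]
  simp only [mul_assoc]

theorem seqLpNorm_filterOp_le {s b : ℝ} {K : ℝ≥0} (hB : BilinearBound τ d s b K)
    {u : ℤ → Torus d → ℂ} (hu : MemBourgain τ (s / 2) b u) :
    seqLpNorm 4 τ (fun n => filterOp τ (u n)) ≤
      ((((2 * Real.pi) ^ d / (2 * Real.pi)).toNNReal * (4 * K)) ^ (1 / 4 : ℝ) : ℝ≥0) *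
        bourgainNorm τ (s / 2) b u := by
  have h_conv := lintegral_enorm_sq_conv_freqLift_le hB hu.summable
  have h_ne_top : (4 * K * bourgainNorm τ (s / 2) b u ^ 4 : ℝ≥0∞) ≠ ∞ :=
    ENNReal.mul_ne_top (by finiteness) (ENNReal.pow_ne_top hu.2.ne)
  have h_root (c : ℝ≥0) : ((c ^ (1 / 4 : ℝ) : ℝ≥0) : ℝ≥0∞) ^ 4 = c := by
    rw [← ENNReal.coe_pow, ← NNReal.rpow_natCast, ← NNReal.rpow_mul]
    norm_num
  rw [← (ENNReal.pow_right_strictMono four_ne_zero).le_iff_le, mul_pow, h_root,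
    seqLpNorm_filterOp_pow_four hu.summable (ne_top_of_le_ne_top h_ne_top h_conv)]
  calc _ ≤ ENNReal.ofReal ((2 * Real.pi) ^ d / (2 * Real.pi)) *
        (4 * K * bourgainNorm τ (s / 2) b u ^ 4) := by gcongr
    _ = _ := by
      rw [ENNReal.ofReal]
      push_cast
      ring

/-- The time-space Fourier transform of the product `Π_τ u₀ Π_τ ū₁ Π_τ u₂`. -/
def cubicLift (u : Fin 3 → ℤ → Torus d → ℂ) : FreqGroup τ d → ℂ :=
  conv (conv (freqLift (u 0)) (freqLift (u 2))) (reflect (freqLift (u 1)))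

theorem measurable_cubicLift (u : Fin 3 → ℤ → Torus d → ℂ) :
    Measurable (cubicLift u : FreqGroup τ d → ℂ) :=
  measurable_conv (measurable_conv (measurable_freqLift _) (measurable_freqLift _))
    (measurable_reflect (measurable_freqLift _))

theorem enorm_cubicLift_le (u : Fin 3 → ℤ → Torus d → ℂ) (z : FreqGroup τ d) :
    ‖cubicLift u z‖ₑ ≤ triConv (fun i z => ‖freqLift (u i) z‖ₑ) z := by
  refine (enorm_conv_le _ _ z).trans ?_
  simp only [reflect, RCLike.enorm_conj]
  exact lconvolution_mono_left (enorm_conv_le _ _) _ z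

theorem fourierCoeff_cubicLift {u : Fin 3 → ℤ → Torus d → ℂ}
    (hu : ∀ i k, Summable (transformTerm τ (u i) k)) (k : Fin d → ℤ) (n : ℤ) :
    fourierCoeff (fun σ : TimeCircle τ => (filterBand τ d).indicator (cubicLift u) (σ, k)) n =
      τ * spaceCoeff (cubic τ u n) k := by
  have h_int (i : Fin 3) := integrable_freqLift (τ := τ) (u i)
  have h_band (i : Fin 3) := bandLimited_freqLift (τ := τ) (u i)
  have h_int₀₂ := integrable_conv (h_int 0) (h_int 2)
  have h_int₁ := integrable_reflect (h_int 1)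
  have h_inv : invTransform (cubicLift u : FreqGroup τ d → ℂ) n = fun x =>
      filterOp τ (u 0 n) x * filterOp τ (fun y => starRingEnd ℂ (u 1 n y)) x *
        filterOp τ (u 2 n) x := by
    ext x
    rw [cubicLift, invTransform_conv h_int₀₂ h_int₁, invTransform_conv (h_int 0) (h_int 2),
      invTransform_reflect, invTransform_freqLift (hu 0), invTransform_freqLift (hu 1),
      invTransform_freqLift (hu 2), filterOp_conj, mul_right_comm]
  have h_coeff := (((h_band 0).conv (h_band 2)).conv (h_band 1).reflect).fourierCoeff_eq
    (integrable_conv h_int₀₂ h_int₁) n k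
  rw [cubic, spaceCoeff_filterOp, ← h_inv]
  split_ifs with hk
  · have h_mem (σ : TimeCircle τ) : (σ, k) ∈ filterBand τ d := hk
    simp only [Set.indicator_of_mem (h_mem _)]
    exact h_coeff
  · have h_notMem (σ : TimeCircle τ) : (σ, k) ∉ filterBand τ d := hk
    simp [Set.indicator_of_notMem (h_notMem _), fourierCoeff]

theorem bourgainNorm_cubic_le_of_weightedSq_triConv_le {s b : ℝ} {u : Fin 3 → ℤ → Torus d → ℂ}
    (hu : ∀ i k, Summable (transformTerm τ (u i) k)) {M : ℝ≥0∞} (hM : M ≠ ∞)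
    (h : weightedSq s b ((filterBand τ d).indicator (triConv fun i z => ‖freqLift (u i) z‖ₑ)) ≤
      M ^ 2) :
    bourgainNorm τ s b (cubic τ u) ≤ M := by
  set D : FreqGroup τ d → ℂ := (filterBand τ d).indicator (cubicLift u)
  have h_le : weightedSq s b (fun z => ‖D z‖ₑ) ≤ M ^ 2 := by
    refine le_trans ?_ h
    unfold weightedSq
    gcongr with z
    exact (enorm_indicator_eq_indicator_enorm _ _).trans_le
      (Set.indicator_le_indicator (enorm_cubicLift_le u z))
  rw [← (ENNReal.pow_right_strictMono two_ne_zero).le_iff_le]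
  exact (bourgainNorm_sq_eq_weightedSq ((measurable_cubicLift u).indicator measurableSet_filterBand)
    (fourierCoeff_cubicLift hu) (ne_top_of_le_ne_top (ENNReal.pow_ne_top hM) h_le)).trans_le h_le

theorem bourgainNorm_cubic_le {s b : ℝ} (hs : 0 ≤ s) {K : ℝ≥0} (hB : BilinearBound τ d s b K)
    {u : Fin 3 → ℤ → Torus d → ℂ} (hu : ∀ i, MemBourgain τ s b (u i)) :
    bourgainNorm τ s (-b) (cubic τ u) ≤ (3 * ((2 : ℝ) ^ s).toNNReal ^ 2 * K : ℝ≥0) *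
      bourgainNorm τ s b (u 0) * bourgainNorm τ s b (u 1) * bourgainNorm τ s b (u 2) := by
  have h_norm₀ := (hu 0).2.ne
  have h_norm₁ := (hu 1).2.ne
  have h_norm₂ := (hu 2).2.ne
  refine bourgainNorm_cubic_le_of_weightedSq_triConv_le (fun i => (hu i).summable)
    (by finiteness) ?_
  calc _ ≤ 9 * ENNReal.ofReal (2 ^ s) ^ 4 * (K : ℝ≥0∞) ^ 2 *
        ∏ j, weightedSq s b (fun z : FreqGroup τ d => ‖freqLift (u j) z‖ₑ) :=
        weightedSq_triConv_le_of_nonneg hs hB (fun i => (measurable_freqLift (u i)).enorm)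
          fun i => isFiltered_freqLift (u i)
    _ ≤ 9 * ENNReal.ofReal (2 ^ s) ^ 4 * (K : ℝ≥0∞) ^ 2 * ∏ j, bourgainNorm τ s b (u j) ^ 2 := by
        gcongr with j
        exact weightedSq_freqLift_le (hu j).summable _ _
    _ = _ := by
        rw [Fin.prod_univ_three, ENNReal.ofReal]
        push_cast
        ring

theorem bourgainNorm_zero_cubic_le {s b : ℝ} {K : ℝ≥0} (hB : BilinearBound τ d s b K)
    {u : Fin 3 → ℤ → Torus d → ℂ} (p : Equiv.Perm (Fin 3)) (hu₀ : MemBourgain τ s b (u (p 0)))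
    (hu₁ : MemBourgain τ s b (u (p 1))) (hu₂ : MemBourgain τ 0 b (u (p 2))) :
    bourgainNorm τ 0 (-b) (cubic τ u) ≤ K * bourgainNorm τ s b (u (p 0)) *
      bourgainNorm τ s b (u (p 1)) * bourgainNorm τ 0 b (u (p 2)) := by
  have h_summable (i : Fin 3) : ∀ k, Summable (transformTerm τ (u i) k) := by
    obtain ⟨i, rfl⟩ := p.surjective i
    fin_cases i
    exacts [hu₀.summable, hu₁.summable, hu₂.summable]
  have h_norm₀ := hu₀.2.ne
  have h_norm₁ := hu₁.2.ne
  have h_norm₂ := hu₂.2.ne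
  refine bourgainNorm_cubic_le_of_weightedSq_triConv_le h_summable (by finiteness) ?_
  calc _ ≤ (K : ℝ≥0∞) ^ 2 * ∏ j, weightedSq (if j = p 2 then 0 else s) b
        (fun z : FreqGroup τ d => ‖freqLift (u j) z‖ₑ) :=
        weightedSq_triConv_le hB (fun i => (measurable_freqLift (u i)).enorm)
          (fun i => isFiltered_freqLift (u i)) (p 2)
    _ ≤ (K : ℝ≥0∞) ^ 2 * ∏ j, bourgainNorm τ (if j = p 2 then 0 else s) b (u j) ^ 2 := by
        gcongr with j
        exact weightedSq_freqLift_le (h_summable j) _ _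
    _ = _ := by
        rw [← Equiv.prod_comp p, Fin.prod_univ_three]
        simp only [p.injective.eq_iff, if_true, Fin.reduceEq, if_false]
        ring

end Estimates

end DiscBourgain

end

theorem theorem2p4_general (d : ℕ) (s b : ℝ) (hs : max 0 ((d : ℝ) / 2 - 1) < s)
    (hb : max (1 / 4) (((d : ℝ) / 2 - s + 1) / 4) < b) :
    (∃ C : ℝ≥0, ∀ τ : ℝ, 0 < τ → ∀ u : ℤ → Torus d → ℂ,
      MemBourgain τ (s / 2) b u →
        seqLpNorm 4 τ (fun n => filterOp τ (u n)) ≤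
          C * bourgainNorm τ (s / 2) b u) ∧
    (∃ C : ℝ≥0, ∀ τ : ℝ, 0 < τ → ∀ u : Fin 3 → ℤ → Torus d → ℂ,
      (∀ i, MemBourgain τ s b (u i)) →
        bourgainNorm τ s (-b) (cubic τ u) ≤
          C * bourgainNorm τ s b (u 0) * bourgainNorm τ s b (u 1) *
            bourgainNorm τ s b (u 2)) ∧
    (∃ C : ℝ≥0, ∀ τ : ℝ, 0 < τ → ∀ u : Fin 3 → ℤ → Torus d → ℂ,
      ∀ p : Equiv.Perm (Fin 3),
      MemBourgain τ s b (u (p 0)) → MemBourgain τ s b (u (p 1)) →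
      MemBourgain τ 0 b (u (p 2)) →
        bourgainNorm τ 0 (-b) (cubic τ u) ≤
          C * bourgainNorm τ s b (u (p 0)) * bourgainNorm τ s b (u (p 1)) *
            bourgainNorm τ 0 b (u (p 2))) := by
  obtain ⟨hs_pos, hs_dim⟩ := max_lt_iff.1 hs
  have h_max : max (1 / 4) (((d : ℝ) / 2 - s + 1) / 4) < 1 / 2 :=
    max_lt (by norm_num) (by linarith)
  obtain ⟨b', hb', hb'_lt_min⟩ := exists_between (lt_min hb h_max)
  obtain ⟨hb'_lt, hb'_half⟩ := lt_min_iff.1 hb'_lt_min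
  obtain ⟨hb'_quarter, hb'_dim⟩ := max_lt_iff.1 hb'
  obtain ⟨K, hK⟩ :=
    exists_lconvolution_weight_le (d := d) hs_pos hb'_quarter hb'_half (by linarith)
  have h_bilinear (τ : ℝ) [Fact (0 < τ)] : BilinearBound τ d s b K :=
    (bilinearBound_of_lconvolution_weight_le (hK τ)).mono hb'_lt.le
  exact ⟨
    ⟨_, fun τ hτ _ hu =>
      haveI := Fact.mk hτ
      seqLpNorm_filterOp_le (h_bilinear τ) hu⟩,
    ⟨_, fun τ hτ _ hu =>
      haveI := Fact.mk hτ
      bourgainNorm_cubic_le hs_pos.le (h_bilinear τ) hu⟩,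
    ⟨_, fun τ hτ _ p hu₀ hu₁ hu₂ =>
      haveI := Fact.mk hτ
      bourgainNorm_zero_cubic_le (h_bilinear τ) p hu₀ hu₁ hu₂⟩⟩

theorem theorem2p4 (d : ℕ) (hd : 1 ≤ d) (s₀ b₀ b₁ : ℝ)
    (hs₀ : max 0 ((d : ℝ) / 2 - 1) < s₀)
    (hb₀ : b₀ ∈ Set.Ioo (1 / 2 : ℝ) (min (1 / 2 + 1 / 4 * (s₀ - (d : ℝ) / 2 + 1)) (3 / 4)))
    (hb₁ : b₁ = 1 - b₀) :
    (∃ C : ℝ≥0, ∀ τ ∈ Set.Ioc (0 : ℝ) 1, ∀ u : ℤ → Torus d → ℂ,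
      MemBourgain τ (s₀ / 2) b₁ u →
        seqLpNorm 4 τ (fun n => filterOp τ (u n)) ≤
          C * bourgainNorm τ (s₀ / 2) b₁ u) ∧
    (∃ C : ℝ≥0, ∀ τ ∈ Set.Ioc (0 : ℝ) 1, ∀ u : Fin 3 → ℤ → Torus d → ℂ,
      (∀ i, MemBourgain τ s₀ b₁ (u i)) →
        bourgainNorm τ s₀ (-b₁) (cubic τ u) ≤
          C * bourgainNorm τ s₀ b₁ (u 0) * bourgainNorm τ s₀ b₁ (u 1) *
            bourgainNorm τ s₀ b₁ (u 2)) ∧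
    (∃ C : ℝ≥0, ∀ τ ∈ Set.Ioc (0 : ℝ) 1, ∀ u : Fin 3 → ℤ → Torus d → ℂ,
      ∀ p : Equiv.Perm (Fin 3),
      MemBourgain τ s₀ b₁ (u (p 0)) → MemBourgain τ s₀ b₁ (u (p 1)) →
      MemBourgain τ 0 b₁ (u (p 2)) →
        bourgainNorm τ 0 (-b₁) (cubic τ u) ≤
          C * bourgainNorm τ s₀ b₁ (u (p 0)) * bourgainNorm τ s₀ b₁ (u (p 1)) *
            bourgainNorm τ 0 b₁ (u (p 2))) := by
  have hb : max (1 / 4) (((d : ℝ) / 2 - s₀ + 1) / 4) < b₁ := by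
    obtain ⟨h_dim, h_three_quarters⟩ := lt_min_iff.1 hb₀.2
    exact max_lt (by linarith) (by linarith)
  obtain ⟨⟨C₁, h₁⟩, ⟨C₂, h₂⟩, ⟨C₃, h₃⟩⟩ := theorem2p4_general d s₀ b₁ hs₀ hb
  exact ⟨⟨C₁, fun τ hτ => h₁ τ hτ.1⟩, ⟨C₂, fun τ hτ => h₂ τ hτ.1⟩, ⟨C₃, fun τ hτ => h₃ τ hτ.1⟩⟩
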